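/- Fix $n$, $m\in\mathbb{C}$ and $w\in\mathbb{R}$. Manifolds are smooth, Hausdorff, second countable and without boundary. For such a manifold $M$, $\Psi^m(M)$ is the space of (classical, scalar) pseudodifferential operators of order $m$, i.e. continuous linear operators $C_c^\infty(M)\to C^\infty(M)$ whose Schwartz kernel is smooth off the diagonal and which in any local coordinates are of the form $p(x,D)+R$, where $R$ has a smooth kernel and $p\sim\sum_{j\ge 0}p_{m-j}$ with $p_{m-j}(x,\xi)$ smooth for $\xi\neq 0$ and homogeneous of degree $m-j$ in $\xi$. $\Psi^{-\infty}(M)$ is the space of operators with smooth kernel. Let $M_n(\mathbb{R})_+$ be the set of positive definite symmetric $n\times n$ matrices and let $S_m(M_n(\mathbb{R})_+\times\mathbb{R}^n)$ be the space of functions $a(g,\xi)$ in $C^\infty(M_n(\mathbb{R})_+\times(\mathbb{R}^n\setminus 0))$ with $a(g,t\xi)=t^m a(g,\xi)$ for all $t>0$. A \emph{Riemannian invariant $\Psi$DO of order $m$ and weight $w$} is the datum, on every Riemannian manifold $(M^n,g)$, of an operator $P_g\in\Psi^m(M)$ such that: (i) for each $j=0,1,\dots$ there are finitely many $a_{j\beta}\in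 S_{m-j}(M_n(\mathbb{R})_+\times\mathbb{R}^n)$, independent of $(M,g)$ and of the coordinates, such that on every $(M^n,g)$ and in any local coordinates $P_g$ has symbol $\sum_{j\ge0} p_{g,m-j}$ with $$p_{g,m-j}(x,\xi)=\sum_{\beta}\Big(\prod_{\alpha,k,l}(\partial^\alpha g_{kl}(x))^{\beta(\alpha,k,l)}\Big)\,a_{j\beta}(g(x),\xi);$$ (ii) $P_{tg}=t^{-w}P_g$ modulo $\Psi^{-\infty}(M)$ for every $t>0$. It is \emph{admissible} if in (i) one can take $a_{0\beta}=0$ for $\beta\neq 0$, i.e. its principal symbol in local coordinates is $a(g(x),\xi)$ for a fixed $a\in S_m(M_n(\mathbb{R})_+\times\mathbb{R}^n)$. \textbf{Proposition.} Let $P_g$ be a Riemannian invariant $\Psi$DO of order $m$ and weight $w$ which is admissible and elliptic (on every $(M^n,g)$ the principal symbol of $P_g$ does not vanish for $\xi\ne0$). For each Riemannian manifold $(M^n,g)$ let $Q_g\in\Psi^{-m}(M)$ be a parametrix for $P_g$, i.e. $P_gQ_g=Q_gP_g=1$ modulo $\Psi^{-\infty}(M)$ (the products being formed, modulo $\Psi^{-\infty}(M)$,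 with properly supported representatives of $P_g$ and $Q_g$). Then $Q_g$ is a Riemannian invariant $\Psi$DO of order $-m$ and weight $-w$; in particular its homogeneous symbols are given by universal expressions in the metric and its derivatives of the form (i), with $m$ replaced by $-m$. -/

import Mathlib

open scoped Manifold ContDiff
open Bundle

universe u

noncomputable section

namespace InvPsiDO

/-! ### Euclidean preliminaries -/

/-- The model space `ℝⁿ`. -/
abbrev Eucl (n : ℕ) : Type := EuclideanSpace ℝ (Fin n)

/-- Iterated partial derivatives: `pd [i₁, …, iₖ] f = ∂_{i₁} ⋯ ∂_{iₖ} f`. A list plays the role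
of a multi-order (on smooth functions only the multiplicities matter), its length that of the
total order. -/
def pd {n : ℕ} {F : Type*} [NormedAddCommGroup F] [NormedSpace ℝ F] :
    List (Fin n) → (Eucl n → F) → Eucl n → F
  | [], f => f
  | i :: l, f => fun x => fderiv ℝ (pd l f) x (EuclideanSpace.single i 1)

/-! ### Symbols on `U × ℝⁿ` -/

/-- `S_m(U × ℝⁿ)`, `m ∈ ℂ`: smooth functions on `U × (ℝⁿ ∖ 0)`, homogeneous of degree `m` in the
second variable. -/
structure IsHomogeneousSymbol {n : ℕ} (U : Set (Eucl n)) (m : ℂ)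
    (p : Eucl n → Eucl n → ℂ) : Prop where
  smooth : ContDiffOn ℝ ∞ (Function.uncurry p) (U ×ˢ {0}ᶜ)
  homogeneous : ∀ x ∈ U, ∀ ξ : Eucl n, ξ ≠ 0 → ∀ t : ℝ, 0 < t → p x (t • ξ) = (t : ℂ) ^ m * p x ξ

/-- `p` belongs to `S^m(U × ℝⁿ)` and has the asymptotic expansion `p ∼ ∑_{j ≥ 0} σ j`, where
`σ j` is homogeneous of degree `m - j`. -/
structure HasSymbolExpansion {n : ℕ} (U : Set (Eucl n)) (m : ℂ)
    (p : Eucl n → Eucl n → ℂ) (σ : ℕ → Eucl n → Eucl n → ℂ) : Prop where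
  smooth : ContDiffOn ℝ ∞ (Function.uncurry p) (U ×ˢ Set.univ)
  homogeneous : ∀ j : ℕ, IsHomogeneousSymbol U (m - j) (σ j)
  bound : ∀ (N : ℕ) (K : Set (Eucl n)), IsCompact K → K ⊆ U → ∀ α β : List (Fin n),
    ∃ C : ℝ, ∀ x ∈ K, ∀ ξ : Eucl n, 1 ≤ ‖ξ‖ →
      ‖pd α (fun x' => pd β (fun ξ' => p x' ξ' - ∑ j ∈ Finset.range N, σ j x' ξ') ξ) x‖
        ≤ C * ‖ξ‖ ^ (m.re - β.length - N)

/-- The operator `p(x, D)`, i.e. `p(x,D)v(x) = (2π)⁻ⁿ ∫ e^{i x·ξ} p(x,ξ) v̂(ξ) dξ`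
with `v̂(ξ) = ∫ e^{-i y·ξ} v(y) dy`. -/
def quantize {n : ℕ} (p : Eucl n → Eucl n → ℂ) (v : Eucl n → ℂ) (x : Eucl n) : ℂ :=
  ((2 * Real.pi : ℝ) : ℂ) ^ (-(n : ℤ)) *
    ∫ ξ : Eucl n, Complex.exp (Complex.I * (inner ℝ x ξ : ℝ)) * p x ξ *
      ∫ y : Eucl n, Complex.exp (-(Complex.I * (inner ℝ y ξ : ℝ))) * v y

/-! ### Manifolds, metrics, function spaces -/

/-- Smooth manifolds of dimension `n` (without boundary, Hausdorff, second countable). -/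
structure SmoothMfd (n : ℕ) : Type (u + 1) where
  carrier : Type u
  [top : TopologicalSpace carrier]
  [charted : ChartedSpace (Eucl n) carrier]
  [isManifold : IsManifold (𝓡 n) ∞ carrier]
  [t2 : T2Space carrier]
  [secondCountable : SecondCountableTopology carrier]

instance (n : ℕ) : CoeSort (SmoothMfd.{u} n) (Type u) := ⟨SmoothMfd.carrier⟩

attribute [instance] SmoothMfd.top SmoothMfd.charted SmoothMfd.isManifold SmoothMfd.t2
  SmoothMfd.secondCountable

variable {n : ℕ}

/-- Smooth Riemannian metrics on `M`. -/
abbrev RiemMetric (M : SmoothMfd.{u} n) : Type u :=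
  ContMDiffRiemannianMetric (𝓡 n) ∞ (Eucl n) (fun x : M => TangentSpace (𝓡 n) x)

set_option synthInstance.maxHeartbeats 400000 in
set_option maxHeartbeats 1000000 in
/-- The metric `t g`, for a constant `t > 0`. -/
def scaleMetric {M : SmoothMfd.{u} n} (t : ℝ) (ht : 0 < t) (g : RiemMetric M) : RiemMetric M where
  inner x := t • g.inner x
  symm x v w := by
    change t * g.inner x v w = t * g.inner x w v
    rw [g.symm]
  pos x v hv := mul_pos ht (g.pos x v hv)
  isVonNBounded x := by
    have h := (g.isVonNBounded x).image
      ((Real.sqrt t)⁻¹ • ContinuousLinearMap.id ℝ (TangentSpace (𝓡 n) x))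
    refine h.subset ?_
    intro v hv
    have hs : Real.sqrt t ≠ 0 := (Real.sqrt_pos.2 ht).ne'
    refine ⟨Real.sqrt t • v, ?_, ?_⟩
    · change t * g.inner x v v < 1 at hv
      change g.inner x (Real.sqrt t • v) (Real.sqrt t • v) < 1
      have e : g.inner x (Real.sqrt t • v) (Real.sqrt t • v) = t * g.inner x v v := by
        rw [map_smul, map_smul, smul_apply, smul_smul,
          Real.mul_self_sqrt ht.le, smul_eq_mul]
      rw [e]; exact hv
    · change (Real.sqrt t)⁻¹ • (Real.sqrt t • v) = v
      rw [smul_smul, inv_mul_cancel₀ hs, one_smul]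
  contMDiff := g.contMDiff.const_smul_section

/-- Local coordinates on `M`: homeomorphisms from an open subset of `M` to an open subset of `ℝⁿ`
that are compatible with the smooth structure. -/
abbrev IsLocalCoord (M : SmoothMfd.{u} n) (φ : OpenPartialHomeomorph M (Eucl n)) : Prop :=
  φ ∈ IsManifold.maximalAtlas (𝓡 n) ∞ (M : Type u)

/-- The matrix `(g_{ij}(x))` of the metric in the local coordinates `φ`, for `x ∈ φ.target`. -/
def metricCoord {M : SmoothMfd.{u} n} (g : RiemMetric M) (φ : OpenPartialHomeomorph M (Eucl n))
    (x : Eucl n) : Fin n → Fin n → ℝ := fun i j =>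
  g.inner (φ.symm x) (mfderiv (𝓡 n) (𝓡 n) φ.symm x (EuclideanSpace.single i 1))
    (mfderiv (𝓡 n) (𝓡 n) φ.symm x (EuclideanSpace.single j 1))

/-- `C^∞(M)` (complex valued). -/
def SmoothFn (M : SmoothMfd.{u} n) : Submodule ℂ (M → ℂ) where
  carrier := {f | ContMDiff (𝓡 n) 𝓘(ℝ, ℂ) ∞ f}
  zero_mem' := contMDiff_const
  add_mem' hf hg := ContMDiff.add hf hg
  smul_mem' c _ hf :=
    ((contDiff_const (c := c)).mul contDiff_id : ContDiff ℝ ∞ fun z : ℂ => c * z).contMDiff.comp hf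

/-- `C_c^∞(M)` (complex valued). -/
def TestFn (M : SmoothMfd.{u} n) : Submodule ℂ (M → ℂ) where
  carrier := {f | ContMDiff (𝓡 n) 𝓘(ℝ, ℂ) ∞ f ∧ HasCompactSupport f}
  zero_mem' := ⟨contMDiff_const, HasCompactSupport.zero⟩
  add_mem' hf hg := ⟨ContMDiff.add hf.1 hg.1, hf.2.add hg.2⟩
  smul_mem' c _ hf :=
    ⟨((contDiff_const (c := c)).mul contDiff_id : ContDiff ℝ ∞ fun z : ℂ => c * z).contMDiff.comp
      hf.1, hf.2.mul_left⟩

theorem testFn_le_smoothFn (M : SmoothMfd.{u} n) : TestFn M ≤ SmoothFn M := fun _ h => h.1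

/-- Linear operators from `C_c^∞(M)` to `C^∞(M)`. -/
abbrev Op (M : SmoothMfd.{u} n) : Type u := TestFn M →ₗ[ℂ] SmoothFn M

/-- The identity, as an operator from `C_c^∞(M)` to `C^∞(M)`. -/
def idOp (M : SmoothMfd.{u} n) : Op M := Submodule.inclusion (testFn_le_smoothFn M)

/-- Convergence in `C^∞(M)`: locally uniform convergence of all derivatives in all local
coordinates. -/
def SmoothTendsto {M : SmoothMfd.{u} n} (u : ℕ → M → ℂ) (v : M → ℂ) : Prop :=
  ∀ φ : OpenPartialHomeomorph M (Eucl n), IsLocalCoord M φ →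
    ∀ K : Set (Eucl n), IsCompact K → K ⊆ φ.target → ∀ α : List (Fin n),
      TendstoUniformlyOn (fun k => pd α (u k ∘ φ.symm)) (pd α (v ∘ φ.symm)) Filter.atTop K

/-- Continuity of an operator from `C_c^∞(M)` to `C^∞(M)`: `C_c^∞(M)` is the inductive limit of
the metrizable spaces of smooth functions supported in a fixed compact set, so continuity is
sequential continuity on each of these. -/
def IsContinuousOp {M : SmoothMfd.{u} n} (T : Op M) : Prop :=
  ∀ K : Set M, IsCompact K → ∀ (u : ℕ → TestFn M) (v : TestFn M),
    (∀ k, tsupport (u k : M → ℂ) ⊆ K) → SmoothTendsto (fun k => (u k : M → ℂ)) v →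
      SmoothTendsto (fun k => (T (u k) : M → ℂ)) (T v)

/-! ### Pseudodifferential operators -/

/-- The Schwartz kernel of `T` is smooth on `φ.source × ψ.source`: in the coordinates `φ` for the
first variable and `ψ` for the second one it is given by a smooth function `k`. -/
def HasSmoothKernelOn {M : SmoothMfd.{u} n} (T : Op M)
    (φ ψ : OpenPartialHomeomorph M (Eucl n)) : Prop :=
  ∃ k : Eucl n → Eucl n → ℂ, ContDiffOn ℝ ∞ (Function.uncurry k) (φ.target ×ˢ ψ.target) ∧
    ∀ u : TestFn M, tsupport (u : M → ℂ) ⊆ ψ.source → ∀ x ∈ φ.target,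
      (T u : M → ℂ) (φ.symm x) = ∫ y in ψ.target, k x y * (u : M → ℂ) (ψ.symm y)

/-- `Ψ^{-∞}(M)`: operators with smooth Schwartz kernel on `M × M`. -/
def IsSmoothing {M : SmoothMfd.{u} n} (T : Op M) : Prop :=
  ∀ φ ψ, IsLocalCoord M φ → IsLocalCoord M ψ → HasSmoothKernelOn T φ ψ

/-- The Schwartz kernel of `T` is smooth off the diagonal of `M × M` (which, as `M` is Hausdorff,
is covered by the products of disjoint coordinate domains). -/
def HasKernelSmoothOffDiagonal {M : SmoothMfd.{u} n} (T : Op M) : Prop :=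
  ∀ φ ψ, IsLocalCoord M φ → IsLocalCoord M ψ → Disjoint φ.source ψ.source →
    HasSmoothKernelOn T φ ψ

/-- In the local coordinates `φ` with range `U = φ.target`, the operator `T` has the symbol
`∑_j σ j`, `σ j` of degree `m - j`: on `C_c^∞(U)` one has `T = p(x, D) + R`, where `p ∼ ∑_j σ j`
is in `S^m(U × ℝⁿ)` and `R` has a smooth kernel on `U × U`. -/
def HasSymbolInCoord {M : SmoothMfd.{u} n} (m : ℂ) (T : Op M)
    (φ : OpenPartialHomeomorph M (Eucl n)) (σ : ℕ → Eucl n → Eucl n → ℂ) : Prop :=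
  ∃ p k : Eucl n → Eucl n → ℂ, HasSymbolExpansion φ.target m p σ ∧
    ContDiffOn ℝ ∞ (Function.uncurry k) (φ.target ×ˢ φ.target) ∧
    ∀ u : TestFn M, tsupport (u : M → ℂ) ⊆ φ.source → ∀ x ∈ φ.target,
      (T u : M → ℂ) (φ.symm x) =
        quantize p (φ.target.indicator ((u : M → ℂ) ∘ φ.symm)) x
          + ∫ y in φ.target, k x y * (u : M → ℂ) (φ.symm y)

/-- `Ψ^m(M)`, `m ∈ ℂ`: pseudodifferential operators of order `m` on `M`. -/
structure IsPsiDO {M : SmoothMfd.{u} n} (m : ℂ) (T : Op M) : Prop where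
  continuous : IsContinuousOp T
  offDiagonal : HasKernelSmoothOffDiagonal T
  local_form : ∀ φ, IsLocalCoord M φ → ∃ σ, HasSymbolInCoord m T φ σ

/-- Ellipticity of an operator of order `m`: in all local coordinates the principal symbol does
not vanish for `ξ ≠ 0`. -/
def IsElliptic {M : SmoothMfd.{u} n} (m : ℂ) (T : Op M) : Prop :=
  IsPsiDO m T ∧ ∀ φ, IsLocalCoord M φ → ∀ σ, HasSymbolInCoord m T φ σ →
    ∀ x ∈ φ.target, ∀ ξ : Eucl n, ξ ≠ 0 → σ 0 x ξ ≠ 0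

/-- Properly supported operators: both projections of the support of the Schwartz kernel to `M`
are proper, expressed through the action on functions. -/
structure IsProperlySupported {M : SmoothMfd.{u} n} (T : Op M) : Prop where
  left : ∀ K : Set M, IsCompact K → ∃ L : Set M, IsCompact L ∧
    ∀ u : TestFn M, tsupport (u : M → ℂ) ⊆ K → tsupport (T u : M → ℂ) ⊆ L
  right : ∀ K : Set M, IsCompact K → ∃ L : Set M, IsCompact L ∧
    ∀ u : TestFn M, (∀ y ∈ L, (u : M → ℂ) y = 0) → ∀ x ∈ K, (T u : M → ℂ) x = 0

theorem IsProperlySupported.apply_mem {M : SmoothMfd.{u} n} {T : Op M}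
    (h : IsProperlySupported T) (u : TestFn M) : (T u : M → ℂ) ∈ TestFn M := by
  obtain ⟨L, hL, hT⟩ := h.left _ u.2.2
  exact ⟨(T u).2, hL.of_isClosed_subset (isClosed_tsupport _) (hT u subset_rfl)⟩

/-- A properly supported operator, as an operator from `C_c^∞(M)` to `C_c^∞(M)`. -/
def IsProperlySupported.toTest {M : SmoothMfd.{u} n} {T : Op M} (h : IsProperlySupported T) :
    TestFn M →ₗ[ℂ] TestFn M :=
  ((SmoothFn M).subtype ∘ₗ T).codRestrict (TestFn M) h.apply_mem

/-- `Q ∈ Ψ^{-m}(M)` is a parametrix for `P ∈ Ψ^m(M)`: `P Q = Q P = 1` modulo `Ψ^{-∞}(M)`.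
The products are defined modulo `Ψ^{-∞}(M)`, upon replacing `P` and `Q` by properly supported
operators that agree with them modulo `Ψ^{-∞}(M)`. -/
def IsParametrix {M : SmoothMfd.{u} n} (m : ℂ) (P Q : Op M) : Prop :=
  IsPsiDO (-m) Q ∧
  ∃ (P' Q' : Op M) (hP : IsProperlySupported P') (hQ : IsProperlySupported Q'),
    IsSmoothing (P - P') ∧ IsSmoothing (Q - Q') ∧
    IsSmoothing (P' ∘ₗ hQ.toTest - idOp M) ∧ IsSmoothing (Q' ∘ₗ hP.toTest - idOp M)

/-! ### Riemannian invariant pseudodifferential operators -/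

/-- `M_n(ℝ)_+`: the positive definite (symmetric) matrices. -/
def posDefMatrices (n : ℕ) : Set (Fin n → Fin n → ℝ) := {A | (Matrix.of A).PosDef}

/-- `S_m(M_n(ℝ)_+ × ℝⁿ)`, `m ∈ ℂ`: smooth functions on `M_n(ℝ)_+ × (ℝⁿ ∖ 0)` that are homogeneous
of degree `m` in the second variable. -/
structure IsUniversalSymbol (n : ℕ) (m : ℂ)
    (a : (Fin n → Fin n → ℝ) → Eucl n → ℂ) : Prop where
  smooth : ContDiffOn ℝ ∞ (Function.uncurry a) (posDefMatrices n ×ˢ {0}ᶜ)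
  homogeneous : ∀ A ∈ posDefMatrices n, ∀ ξ : Eucl n, ξ ≠ 0 → ∀ t : ℝ, 0 < t →
    a A (t • ξ) = (t : ℂ) ^ m * a A ξ

/-- Exponents of monomials in the variables `∂^α g_{ij}`, indexed by `(α, i, j)`. -/
abbrev JetExponent (n : ℕ) : Type := (List (Fin n) × Fin n × Fin n) →₀ ℕ

/-- The monomial `∏ (∂^α G_{ij}(x))^{β(α,i,j)}`, for a matrix valued function `G` on `ℝⁿ`. -/
def jetMonomial (G : Eucl n → Fin n → Fin n → ℝ) (β : JetExponent n) (x : Eucl n) : ℝ :=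
  β.prod fun v k => pd v.1 (fun y => G y v.2.1 v.2.2) x ^ k

/-- The finite sum `∑_β (monomial β in the derivatives of G at x) · a_β(G(x), ξ)`. -/
def universalExpr (a : JetExponent n →₀ ((Fin n → Fin n → ℝ) → Eucl n → ℂ))
    (G : Eucl n → Fin n → Fin n → ℝ) (x ξ : Eucl n) : ℂ :=
  a.sum fun β b => (jetMonomial G β x : ℂ) * b (G x) ξ

/-- The datum on any Riemannian manifold `(M, g)` of dimension `n` of an operator
from `C_c^∞(M)` to `C^∞(M)`. -/
abbrev OpFamily (n : ℕ) : Type (u + 1) := ∀ M : SmoothMfd.{u} n, RiemMetric M → Op M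

/-- The finite families `a j = (a_{jβ})_β` of elements of `S_{m-j}(M_n(ℝ)_+ × ℝⁿ)` represent the
symbol of `P_g`, for any Riemannian manifold and in any local coordinates: the component of degree
`m - j` is `∑_β (monomial β in the derivatives of g at x) · a_{jβ}(g(x), ξ)`. -/
def HasUniversalSymbol (m : ℂ) (P : OpFamily.{u} n)
    (a : ℕ → JetExponent n →₀ ((Fin n → Fin n → ℝ) → Eucl n → ℂ)) : Prop :=
  (∀ (j : ℕ) (β : JetExponent n), IsUniversalSymbol n (m - j) (a j β)) ∧
  ∀ (M : SmoothMfd.{u} n) (g : RiemMetric M) (φ : OpenPartialHomeomorph M (Eucl n)),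
    IsLocalCoord M φ →
      HasSymbolInCoord m (P M g) φ (fun j => universalExpr (a j) (metricCoord g φ))

/-- Riemannian invariant pseudodifferential operators of order `m` and weight `w`. -/
structure IsRiemannianInvariantPsiDO (m : ℂ) (w : ℝ) (P : OpFamily.{u} n) : Prop where
  isPsiDO : ∀ (M : SmoothMfd.{u} n) (g : RiemMetric M), IsPsiDO m (P M g)
  universal : ∃ a, HasUniversalSymbol m P a
  weight : ∀ (M : SmoothMfd.{u} n) (g : RiemMetric M) (t : ℝ) (ht : 0 < t),
    IsSmoothing (P M (scaleMetric t ht g) - ((t ^ (-w) : ℝ) : ℂ) • P M g)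

/-- Admissibility: in the universal expression of the principal symbol one can take only the
term without derivatives of the metric, i.e. `p_{g,m}(x, ξ) = a(g(x), ξ)`. -/
def IsAdmissible (m : ℂ) (P : OpFamily.{u} n) : Prop :=
  ∃ a, HasUniversalSymbol m P a ∧ ∀ β, β ≠ 0 → a 0 β = 0

end InvPsiDO

end

open InvPsiDO

/-! Work in one coordinate chart. If `P` and `Q` have full symbols `σ` and `τ`, then `P Q = 1`
modulo smoothing operators forces the formal product `∑ (1/α!) ∂_ξ^α σ · D_x^α τ` to be `1` degree
by degree (`symProd_eq_one`). In its component of index `j` the unknown `τ j` occurs only in `σ 0 *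
τ j` (`symProd_eq_add`). As `σ 0` has no zeros, the equations determine `τ` recursively: `τ j` is
`(σ 0)⁻¹` times an expression in derivatives of `σ` and of the `τ i` with `i < j`.

This recursion stays inside the universal expressions. The class `IsUniv` is closed under sums,
products, `ξ`-derivatives, and `x`-derivatives, the last by the Leibniz and chain rules.
Admissibility handles the division: `σ 0 = a(g(x), ξ)`, so `(σ 0)⁻¹` is again a single coefficient,
with no derivatives of the metric in a denominator. It is a coefficient on all positive definite
matrices because each of them is a constant metric on `ℝⁿ`, where ellipticity applies
(`principal_ne_zero`). The result is `exists_universal_inverse`. Since `Q` is given as a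
pseudodifferential operator, it has some full symbol in each chart, and only its identification with
the universal expression is needed.

For the weight, the symbols of `P_{tg}` and `t^{-w} P_g` agree, so uniqueness of formal inverses
makes the symbols of `Q_{tg}` and `t^w Q_g` agree. Their difference has vanishing full symbol in
every chart and a smooth kernel off the diagonal; gluing of kernels shows that it is smoothing
(`isSmoothing_sub_of_isParametrix`).

The analysis behind `symProd_eq_one` is done at one point `x₀`. A cutoff splits the composite. The
part through points away from `x₀` is integration against a smooth function
(`exists_offDiagonal_kernel`). The part near `x₀` has a symbol given by an integral (`comp_eq`),
expanded by Taylor's formula (`compSymbol_expansion`). Testing on plane waves of high frequency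
shows that an expansion whose operator agrees at `x₀` with a smooth kernel is zero
(`expansion_eq_zero`). Only the values at `x₀` are compared, so the composite need not be shown to
be a pseudodifferential operator. -/

open scoped Topology

noncomputable section

namespace InvPsiDO

variable {n : ℕ}

/-! ### Iterated partial derivatives -/

section PartialDerivatives

variable {F : Type*} [NormedAddCommGroup F] [NormedSpace ℝ F]

/-- The standard basis vectors of `ℝⁿ`. -/
abbrev stdVec (i : Fin n) : Eucl n := EuclideanSpace.single i 1

theorem sum_coord_smul_stdVec (v : Eucl n) : ∑ i, v i • stdVec i = v := by
  simpa using (EuclideanSpace.basisFun (Fin n) ℝ).sum_repr v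

theorem fderiv_apply_eq_sum {f : Eucl n → F} (x v : Eucl n) :
    fderiv ℝ f x v = ∑ i, v i • fderiv ℝ f x (stdVec i) := by
  conv_lhs => rw [← sum_coord_smul_stdVec v]
  simp

theorem pd_cons (i : Fin n) (l : List (Fin n)) (f : Eucl n → F) :
    pd (i :: l) f = fun x => fderiv ℝ (pd l f) x (stdVec i) := rfl

theorem pd_cons_eq_pd_singleton (i : Fin n) (l : List (Fin n)) (f : Eucl n → F) :
    pd (i :: l) f = pd [i] (pd l f) := rfl

theorem pd_append (l l' : List (Fin n)) (f : Eucl n → F) : pd (l ++ l') f = pd l (pd l' f) := by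
  induction l with
  | nil => rfl
  | cons i l ih => rw [List.cons_append, pd_cons, ih, pd_cons]

theorem contDiffOn_pd {U : Set (Eucl n)} (hU : IsOpen U) {f : Eucl n → F}
    (hf : ContDiffOn ℝ ∞ f U) (l : List (Fin n)) : ContDiffOn ℝ ∞ (pd l f) U := by
  induction l with
  | nil => exact hf
  | cons i l ih => exact (ih.fderiv_of_isOpen hU (m := ∞) le_rfl).clm_apply contDiffOn_const

theorem contDiff_pd {f : Eucl n → F} (hf : ContDiff ℝ ∞ f) (l : List (Fin n)) :
    ContDiff ℝ ∞ (pd l f) :=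
  contDiffOn_univ.1 (contDiffOn_pd isOpen_univ hf.contDiffOn l)

theorem pd_differentiableAt {U : Set (Eucl n)} (hU : IsOpen U) {f : Eucl n → F}
    (hf : ContDiffOn ℝ ∞ f U) (l : List (Fin n)) {x : Eucl n} (hx : x ∈ U) :
    DifferentiableAt ℝ (pd l f) x :=
  ((contDiffOn_pd hU hf l).differentiableOn (by simp)).differentiableAt (hU.mem_nhds hx)

theorem pd_eventuallyEq {f g : Eucl n → F} {x : Eucl n} (h : f =ᶠ[𝓝 x] g) (l : List (Fin n)) :
    pd l f =ᶠ[𝓝 x] pd l g := by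
  induction l with
  | nil => exact h
  | cons i l ih =>
    filter_upwards [ih.fderiv (𝕜 := ℝ)] with y hy
    simp only [pd_cons, hy]

theorem pd_congr {U : Set (Eucl n)} (hU : IsOpen U) {f g : Eucl n → F} (h : Set.EqOn f g U)
    (l : List (Fin n)) : Set.EqOn (pd l f) (pd l g) U := fun _ hx =>
  (pd_eventuallyEq (h.eventuallyEq_of_mem (hU.mem_nhds hx)) l).eq_of_nhds

theorem pd_add {U : Set (Eucl n)} (hU : IsOpen U) {f g : Eucl n → F} (hf : ContDiffOn ℝ ∞ f U)
    (hg : ContDiffOn ℝ ∞ g U) (l : List (Fin n)) :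
    Set.EqOn (pd l (fun x => f x + g x)) (fun x => pd l f x + pd l g x) U := by
  induction l with
  | nil => exact fun _ _ => rfl
  | cons i l ih =>
    intro x hx
    have h1 := (pd_congr hU ih [i] hx)
    rw [pd_cons_eq_pd_singleton, h1]
    simp only [pd]
    rw [fderiv_fun_add (pd_differentiableAt hU hf l hx) (pd_differentiableAt hU hg l hx)]
    simp

theorem pd_sub {U : Set (Eucl n)} (hU : IsOpen U) {f g : Eucl n → F} (hf : ContDiffOn ℝ ∞ f U)
    (hg : ContDiffOn ℝ ∞ g U) (l : List (Fin n)) :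
    Set.EqOn (pd l (fun x => f x - g x)) (fun x => pd l f x - pd l g x) U := by
  induction l with
  | nil => exact fun _ _ => rfl
  | cons i l ih =>
    intro x hx
    have h1 := (pd_congr hU ih [i] hx)
    rw [pd_cons_eq_pd_singleton, h1]
    simp only [pd]
    rw [fderiv_fun_sub (pd_differentiableAt hU hf l hx) (pd_differentiableAt hU hg l hx)]
    simp

theorem pd_zero (l : List (Fin n)) : pd l (fun _ : Eucl n => (0 : F)) = fun _ => 0 := by
  induction l with
  | nil => rfl
  | cons i l ih => rw [pd_cons, ih]; simp

theorem pd_const_cons (i : Fin n) (l : List (Fin n)) (c : F) :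
    pd (i :: l) (fun _ : Eucl n => c) = fun _ => 0 := by
  induction l generalizing i with
  | nil => simp [pd]
  | cons j l ih => rw [pd_cons, ih]; simp

theorem pd_sum {U : Set (Eucl n)} (hU : IsOpen U) {ι : Type*} (s : Finset ι)
    {f : ι → Eucl n → F} (hf : ∀ i ∈ s, ContDiffOn ℝ ∞ (f i) U) (l : List (Fin n)) :
    Set.EqOn (pd l (fun x => ∑ i ∈ s, f i x)) (fun x => ∑ i ∈ s, pd l (f i) x) U := by
  classical
  induction s using Finset.induction_on with
  | empty => intro x _; simp [pd_zero]
  | insert a s ha ih =>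
    intro x hx
    have h := pd_add hU (hf a (Finset.mem_insert_self a s)) (ContDiffOn.sum (s := s)
      (fun i hi => hf i (Finset.mem_insert_of_mem hi))) l hx
    have h2 := ih (fun i hi => hf i (Finset.mem_insert_of_mem hi)) hx
    simp only [Finset.sum_insert ha] at h ⊢
    rw [h, h2]

theorem pd_const_mul {U : Set (Eucl n)} (hU : IsOpen U) {f : Eucl n → ℂ}
    (hf : ContDiffOn ℝ ∞ f U) (c : ℂ) (l : List (Fin n)) :
    Set.EqOn (pd l (fun x => c * f x)) (fun x => c * pd l f x) U := by
  induction l with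
  | nil => exact fun _ _ => rfl
  | cons i l ih =>
    intro x hx
    rw [pd_cons_eq_pd_singleton, pd_congr hU ih [i] hx]
    simp only [pd]
    rw [fderiv_const_mul (pd_differentiableAt hU hf l hx)]
    simp

/-- The ways of distributing the entries of a list over two lists. -/
def splits {ι : Type*} : List ι → List (List ι × List ι)
  | [] => [([], [])]
  | i :: l => (splits l).map (fun s => (i :: s.1, s.2)) ++ (splits l).map (fun s => (s.1, i :: s.2))

theorem pd_list_sum {U : Set (Eucl n)} (hU : IsOpen U) {ι : Type*} (s : List ι)
    {f : ι → Eucl n → F} (hf : ∀ i ∈ s, ContDiffOn ℝ ∞ (f i) U) (l : List (Fin n)) :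
    Set.EqOn (pd l (fun x => (s.map fun i => f i x).sum))
      (fun x => (s.map fun i => pd l (f i) x).sum) U := by
  induction s with
  | nil => intro x _; simp [pd_zero]
  | cons a s ih =>
    intro x hx
    have hs : ContDiffOn ℝ ∞ (fun x => (s.map fun i => f i x).sum) U := by
      clear ih
      induction s with
      | nil => simpa using contDiffOn_const
      | cons b s ih' =>
        simp only [List.map_cons, List.sum_cons]
        exact (hf b (by simp)).add (ih' fun i hi => hf i (by
          rcases List.mem_cons.1 hi with h | h <;> simp [h]))
    have h := pd_add hU (hf a (by simp)) hs l hx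
    have h2 := ih (fun i hi => hf i (List.mem_cons_of_mem _ hi)) hx
    simp only [List.map_cons, List.sum_cons] at h ⊢
    rw [h, h2]

/-- The Leibniz rule. -/
theorem pd_mul {U : Set (Eucl n)} (hU : IsOpen U) {f g : Eucl n → ℂ} (hf : ContDiffOn ℝ ∞ f U)
    (hg : ContDiffOn ℝ ∞ g U) (l : List (Fin n)) :
    Set.EqOn (pd l (fun x => f x * g x))
      (fun x => ((splits l).map fun s => pd s.1 f x * pd s.2 g x).sum) U := by
  induction l with
  | nil => intro x _; simp [splits, pd]
  | cons i l ih =>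
    intro x hx
    rw [pd_cons_eq_pd_singleton, pd_congr hU ih [i] hx, pd_list_sum hU _ (fun s _ =>
      (contDiffOn_pd hU hf s.1).mul (contDiffOn_pd hU hg s.2)) [i] hx]
    have : ∀ s : List (Fin n) × List (Fin n), pd [i] (fun x => pd s.1 f x * pd s.2 g x) x =
        pd (i :: s.1) f x * pd s.2 g x + pd s.1 f x * pd (i :: s.2) g x := by
      intro s
      simp only [pd]
      rw [fderiv_fun_mul (pd_differentiableAt hU hf _ hx) (pd_differentiableAt hU hg _ hx)]
      simp only [_root_.add_apply, _root_.smul_apply, smul_eq_mul]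
      ring
    simp only [this, List.sum_map_add, splits, List.map_append, List.map_map, List.sum_append]
    rfl

theorem pd_support_subset (f : Eucl n → F) (l : List (Fin n)) : tsupport (pd l f) ⊆ tsupport f := by
  induction l with
  | nil => exact subset_rfl
  | cons i l ih =>
    refine (closure_mono ?_).trans ((tsupport_fderiv_subset ℝ).trans ih)
    intro x hx h
    exact hx (by simp [pd_cons, h])

variable {E : Type*} [NormedAddCommGroup E] [NormedSpace ℝ E]

/-- A partial derivative in the first slot is the total derivative of the uncurried function on
`(stdVec i, 0)`, so joint smoothness survives each differentiation. -/
theorem contDiffOn_pd_fst {Ω : Set (Eucl n × E)} (hΩ : IsOpen Ω) {f : Eucl n → E → F}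
    (hf : ContDiffOn ℝ ∞ (Function.uncurry f) Ω) (l : List (Fin n)) :
    ContDiffOn ℝ ∞ (Function.uncurry fun x t => pd l (fun x' => f x' t) x) Ω := by
  induction l with
  | nil => exact hf
  | cons i l ih =>
    have h := (ih.fderiv_of_isOpen hΩ (m := ∞) le_rfl).clm_apply
      (contDiffOn_const (c := ((stdVec i : Eucl n), (0 : E))))
    refine h.congr ?_
    rintro ⟨x, t⟩ hx
    have hd : DifferentiableAt ℝ (Function.uncurry fun x t => pd l (fun x' => f x' t) x) (x, t) :=
      (ih.differentiableOn (by simp)).differentiableAt (hΩ.mem_nhds hx)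
    have hp : HasFDerivAt (fun x' : Eucl n => (x', t)) (ContinuousLinearMap.inl ℝ (Eucl n) E) x :=
      hasFDerivAt_prodMk_left x t
    have h2 := (hd.hasFDerivAt.comp (f := fun x' : Eucl n => (x', t)) x hp).fderiv
    simp only [Function.uncurry, pd_cons]
    change fderiv ℝ ((Function.uncurry fun x t => pd l (fun x' => f x' t) x) ∘
      fun x' => (x', t)) x _ = _
    rw [h2]
    simp

theorem contDiffOn_pd_snd {Ω : Set (E × Eucl n)} (hΩ : IsOpen Ω) {f : E → Eucl n → F}
    (hf : ContDiffOn ℝ ∞ (Function.uncurry f) Ω) (l : List (Fin n)) :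
    ContDiffOn ℝ ∞ (Function.uncurry fun t x => pd l (f t) x) Ω := by
  have hswap : IsOpen (Prod.swap ⁻¹' Ω) := hΩ.preimage continuous_swap
  have h1 : ContDiffOn ℝ ∞ (Function.uncurry fun x t => f t x) (Prod.swap ⁻¹' Ω) :=
    hf.comp (contDiff_snd.prodMk contDiff_fst).contDiffOn (fun _ h => h)
  exact (contDiffOn_pd_fst hswap h1 l).comp (contDiff_snd.prodMk contDiff_fst).contDiffOn
    (fun _ h => h)

theorem contDiffOn_slice_fst {U : Set (Eucl n)} {V : Set E} {f : Eucl n → E → F}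
    (hf : ContDiffOn ℝ ∞ (Function.uncurry f) (U ×ˢ V)) {t : E} (ht : t ∈ V) :
    ContDiffOn ℝ ∞ (fun x => f x t) U :=
  hf.comp (contDiffOn_id.prodMk contDiffOn_const) fun _ hx => ⟨hx, ht⟩

theorem contDiffOn_slice_snd {U : Set (Eucl n)} {V : Set E} {f : Eucl n → E → F}
    (hf : ContDiffOn ℝ ∞ (Function.uncurry f) (U ×ˢ V)) {x : Eucl n} (hx : x ∈ U) :
    ContDiffOn ℝ ∞ (f x) V :=
  hf.comp (contDiffOn_const.prodMk contDiffOn_id) fun _ ht => ⟨hx, ht⟩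

theorem exists_bound_pd {U K : Set (Eucl n)} (hU : IsOpen U) (hK : IsCompact K) (hKU : K ⊆ U)
    {f : Eucl n → F} (hf : ContDiffOn ℝ ∞ f U) (l : List (Fin n)) :
    ∃ C, 0 ≤ C ∧ ∀ x ∈ K, ‖pd l f x‖ ≤ C := by
  obtain ⟨C, hC⟩ := hK.exists_bound_of_continuousOn ((contDiffOn_pd hU hf l).continuousOn.mono hKU)
  exact ⟨max C 0, le_max_right _ _, fun x hx => (hC x hx).trans (le_max_left _ _)⟩

/-- If all derivatives of `g t` are bounded by multiples of `A t`, uniformly in `t ∈ S`, then so are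
those of `f * g t`. -/
theorem exists_bound_pd_mul {ι : Type*} {S : Set ι} {U K : Set (Eucl n)} (hU : IsOpen U)
    (hKU : K ⊆ U) {f g : ι → Eucl n → ℂ} (hf : ∀ t ∈ S, ContDiffOn ℝ ∞ (f t) U)
    (hg : ∀ t ∈ S, ContDiffOn ℝ ∞ (g t) U) {A B : ι → ℝ}
    (hbf : ∀ l, ∃ C, ∀ t ∈ S, ∀ x ∈ K, ‖pd l (f t) x‖ ≤ C * A t)
    (hbg : ∀ l, ∃ C, ∀ t ∈ S, ∀ x ∈ K, ‖pd l (g t) x‖ ≤ C * B t) (l : List (Fin n)) :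
    ∃ C, ∀ t ∈ S, ∀ x ∈ K, ‖pd l (fun x => f t x * g t x) x‖ ≤ C * (A t * B t) := by
  have key : ∀ L : List (List (Fin n) × List (Fin n)), ∃ C, ∀ t ∈ S, ∀ x ∈ K,
      ‖(L.map fun s => pd s.1 (f t) x * pd s.2 (g t) x).sum‖ ≤ C * (A t * B t) := by
    intro L
    induction L with
    | nil => exact ⟨0, by simp⟩
    | cons s L ih =>
      obtain ⟨C, hC⟩ := ih
      obtain ⟨C1, h1⟩ := hbf s.1
      obtain ⟨C2, h2⟩ := hbg s.2
      refine ⟨C1 * C2 + C, fun t ht x hx => ?_⟩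
      rw [List.map_cons, List.sum_cons]
      refine (norm_add_le _ _).trans ?_
      rw [norm_mul, add_mul]
      refine add_le_add ?_ (hC t ht x hx)
      calc ‖pd s.1 (f t) x‖ * ‖pd s.2 (g t) x‖ ≤ (C1 * A t) * (C2 * B t) :=
            mul_le_mul (h1 t ht x hx) (h2 t ht x hx) (norm_nonneg _)
              ((norm_nonneg _).trans (h1 t ht x hx))
        _ = _ := by ring
  obtain ⟨C, hC⟩ := key (splits l)
  exact ⟨C, fun t ht x hx => by
    rw [pd_mul hU (hf t ht) (hg t ht) l (hKU hx)]; exact hC t ht x hx⟩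

end PartialDerivatives

/-! ### Oscillatory integrals -/

section Oscillatory

open MeasureTheory Real

/-- The plane wave `e^{i x·ξ}`. -/
def osc (x ξ : Eucl n) : ℂ := Complex.exp (Complex.I * (inner ℝ x ξ : ℝ))

theorem osc_comm (x ξ : Eucl n) : osc x ξ = osc ξ x := by
  rw [osc, osc, real_inner_comm]

theorem osc_add_left (x y ξ : Eucl n) : osc (x + y) ξ = osc x ξ * osc y ξ := by
  simp only [osc, inner_add_left, Complex.ofReal_add, mul_add, Complex.exp_add]

theorem osc_add_right (x ξ η : Eucl n) : osc x (ξ + η) = osc x ξ * osc x η := by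
  rw [osc_comm, osc_add_left, osc_comm, osc_comm η]

theorem osc_neg_left (x ξ : Eucl n) : osc (-x) ξ = Complex.exp (-(Complex.I * (inner ℝ x ξ : ℝ))) := by
  simp [osc]

theorem osc_neg_comm (x ξ : Eucl n) : osc (-x) ξ = osc x (-ξ) := by
  simp [osc]

@[simp] theorem osc_zero_left (ξ : Eucl n) : osc 0 ξ = 1 := by simp [osc]

theorem osc_mul_osc_neg (x ξ : Eucl n) : osc x ξ * osc (-x) ξ = 1 := by
  rw [← osc_add_left, add_neg_cancel, osc_zero_left]

@[simp] theorem norm_osc (x ξ : Eucl n) : ‖osc x ξ‖ = 1 := by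
  rw [osc, mul_comm, Complex.norm_exp_ofReal_mul_I]

theorem contDiff_osc : ContDiff ℝ ∞ (fun p : Eucl n × Eucl n => osc p.1 p.2) := by
  have : ContDiff ℝ ∞ (fun p : Eucl n × Eucl n => ((inner ℝ p.1 p.2 : ℝ) : ℂ)) :=
    Complex.ofRealCLM.contDiff.comp (contDiff_fst.inner ℝ contDiff_snd)
  exact (contDiff_const.mul this).cexp

theorem continuous_osc : Continuous (fun p : Eucl n × Eucl n => osc p.1 p.2) :=
  contDiff_osc.continuous

theorem hasFDerivAt_osc_left (x ξ : Eucl n) : HasFDerivAt (fun x => osc x ξ)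
    ((innerSL ℝ ξ).smulRight (Complex.I * osc x ξ)) x := by
  have h1 : HasFDerivAt (fun x : Eucl n => ((inner ℝ x ξ : ℝ) : ℂ))
      (Complex.ofRealCLM ∘L innerSL ℝ ξ) x := by
    have := (Complex.ofRealCLM ∘L (innerSL ℝ ξ)).hasFDerivAt (x := x)
    refine this.congr_of_eventuallyEq (Filter.Eventually.of_forall fun y => ?_)
    simp [real_inner_comm]
  have h2 := (h1.const_mul Complex.I).cexp
  refine h2.congr_fderiv ?_
  ext v
  simp [osc]
  ring

theorem fderiv_osc_left (x ξ v : Eucl n) :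
    fderiv ℝ (fun x => osc x ξ) x v = Complex.I * (inner ℝ ξ v : ℝ) * osc x ξ := by
  rw [(hasFDerivAt_osc_left x ξ).fderiv]
  simp
  ring

/-- `∫ e^{i z·y} v(y) dy`. -/
def oscInt (v : Eucl n → ℂ) (z : Eucl n) : ℂ := ∫ y, osc z y * v y

/-- Both Fourier integrals take the one form `oscInt`, the sign of the inner transform moving into
the argument `-ξ`. All later estimates are estimates of `oscInt`. -/
theorem quantize_eq (p : Eucl n → Eucl n → ℂ) (v : Eucl n → ℂ) (x : Eucl n) :
    quantize p v x = ((2 * Real.pi : ℝ) : ℂ) ^ (-(n : ℤ)) *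
      oscInt (fun ξ => p x ξ * oscInt v (-ξ)) x := by
  simp only [quantize, oscInt, ← mul_assoc]
  congr 2 with ξ
  congr 2 with y
  rw [osc_comm, ← osc_neg_comm, osc_neg_left]

theorem norm_oscInt_le (v : Eucl n → ℂ) (z : Eucl n) : ‖oscInt v z‖ ≤ ∫ y, ‖v y‖ := by
  refine (norm_integral_le_integral_norm _).trans (le_of_eq ?_)
  simp

theorem integrable_osc_mul {v : Eucl n → ℂ} (hv : Integrable v) (z : Eucl n) :
    Integrable (fun y => osc z y * v y) := by
  refine hv.bdd_mul (c := 1) ?_ (Filter.Eventually.of_forall fun y => by simp)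
  exact (continuous_osc.comp (by fun_prop : Continuous fun y => (z, y))).aestronglyMeasurable

theorem oscInt_add {v w : Eucl n → ℂ} (hv : Integrable v) (hw : Integrable w) (z : Eucl n) :
    oscInt (fun y => v y + w y) z = oscInt v z + oscInt w z := by
  simp only [oscInt, mul_add]
  exact integral_add (integrable_osc_mul hv z) (integrable_osc_mul hw z)

theorem oscInt_sub {v w : Eucl n → ℂ} (hv : Integrable v) (hw : Integrable w) (z : Eucl n) :
    oscInt (fun y => v y - w y) z = oscInt v z - oscInt w z := by
  simp only [oscInt, mul_sub]
  exact integral_sub (integrable_osc_mul hv z) (integrable_osc_mul hw z)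

theorem oscInt_const_mul (c : ℂ) (v : Eucl n → ℂ) (z : Eucl n) :
    oscInt (fun y => c * v y) z = c * oscInt v z := by
  simp only [oscInt, mul_left_comm _ c]
  exact integral_const_mul _ _

theorem oscInt_sum {ι : Type*} (s : Finset ι) {v : ι → Eucl n → ℂ}
    (hv : ∀ i ∈ s, Integrable (v i)) (z : Eucl n) :
    oscInt (fun y => ∑ i ∈ s, v i y) z = ∑ i ∈ s, oscInt (v i) z := by
  simp only [oscInt, Finset.mul_sum]
  exact integral_finsetSum _ fun i hi => integrable_osc_mul (hv i hi) z

theorem oscInt_osc_mul (v : Eucl n → ℂ) (a z : Eucl n) :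
    oscInt (fun y => osc a y * v y) z = oscInt v (z + a) := by
  simp only [oscInt, osc_add_left, mul_assoc]

theorem contDiff_integrable {v : Eucl n → ℂ} (hv : ContDiff ℝ ∞ v) (hc : HasCompactSupport v) :
    Integrable v := hv.continuous.integrable_of_hasCompactSupport hc

theorem hasCompactSupport_pd {v : Eucl n → ℂ} (hc : HasCompactSupport v) (l : List (Fin n)) :
    HasCompactSupport (pd l v) := hc.of_isClosed_subset (isClosed_tsupport _) (pd_support_subset v l)

theorem inner_stdVec (z : Eucl n) (i : Fin n) : inner ℝ z (stdVec i) = z i := by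
  simp [stdVec, EuclideanSpace.inner_single_right]

/-- Integration by parts; compact support of `v` supplies the integrability that removes boundary
terms. -/
theorem oscInt_pd_singleton {v : Eucl n → ℂ} (hv : ContDiff ℝ ∞ v) (hc : HasCompactSupport v)
    (i : Fin n) (z : Eucl n) : oscInt (pd [i] v) z = -(Complex.I * (z i : ℝ)) * oscInt v z := by
  have hd : ∀ x, fderiv ℝ (fun y => osc z y) x (stdVec i) = Complex.I * (z i : ℝ) * osc z x := by
    intro x
    simp only [osc_comm z]
    rw [fderiv_osc_left, inner_stdVec]
  have ho : Differentiable ℝ (fun y => osc z y) := fun y =>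
    (hasFDerivAt_osc_left y z).differentiableAt.congr_of_eventuallyEq
      (Filter.Eventually.of_forall fun x => osc_comm z x)
  have hi := integrable_osc_mul (contDiff_integrable hv hc) z
  have hi' : Integrable fun x => osc z x * fderiv ℝ v x (stdVec i) :=
    integrable_osc_mul (contDiff_integrable (contDiff_pd hv [i]) (hasCompactSupport_pd hc [i])) z
  have hi2 : Integrable fun x => fderiv ℝ (fun y => osc z y) x (stdVec i) * v x := by
    simp only [hd, mul_assoc]
    exact (hi.const_mul _).const_mul _
  have h := integral_mul_fderiv_eq_neg_fderiv_mul_of_integrable hi2 hi' hi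
    (fun x _ => ho x) (fun x _ => (hv.differentiable (by simp)) x)
  have h2 : (∫ x, fderiv ℝ (fun y => osc z y) x (stdVec i) * v x) =
      Complex.I * (z i : ℝ) * ∫ x, osc z x * v x := by
    simp only [hd, mul_assoc]
    rw [integral_const_mul, integral_const_mul]
  rw [h2] at h
  rw [neg_mul]
  exact h

theorem norm_le_sum_coord (z : Eucl n) : ‖z‖ ≤ ∑ i, |z i| := by
  conv_lhs => rw [← sum_coord_smul_stdVec z]
  refine (norm_sum_le _ _).trans (Finset.sum_le_sum fun i _ => ?_)
  rw [norm_smul]; simp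

theorem abs_coord_le_norm (z : Eucl n) (i : Fin n) : |z i| ≤ ‖z‖ := by
  simpa using PiLp.norm_apply_le z i

/-- Since `1 + ‖z‖ ≤ 1 + ∑ |z i|`, each power of `1 + ‖z‖` can be traded for at most one derivative
of `v`. One step of the induction adds up `n + 1` copies of the previous bound, whence `(1 + n) ^
N`. -/
theorem oscInt_bound_pow {K : Set (Eucl n)} (hK : IsCompact K) (N : ℕ) {v : Eucl n → ℂ}
    (hv : ContDiff ℝ ∞ v) (hvK : tsupport v ⊆ K) {B : ℝ}
    (hB : ∀ l : List (Fin n), l.length ≤ N → ∀ y ∈ K, ‖pd l v y‖ ≤ B) (z : Eucl n) :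
    (1 + ‖z‖) ^ N * ‖oscInt v z‖ ≤ ((1 + n) ^ N * volume.real K) * B := by
  induction N generalizing v with
  | zero =>
    simp only [pow_zero, one_mul]
    have h1 : oscInt v z = ∫ y in K, osc z y * v y := by
      refine (setIntegral_eq_integral_of_forall_compl_eq_zero fun y hy => ?_).symm
      rw [image_eq_zero_of_notMem_tsupport fun h => hy (hvK h), mul_zero]
    rw [h1, mul_comm]
    refine norm_setIntegral_le_of_norm_le_const hK.measure_lt_top fun y hy => ?_
    rw [norm_mul, norm_osc, one_mul]
    exact hB [] (Nat.zero_le _) y hy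
  | succ N ih =>
    have hc : HasCompactSupport v := hK.of_isClosed_subset (isClosed_tsupport _) hvK
    have h0 := ih hv hvK (fun l hl => hB l (by omega))
    have hi : ∀ i, (1 + ‖z‖) ^ N * (|z i| * ‖oscInt v z‖) ≤ ((1 + n) ^ N * volume.real K) * B := by
      intro i
      have := ih (contDiff_pd hv [i]) ((pd_support_subset v [i]).trans hvK) (fun l hl y hy => by
        rw [← pd_append]
        exact hB _ (by simpa using hl) y hy)
      rwa [oscInt_pd_singleton hv hc, norm_mul, norm_neg, norm_mul, Complex.norm_I, one_mul,
        Complex.norm_real, Real.norm_eq_abs] at this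
    calc (1 + ‖z‖) ^ (N + 1) * ‖oscInt v z‖
        ≤ (1 + ‖z‖) ^ N * (1 + ∑ i, |z i|) * ‖oscInt v z‖ := by
          rw [pow_succ]
          gcongr
          exact norm_le_sum_coord z
      _ = (1 + ‖z‖) ^ N * ‖oscInt v z‖ + ∑ i, (1 + ‖z‖) ^ N * (|z i| * ‖oscInt v z‖) := by
          rw [← Finset.mul_sum, ← Finset.sum_mul]; ring
      _ ≤ ((1 + n) ^ N * volume.real K) * B + ∑ _i : Fin n, ((1 + n) ^ N * volume.real K) * B :=
          add_le_add h0 (Finset.sum_le_sum fun i _ => hi i)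
      _ = _ := by simp; ring

theorem oscInt_bound {K : Set (Eucl n)} (hK : IsCompact K) (N : ℕ) {v : Eucl n → ℂ}
    (hv : ContDiff ℝ ∞ v) (hvK : tsupport v ⊆ K) {B : ℝ}
    (hB : ∀ l : List (Fin n), l.length ≤ N → ∀ y ∈ K, ‖pd l v y‖ ≤ B) (z : Eucl n) :
    ‖oscInt v z‖ ≤ ((1 + n) ^ N * volume.real K) * B * (1 + ‖z‖) ^ (-(N : ℝ)) := by
  have h : 0 < (1 + ‖z‖) := by positivity
  rw [rpow_neg h.le, rpow_natCast, ← div_eq_mul_inv, le_div_iff₀ (by positivity), mul_comm]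
  exact oscInt_bound_pow hK N hv hvK hB z

theorem exists_uniform_pd_bound {ι : Type*} {S : Set ι} {K : Set (Eucl n)}
    {v : ι → Eucl n → ℂ} {A : ι → ℝ} (hA : ∀ t ∈ S, 0 ≤ A t)
    (h : ∀ l, ∃ C, ∀ t ∈ S, ∀ y ∈ K, ‖pd l (v t) y‖ ≤ C * A t) (N : ℕ) :
    ∃ C, 0 ≤ C ∧ ∀ l : List (Fin n), l.length ≤ N → ∀ t ∈ S, ∀ y ∈ K, ‖pd l (v t) y‖ ≤ C * A t := by
  choose C hC using h
  have hfin : {l : List (Fin n) | l.length ≤ N}.Finite := List.finite_length_le _ _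
  refine ⟨∑ l ∈ hfin.toFinset, |C l|, Finset.sum_nonneg fun _ _ => abs_nonneg _,
    fun l hl t ht y hy => (hC l t ht y hy).trans ?_⟩
  refine mul_le_mul_of_nonneg_right ?_ (hA t ht)
  exact (le_abs_self _).trans (Finset.single_le_sum (f := fun l => |C l|)
    (fun _ _ => abs_nonneg _) (by simpa using hl))

/-- The weight `A t` lets one estimate serve both for single functions and for amplitudes that grow
with the frequency `t`. -/
theorem oscInt_bound_family {ι : Type*} {S : Set ι} {K : Set (Eucl n)} (hK : IsCompact K)
    {v : ι → Eucl n → ℂ} {A : ι → ℝ} (hA : ∀ t ∈ S, 0 ≤ A t)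
    (hv : ∀ t ∈ S, ContDiff ℝ ∞ (v t)) (hvK : ∀ t ∈ S, tsupport (v t) ⊆ K)
    (h : ∀ l, ∃ C, ∀ t ∈ S, ∀ y ∈ K, ‖pd l (v t) y‖ ≤ C * A t) (N : ℕ) :
    ∃ C, 0 ≤ C ∧ ∀ t ∈ S, ∀ z, ‖oscInt (v t) z‖ ≤ C * A t * (1 + ‖z‖) ^ (-(N : ℝ)) := by
  obtain ⟨C, hC0, hC⟩ := exists_uniform_pd_bound hA h N
  refine ⟨((1 + n) ^ N * volume.real K) * C, by positivity, fun t ht z => ?_⟩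
  have := oscInt_bound hK N (hv t ht) (hvK t ht) (fun l hl y hy => hC l hl t ht y hy) z
  rwa [← mul_assoc] at this

theorem oscInt_bound_single {v : Eucl n → ℂ} (hv : ContDiff ℝ ∞ v) (hc : HasCompactSupport v)
    (N : ℕ) : ∃ C, 0 ≤ C ∧ ∀ z, ‖oscInt v z‖ ≤ C * (1 + ‖z‖) ^ (-(N : ℝ)) := by
  obtain ⟨C, h0, h⟩ := oscInt_bound_family (ι := Unit) (S := Set.univ) (v := fun _ => v)
    (A := fun _ => 1) hc (fun _ _ => zero_le_one) (fun _ _ => hv) (fun _ _ => subset_rfl)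
    (fun l => by
      obtain ⟨C, _, hC⟩ := exists_bound_pd isOpen_univ hc (Set.subset_univ _) hv.contDiffOn l
      exact ⟨C, fun _ _ y hy => by simpa using hC y hy⟩) N
  exact ⟨C, h0, fun z => by simpa using h () trivial z⟩

theorem integrable_one_add_norm_rpow {t : ℝ} (ht : t < -n) :
    Integrable (fun x : Eucl n => (1 + ‖x‖) ^ t) := by
  have := integrable_one_add_norm (E := Eucl n) (μ := volume) (r := -t) (by simp; linarith)
  simpa using this

theorem integrable_of_norm_le_rpow {f : Eucl n → ℂ} (hf : AEStronglyMeasurable f) {C t : ℝ}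
    (ht : t < -n) (h : ∀ x, ‖f x‖ ≤ C * (1 + ‖x‖) ^ t) : Integrable f :=
  ((integrable_one_add_norm_rpow ht).const_mul C).mono' hf (Filter.Eventually.of_forall h)

theorem continuous_oscInt {v : Eucl n → ℂ} (hv : Integrable v) : Continuous (oscInt v) := by
  refine continuous_of_dominated (bound := fun y => ‖v y‖) (fun z => ?_) (fun z => ?_) hv.norm ?_
  · exact (integrable_osc_mul hv z).1
  · exact Filter.Eventually.of_forall fun y => by simp
  · refine Filter.Eventually.of_forall fun y => ?_
    exact (continuous_osc.comp (by fun_prop : Continuous fun z => (z, y))).mul continuous_const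

theorem integrable_oscInt {v : Eucl n → ℂ} (hv : ContDiff ℝ ∞ v) (hc : HasCompactSupport v) :
    Integrable (oscInt v) := by
  obtain ⟨C, _, hC⟩ := oscInt_bound_single hv hc (n + 1)
  exact integrable_of_norm_le_rpow
    (continuous_oscInt (contDiff_integrable hv hc)).aestronglyMeasurable (by push_cast; linarith) hC

open FourierTransform in
-- The normalisation `e^{-2πi⟨x,w⟩}` of Mathlib's transform is converted by the substitution `ξ = 2π
-- w`, whose Jacobian is the factor `(2π)⁻ⁿ`.
theorem fourier_inversion {v : Eucl n → ℂ} (hv : ContDiff ℝ ∞ v) (hc : HasCompactSupport v)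
    (x : Eucl n) :
    ((2 * Real.pi : ℝ) : ℂ) ^ (-(n : ℤ)) * oscInt (fun ξ => oscInt v (-ξ)) x = v x := by
  have h1 : 𝓕 v = fun w => oscInt v (-((2 * Real.pi) • w)) := by
    ext w
    rw [Real.fourier_eq', oscInt]
    congr 1 with y
    rw [smul_eq_mul, osc]
    congr 2
    rw [inner_neg_left, inner_smul_left, real_inner_comm]
    simp
    ring
  have hint := integrable_oscInt hv hc
  have h2 : Integrable (𝓕 v) := by
    rw [h1]
    simpa using hint.comp_smul (R := -(2 * Real.pi)) (by simp)
  have h3 := congrFun (hv.continuous.fourierInv_fourier_eq (contDiff_integrable hv hc) h2) x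
  rw [Real.fourierInv_eq', h1] at h3
  rw [← h3]
  have h4 := Measure.integral_comp_smul (volume : Measure (Eucl n))
    (fun ξ => osc x ξ * oscInt v (-ξ)) (2 * Real.pi)
  have h5 : (∫ w : Eucl n, Complex.exp (↑(2 * π * inner ℝ w x) * Complex.I) •
      oscInt v (-((2 * Real.pi) • w))) = ∫ w, osc x ((2 * π) • w) * oscInt v (-((2 * π) • w)) := by
    congr 1 with w
    rw [smul_eq_mul, osc]
    congr 2
    rw [inner_smul_right, real_inner_comm, mul_comm]
  rw [h5, h4, oscInt]
  simp only [finrank_euclideanSpace, Fintype.card_fin]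
  rw [abs_of_pos (by positivity), Complex.real_smul, zpow_neg, zpow_natCast]
  push_cast
  ring

/-- Peetre's inequality. For negative exponents the basic estimate is applied to `x = (x + y) +
(-y)`. -/
theorem peetre (x y : Eucl n) (t : ℝ) :
    (1 + ‖x + y‖) ^ t ≤ (1 + ‖x‖) ^ t * (1 + ‖y‖) ^ |t| := by
  have key : ∀ a b : Eucl n, 1 + ‖a + b‖ ≤ (1 + ‖a‖) * (1 + ‖b‖) := by
    intro a b
    nlinarith [norm_add_le a b, norm_nonneg a, norm_nonneg b, mul_nonneg (norm_nonneg a) (norm_nonneg b)]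
  rcases le_total 0 t with ht | ht
  · rw [abs_of_nonneg ht, ← mul_rpow (by positivity) (by positivity)]
    exact rpow_le_rpow (by positivity) (key x y) ht
  · rw [abs_of_nonpos ht, rpow_neg (by positivity), ← div_eq_mul_inv,
      ← div_rpow (by positivity) (by positivity)]
    refine rpow_le_rpow_of_nonpos (by positivity) ?_ ht
    rw [div_le_iff₀ (by positivity)]
    have := key (x + y) (-y)
    simpa using this

theorem rpow_one_add_norm_mono (x : Eucl n) {s t : ℝ} (h : s ≤ t) :
    (1 + ‖x‖) ^ s ≤ (1 + ‖x‖) ^ t :=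
  rpow_le_rpow_of_exponent_le (by linarith [norm_nonneg x]) h

end Oscillatory

/-! ### Oscillatory integrals depending on parameters -/

section ParametricIntegrals

open MeasureTheory Real

/-- A class of functions that contains the partial derivatives of its members consists of smooth
functions, by induction on the order. Differentiation under the integral then has to be justified
only once. -/
theorem contDiffOn_of_partials {E : Type*} [NormedAddCommGroup E] [NormedSpace ℝ E] {ι : Type*}
    [Fintype ι] {s : Set E} (hs : IsOpen s) (e : ι → E →L[ℝ] ℝ) {𝒞 : Set (E → ℂ)}
    (h : ∀ f ∈ 𝒞, ∃ g : ι → E → ℂ, (∀ i, g i ∈ 𝒞) ∧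
      ∀ x ∈ s, HasFDerivAt f (∑ i, (e i).smulRight (g i x)) x) {f : E → ℂ} (hf : f ∈ 𝒞) :
    ContDiffOn ℝ ∞ f s := by
  refine contDiffOn_infty.2 fun k => ?_
  induction k generalizing f with
  | zero =>
    obtain ⟨g, _, hg⟩ := h f hf
    exact contDiffOn_zero.2 fun x hx => (hg x hx).continuousAt.continuousWithinAt
  | succ k ih =>
    obtain ⟨g, hgC, hg⟩ := h f hf
    push_cast
    refine (contDiffOn_succ_iff_fderiv_of_isOpen hs).2
      ⟨fun x hx => (hg x hx).differentiableAt.differentiableWithinAt, by simp, ?_⟩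
    refine ContDiffOn.congr (f := fun x => ∑ i, (e i).smulRight (g i x)) ?_
      fun x hx => (hg x hx).fderiv
    exact ContDiffOn.sum fun i _ => contDiffOn_const.smulRight (ih (hgC i))

/-- Functions on `U × ℝⁿ` all of whose derivatives in the first variable are rapidly decreasing in
the second one, locally uniformly in the first one. -/
structure RapidDecay (U : Set (Eucl n)) (r : Eucl n → Eucl n → ℂ) : Prop where
  smooth : ContDiffOn ℝ ∞ (Function.uncurry r) (U ×ˢ Set.univ)
  bound : ∀ K : Set (Eucl n), IsCompact K → K ⊆ U → ∀ (l : List (Fin n)) (N : ℕ),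
    ∃ C, ∀ x ∈ K, ∀ ξ, ‖pd l (fun x' => r x' ξ) x‖ ≤ C * (1 + ‖ξ‖) ^ (-(N : ℝ))

namespace RapidDecay

variable {U : Set (Eucl n)} {r : Eucl n → Eucl n → ℂ}

theorem pd (hU : IsOpen U) (hr : RapidDecay U r) (l : List (Fin n)) :
    RapidDecay U (fun x ξ => pd l (fun x' => r x' ξ) x) where
  smooth := contDiffOn_pd_fst (hU.prod isOpen_univ) hr.smooth l
  bound K hK hKU l' N := by
    simpa only [pd_append] using hr.bound K hK hKU (l' ++ l) N

/-- Polynomial growth of order `M` is absorbed by asking `r` for `M` further orders of decay. -/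
theorem mul_right (hU : IsOpen U) (hr : RapidDecay U r) {g : Eucl n → ℂ} (hg : ContDiff ℝ ∞ g)
    {C M : ℝ} (hb : ∀ ξ, ‖g ξ‖ ≤ C * (1 + ‖ξ‖) ^ M) : RapidDecay U (fun x ξ => g ξ * r x ξ) where
  smooth := (hg.comp contDiff_snd).contDiffOn.mul hr.smooth
  bound K hK hKU l N := by
    obtain ⟨N', hN'⟩ := exists_nat_ge (N + M)
    obtain ⟨C', hC'⟩ := hr.bound K hK hKU l N'
    refine ⟨|C| * C', fun x hx ξ => ?_⟩
    rw [pd_const_mul hU (contDiffOn_slice_fst hr.smooth (Set.mem_univ ξ)) (g ξ) l (hKU hx),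
      norm_mul]
    calc ‖g ξ‖ * ‖InvPsiDO.pd l (fun x' => r x' ξ) x‖
        ≤ (|C| * (1 + ‖ξ‖) ^ M) * (C' * (1 + ‖ξ‖) ^ (-(N' : ℝ))) := by
          refine mul_le_mul ((hb ξ).trans ?_) (hC' x hx ξ) (norm_nonneg _) (by positivity)
          exact mul_le_mul_of_nonneg_right (le_abs_self C) (by positivity)
      _ = |C| * C' * (1 + ‖ξ‖) ^ (M - N') := by
          rw [sub_eq_add_neg, rpow_add (by positivity)]; ring
      _ ≤ _ := by
          have h0 : 0 ≤ C' := by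
            have := (norm_nonneg _).trans (hC' x hx ξ)
            exact nonneg_of_mul_nonneg_left this (by positivity)
          exact mul_le_mul_of_nonneg_left (rpow_one_add_norm_mono ξ (by linarith)) (by positivity)

theorem coord_mul (hU : IsOpen U) (hr : RapidDecay U r) (i : Fin n) :
    RapidDecay U (fun x ξ => Complex.I * (ξ i : ℝ) * r x ξ) := by
  refine hr.mul_right (C := 1) (M := 1) hU (g := fun ξ : Eucl n => Complex.I * (ξ i : ℝ)) ?_ ?_
  · have : ContDiff ℝ ∞ (fun ξ : Eucl n => ((ξ i : ℝ) : ℂ)) :=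
      Complex.ofRealCLM.contDiff.comp (EuclideanSpace.proj (𝕜 := ℝ) i).contDiff
    exact contDiff_const.mul this
  · intro ξ
    rw [norm_mul, Complex.norm_I, Complex.norm_real, rpow_one, one_mul, one_mul, Real.norm_eq_abs]
    linarith [abs_coord_le_norm ξ i]

theorem continuous_slice (hr : RapidDecay U r) {x : Eucl n} (hx : x ∈ U) : Continuous (r x) :=
  (contDiffOn_univ.1 (contDiffOn_slice_snd hr.smooth hx)).continuous

theorem integrable (hr : RapidDecay U r) {x : Eucl n} (hx : x ∈ U) : Integrable (r x) := by
  obtain ⟨C, hC⟩ := hr.bound {x} isCompact_singleton (by simpa using hx) [] (n + 1)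
  exact integrable_of_norm_le_rpow (hr.continuous_slice hx).aestronglyMeasurable
    (by push_cast; linarith) (hC x rfl)

/-- Coordinates on `ℝⁿ × ℝⁿ`. -/
def coordCLM : Fin n ⊕ Fin n → (Eucl n × Eucl n →L[ℝ] ℝ)
  | .inl i => (EuclideanSpace.proj (𝕜 := ℝ) i).comp (ContinuousLinearMap.fst ℝ _ _)
  | .inr i => (EuclideanSpace.proj (𝕜 := ℝ) i).comp (ContinuousLinearMap.snd ℝ _ _)

/-- The symbols of the partial derivatives of `oscInt (r x) z`. -/
def partials (r : Eucl n → Eucl n → ℂ) : Fin n ⊕ Fin n → Eucl n → Eucl n → ℂ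
  | .inl i => fun x ξ => InvPsiDO.pd [i] (fun x' => r x' ξ) x
  | .inr i => fun x ξ => Complex.I * (ξ i : ℝ) * r x ξ

theorem partials_rapidDecay (hU : IsOpen U) (hr : RapidDecay U r) (i : Fin n ⊕ Fin n) :
    RapidDecay U (partials r i) := by
  cases i with
  | inl i => exact hr.pd hU [i]
  | inr i => exact hr.coord_mul hU i

theorem hasFDerivAt_integrand (hU : IsOpen U) (hr : RapidDecay U r) {p : Eucl n × Eucl n}
    (hp : p.1 ∈ U) (ξ : Eucl n) :
    HasFDerivAt (fun p : Eucl n × Eucl n => osc p.2 ξ * r p.1 ξ)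
      (∑ i, (coordCLM i).smulRight (osc p.2 ξ * partials r i p.1 ξ)) p := by
  have h1 : HasFDerivAt (fun p : Eucl n × Eucl n => osc p.2 ξ) _ p :=
    (hasFDerivAt_osc_left p.2 ξ).comp p hasFDerivAt_snd
  have hd : DifferentiableAt ℝ (fun x => r x ξ) p.1 :=
    pd_differentiableAt hU (contDiffOn_slice_fst hr.smooth (Set.mem_univ ξ)) [] hp
  have h2 : HasFDerivAt (fun p : Eucl n × Eucl n => r p.1 ξ) _ p :=
    hd.hasFDerivAt.comp p hasFDerivAt_fst
  refine (h1.mul h2).congr_fderiv ?_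
  ext v
  · simp only [ContinuousLinearMap.comp_apply, ContinuousLinearMap.inl_apply,
      Fintype.sum_sum_type]
    simp only [_root_.add_apply, _root_.sum_apply, _root_.smul_apply, ContinuousLinearMap.comp_apply,
      ContinuousLinearMap.smulRight_apply, coordCLM, partials, smul_eq_mul,
      ContinuousLinearMap.coe_fst', ContinuousLinearMap.coe_snd', fderiv_apply_eq_sum p.1 v,
      map_zero, zero_smul, mul_zero, Finset.sum_const_zero, add_zero, Finset.mul_sum]
    refine Finset.sum_congr rfl fun i _ => ?_
    simp [InvPsiDO.pd]
    ring
  · simp only [ContinuousLinearMap.comp_apply, ContinuousLinearMap.inr_apply,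
      Fintype.sum_sum_type]
    simp only [_root_.add_apply, _root_.sum_apply, _root_.smul_apply, ContinuousLinearMap.comp_apply,
      ContinuousLinearMap.smulRight_apply, coordCLM, partials, smul_eq_mul,
      ContinuousLinearMap.coe_fst', ContinuousLinearMap.coe_snd', innerSL_apply_apply,
      map_zero, zero_smul, mul_zero, Finset.sum_const_zero, zero_add, PiLp.inner_apply]
    simp only [Complex.real_smul, Complex.ofReal_sum, Finset.sum_mul, Finset.mul_sum]
    refine Finset.sum_congr rfl fun i _ => ?_
    simp
    ring

theorem integrable_smulRight {E : Type*} [NormedAddCommGroup E] [NormedSpace ℝ E] (e : E →L[ℝ] ℝ)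
    {f : Eucl n → ℂ} (hf : Integrable f) : Integrable fun ξ => e.smulRight (f ξ) :=
  (ContinuousLinearMap.smulRightL ℝ E ℂ e).integrable_comp hf

theorem integrable_sum {α G : Type*} [MeasurableSpace α] {μ : Measure α} [NormedAddCommGroup G]
    {ι : Type*} [Fintype ι] {g : ι → α → G} (hg : ∀ i, Integrable (g i) μ) :
    Integrable (fun a => ∑ i, g i a) μ := by
  exact integrable_finsetSum Finset.univ (fun i _ => hg i)

theorem integral_sum {α G : Type*} [MeasurableSpace α] {μ : Measure α} [NormedAddCommGroup G]
    [NormedSpace ℝ G] {ι : Type*} [Fintype ι] {g : ι → α → G} (hg : ∀ i, Integrable (g i) μ) :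
    ∫ a, ∑ i, g i a ∂μ = ∑ i, ∫ a, g i a ∂μ := by
  exact integral_finsetSum Finset.univ (fun i _ => hg i)

theorem integrable_sum_smulRight {E : Type*} [NormedAddCommGroup E] [NormedSpace ℝ E] {ι : Type*}
    [Fintype ι] (e : ι → E →L[ℝ] ℝ) {g : ι → Eucl n → ℂ} (hg : ∀ i, Integrable (g i)) :
    Integrable fun ξ => ∑ i, (e i).smulRight (g i ξ) :=
  integrable_sum fun i => integrable_smulRight (e i) (hg i)

theorem integral_smulRight {E : Type*} [NormedAddCommGroup E] [NormedSpace ℝ E] (e : E →L[ℝ] ℝ)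
    {f : Eucl n → ℂ} (hf : Integrable f) :
    ∫ ξ, e.smulRight (f ξ) = e.smulRight (∫ ξ, f ξ) :=
  (ContinuousLinearMap.smulRightL ℝ E ℂ e).integral_comp_comm hf

theorem integral_sum_smulRight {E : Type*} [NormedAddCommGroup E] [NormedSpace ℝ E] {ι : Type*}
    [Fintype ι] (e : ι → E →L[ℝ] ℝ) {g : ι → Eucl n → ℂ} (hg : ∀ i, Integrable (g i)) :
    ∫ ξ, ∑ i, (e i).smulRight (g i ξ) = ∑ i, (e i).smulRight (∫ ξ, g i ξ) :=
  (integral_sum fun i => integrable_smulRight (e i) (hg i)).trans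
    (Finset.sum_congr rfl fun i _ => integral_smulRight (e i) (hg i))

/-- Differentiation under the integral sign. With `x` in a compact ball about `p.1`, all partial
derivatives are dominated by `(1 + ‖ξ‖) ^ (-(n + 1))`, integrable on `ℝⁿ`; `z` needs no restriction
because the plane wave has modulus one. -/
theorem hasFDerivAt_oscInt (hU : IsOpen U) (hr : RapidDecay U r) {p : Eucl n × Eucl n}
    (hp : p.1 ∈ U) :
    HasFDerivAt (fun p : Eucl n × Eucl n => oscInt (r p.1) p.2)
      (∑ i, (coordCLM i).smulRight (oscInt (partials r i p.1) p.2)) p := by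
  obtain ⟨ε, hε, hball⟩ := Metric.isOpen_iff.1 hU p.1 hp
  have hK : IsCompact (Metric.closedBall p.1 (ε / 2)) := isCompact_closedBall _ _
  have hKU : Metric.closedBall p.1 (ε / 2) ⊆ U :=
    (Metric.closedBall_subset_ball (by linarith)).trans hball
  have hs : {q : Eucl n × Eucl n | q.1 ∈ Metric.closedBall p.1 (ε / 2)} ∈ 𝓝 p :=
    continuous_fst.continuousAt.preimage_mem_nhds (Metric.closedBall_mem_nhds _ (by positivity))
  choose C hC using fun i => (hr.partials_rapidDecay hU i).bound _ hK hKU [] (n + 1)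
  have hi : ∀ i, Integrable fun ξ => osc p.2 ξ * partials r i p.1 ξ := fun i =>
    integrable_osc_mul ((hr.partials_rapidDecay hU i).integrable hp) _
  have hsum : Integrable fun ξ =>
      ∑ i, (coordCLM i).smulRight (osc p.2 ξ * partials r i p.1 ξ) :=
    integrable_sum_smulRight coordCLM hi
  have h1 : ∀ᶠ q in 𝓝 p, AEStronglyMeasurable (fun ξ => osc q.2 ξ * r q.1 ξ) volume := by
    filter_upwards [hs] with q hq
    exact (integrable_osc_mul (hr.integrable (hKU hq)) _).1
  have h2 : Integrable (fun ξ => osc p.2 ξ * r p.1 ξ) := integrable_osc_mul (hr.integrable hp) _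
  have h3 : ∀ ξ, ∀ q ∈ {q : Eucl n × Eucl n | q.1 ∈ Metric.closedBall p.1 (ε / 2)},
      ‖∑ i, (coordCLM i).smulRight (osc q.2 ξ * partials r i q.1 ξ)‖ ≤
        (∑ i, ‖coordCLM (n := n) i‖ * C i) * (1 + ‖ξ‖) ^ (-((n + 1 : ℕ) : ℝ)) := by
    intro ξ q hq
    rw [Finset.sum_mul]
    refine (norm_sum_le _ _).trans (Finset.sum_le_sum fun i _ => ?_)
    rw [ContinuousLinearMap.norm_smulRight_apply, norm_mul, norm_osc, one_mul, mul_assoc]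
    exact mul_le_mul_of_nonneg_left (hC i q.1 hq ξ) (norm_nonneg _)
  have h4 : Integrable fun ξ : Eucl n =>
      (∑ i, ‖coordCLM (n := n) i‖ * C i) * (1 + ‖ξ‖) ^ (-((n + 1 : ℕ) : ℝ)) :=
    (integrable_one_add_norm_rpow (by push_cast; linarith)).const_mul _
  have key := hasFDerivAt_integral_of_dominated_of_fderiv_le hs h1 h2 hsum.1
    (Filter.Eventually.of_forall h3) h4
    (Filter.Eventually.of_forall fun ξ q hq => hr.hasFDerivAt_integrand hU (hKU hq) ξ)
  rw [integral_sum_smulRight coordCLM hi] at key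
  exact key

theorem contDiffOn_oscInt (hU : IsOpen U) (hr : RapidDecay U r) :
    ContDiffOn ℝ ∞ (fun p : Eucl n × Eucl n => oscInt (r p.1) p.2) (U ×ˢ Set.univ) := by
  refine contDiffOn_of_partials (hU.prod isOpen_univ) coordCLM
    -- The integrals of rapidly decreasing functions are closed under partial derivatives: one in
    -- `x` differentiates `r`, one in `z` multiplies it by `i ξ`.
    (𝒞 := {f | ∃ r : Eucl n → Eucl n → ℂ, RapidDecay U r ∧ f = fun p => oscInt (r p.1) p.2})
    ?_ ⟨r, hr, rfl⟩
  rintro _ ⟨r, hr, rfl⟩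
  exact ⟨fun i p => oscInt (partials r i p.1) p.2,
    fun i => ⟨partials r i, hr.partials_rapidDecay hU i, rfl⟩,
    fun p hp => hr.hasFDerivAt_oscInt hU hp.1⟩

theorem pd_singleton_oscInt (hU : IsOpen U) (hr : RapidDecay U r) (i : Fin n) (z : Eucl n)
    {x : Eucl n} (hx : x ∈ U) : InvPsiDO.pd [i] (fun x' => oscInt (r x') z) x =
      oscInt (fun ξ => InvPsiDO.pd [i] (fun x' => r x' ξ) x) z := by
  have h := (hr.hasFDerivAt_oscInt hU (p := (x, z)) hx).comp (f := fun x' : Eucl n => (x', z)) x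
    (hasFDerivAt_prodMk_left x z)
  change fderiv ℝ ((fun p : Eucl n × Eucl n => oscInt (r p.1) p.2) ∘ fun x' => (x', z)) x _ = _
  rw [h.fderiv]
  simp [Fintype.sum_sum_type, coordCLM, partials]

theorem pd_oscInt (hU : IsOpen U) (hr : RapidDecay U r) (l : List (Fin n)) (z : Eucl n) :
    Set.EqOn (InvPsiDO.pd l (fun x' => oscInt (r x') z))
      (fun x => oscInt (fun ξ => InvPsiDO.pd l (fun x' => r x' ξ) x) z) U := by
  induction l with
  | nil => exact fun _ _ => rfl
  | cons i l ih =>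
    intro x hx
    rw [pd_cons_eq_pd_singleton, pd_congr hU ih [i] hx, (hr.pd hU l).pd_singleton_oscInt hU i z hx]
    rfl

theorem pd_singleton_oscInt_snd (hU : IsOpen U) (hr : RapidDecay U r) (i : Fin n) (z : Eucl n)
    {x : Eucl n} (hx : x ∈ U) : InvPsiDO.pd [i] (oscInt (r x)) z =
      oscInt (fun ξ => Complex.I * (ξ i : ℝ) * r x ξ) z := by
  have h := (hr.hasFDerivAt_oscInt hU (p := (x, z)) hx).comp (f := fun z' : Eucl n => (x, z')) z
    (hasFDerivAt_prodMk_right x z)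
  change fderiv ℝ ((fun p : Eucl n × Eucl n => oscInt (r p.1) p.2) ∘ fun z' => (x, z')) z _ = _
  rw [h.fderiv]
  simp [Fintype.sum_sum_type, coordCLM, partials]

/-- Smooth functions with locally uniformly compact support in the second variable. -/
theorem of_support (hU : IsOpen U) (hr : ContDiffOn ℝ ∞ (Function.uncurry r) (U ×ˢ Set.univ))
    (hs : ∀ K : Set (Eucl n), IsCompact K → K ⊆ U → ∃ K' : Set (Eucl n), IsCompact K' ∧
      ∀ x ∈ K, ∀ z ∉ K', r x z = 0) : RapidDecay U r where
  smooth := hr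
  bound K hK hKU l N := by
    -- For the `x`-derivatives to vanish at points of `K`, the function has to vanish for all nearby
    -- `x`; hence the larger compact set.
    obtain ⟨K₁, hK₁, hKK₁, hK₁U⟩ := exists_compact_between hK hU hKU
    obtain ⟨K', hK', h0⟩ := hs K₁ hK₁ hK₁U
    have hc : ContinuousOn (fun p : Eucl n × Eucl n =>
        InvPsiDO.pd l (fun x' => r x' p.2) p.1 * ((1 + ‖p.2‖) ^ (N : ℝ) : ℝ)) (K ×ˢ K') := by
      refine ContinuousOn.mul ?_ ?_
      · exact ((contDiffOn_pd_fst (hU.prod isOpen_univ) hr l).continuousOn).mono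
          (Set.prod_mono hKU (Set.subset_univ _))
      · refine Continuous.continuousOn (Complex.continuous_ofReal.comp ?_)
        exact Continuous.rpow_const (by fun_prop) fun p => Or.inr (by positivity)
    obtain ⟨C, hC⟩ := (hK.prod hK').exists_bound_of_continuousOn hc
    refine ⟨max C 0, fun x hx ξ => ?_⟩
    by_cases hξ : ξ ∈ K'
    · have := hC (x, ξ) ⟨hx, hξ⟩
      rw [norm_mul, Complex.norm_real, Real.norm_of_nonneg (by positivity)] at this
      rw [rpow_neg (by positivity), ← div_eq_mul_inv, le_div_iff₀ (by positivity)]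
      exact this.trans (le_max_left _ _)
    · have : (fun x' => r x' ξ) =ᶠ[𝓝 x] fun _ => 0 := by
        filter_upwards [mem_interior_iff_mem_nhds.1 (hKK₁ hx)] with x' hx'
        exact h0 x' hx' ξ hξ
      rw [(pd_eventuallyEq this l).eq_of_nhds, pd_zero, norm_zero]
      positivity

/-- The derivatives of the transform in `x` are transforms of the derivatives of `r`, which have
uniformly compact support, so `oscInt_bound_family` applies to them. -/
theorem oscInt_of_support (hU : IsOpen U)
    (hr : ContDiffOn ℝ ∞ (Function.uncurry r) (U ×ˢ Set.univ))
    (hs : ∀ K : Set (Eucl n), IsCompact K → K ⊆ U → ∃ K' : Set (Eucl n), IsCompact K' ∧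
      ∀ x ∈ K, ∀ z ∉ K', r x z = 0) : RapidDecay U (fun x ξ => oscInt (r x) ξ) where
  smooth := (of_support hU hr hs).contDiffOn_oscInt hU
  bound K hK hKU l N := by
    obtain ⟨K₁, hK₁, hKK₁, hK₁U⟩ := exists_compact_between hK hU hKU
    obtain ⟨K', hK', h0⟩ := hs K₁ hK₁ hK₁U
    have hsm := contDiffOn_pd_fst (hU.prod isOpen_univ) hr l
    obtain ⟨C, _, hC⟩ := oscInt_bound_family (S := K) (K := K') hK'
      (v := fun x ξ => InvPsiDO.pd l (fun x' => r x' ξ) x) (A := fun _ => 1)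
      (fun _ _ => zero_le_one)
      (fun x hx => contDiffOn_univ.1 (contDiffOn_slice_snd hsm (hKU hx)))
      (fun x hx => by
        refine closure_minimal (fun ξ hξ => ?_) hK'.isClosed
        by_contra hξ'
        have : (fun x' => r x' ξ) =ᶠ[𝓝 x] fun _ => 0 := by
          filter_upwards [mem_interior_iff_mem_nhds.1 (hKK₁ hx)] with x' hx'
          exact h0 x' hx' ξ hξ'
        exact hξ (by
          change InvPsiDO.pd l (fun x' => r x' ξ) x = 0
          rw [(pd_eventuallyEq this l).eq_of_nhds, pd_zero]))
      (fun l' => by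
        obtain ⟨C, hC⟩ := (hK.prod hK').exists_bound_of_continuousOn
          ((contDiffOn_pd_snd (hU.prod isOpen_univ) hsm l').continuousOn.mono
            (Set.prod_mono hKU (Set.subset_univ _)))
        exact ⟨C, fun x hx y hy => by simpa using hC (x, y) ⟨hx, hy⟩⟩) N
    refine ⟨C, fun x hx ξ => ?_⟩
    rw [(of_support hU hr hs).pd_oscInt hU l ξ (hKU hx)]
    simpa using hC x hx ξ

end RapidDecay

theorem contDiff_I_mul_coord (i : Fin n) :
    ContDiff ℝ ∞ (fun ξ : Eucl n => Complex.I * ((ξ i : ℝ) : ℂ)) := by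
  have : ContDiff ℝ ∞ (fun ξ : Eucl n => ((ξ i : ℝ) : ℂ)) :=
    Complex.ofRealCLM.contDiff.comp (EuclideanSpace.proj (𝕜 := ℝ) i).contDiff
  exact contDiff_const.mul this

/-- A derivative of the transform is the transform of `i z_i v`, which is again smooth of compact
support. The innermost derivative is removed first, hence the induction from the end of the list. -/
theorem pd_oscInt_bound {v : Eucl n → ℂ} (hv : ContDiff ℝ ∞ v) (hc : HasCompactSupport v)
    (l : List (Fin n)) (N : ℕ) :
    ∃ C, ∀ ξ, ‖pd l (oscInt v) ξ‖ ≤ C * (1 + ‖ξ‖) ^ (-(N : ℝ)) := by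
  induction l using List.reverseRecOn generalizing v with
  | nil =>
    obtain ⟨C, _, hC⟩ := oscInt_bound_single hv hc N
    exact ⟨C, hC⟩
  | append_singleton l i ih =>
    have h1 : pd [i] (oscInt v) = oscInt (fun z => Complex.I * (z i : ℝ) * v z) := by
      ext z
      exact (RapidDecay.of_support (r := fun _ => v) isOpen_univ (hv.comp contDiff_snd).contDiffOn
        fun _ _ _ => ⟨_, hc, fun _ _ _ =>
          image_eq_zero_of_notMem_tsupport⟩).pd_singleton_oscInt_snd isOpen_univ i z
          (Set.mem_univ (0 : Eucl n))
    rw [pd_append, h1]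
    exact ih ((contDiff_I_mul_coord i).mul hv) hc.mul_left

end ParametricIntegrals

/-! ### Asymptotic expansions -/

section Expansions

open MeasureTheory Real Filter Asymptotics

theorem exists_cutoff {K U : Set (Eucl n)} (hK : IsCompact K) (hU : IsOpen U) (hKU : K ⊆ U) :
    ∃ χ : Eucl n → ℂ, ContDiff ℝ ∞ χ ∧ HasCompactSupport χ ∧ tsupport χ ⊆ U ∧
      ∃ W, IsOpen W ∧ K ⊆ W ∧ ∀ x ∈ W, χ x = 1 := by
  obtain ⟨K₁, hK₁, hKK₁, hK₁U⟩ := exists_compact_between hK hU hKU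
  obtain ⟨K₂, hK₂, hKK₂, hK₂U⟩ := exists_compact_between hK isOpen_interior hKK₁
  obtain ⟨f, hf1, hf0, -⟩ := exists_contMDiffMap_one_nhds_of_subset_interior (n := ⊤) 𝓘(ℝ, Eucl n)
    hK₂.isClosed hK₂U
  have hs : tsupport (fun x => ((f x : ℝ) : ℂ)) ⊆ K₁ := by
    refine closure_minimal (fun x hx => ?_) hK₁.isClosed
    by_contra h
    exact hx (by simp [hf0 x h])
  refine ⟨fun x => ((f x : ℝ) : ℂ), Complex.ofRealCLM.contDiff.comp f.contMDiff.contDiff,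
    hK₁.of_isClosed_subset (isClosed_tsupport _) hs, hs.trans hK₁U, interior K₂, isOpen_interior,
    hKK₂, fun x hx => ?_⟩
  have := (eventually_nhdsSet_iff_forall.1 hf1 x (interior_subset hx)).self_of_nhds
  simp [this]

/-- The exterior of the unit ball. -/
def far (n : ℕ) : Set (Eucl n) := {ξ | 1 ≤ ‖ξ‖}

/-- `f ∼ ∑ F j` at infinity, `F j` being of order `μ - j`. -/
def HasExpansion (μ : ℝ) (f : Eucl n → ℂ) (F : ℕ → Eucl n → ℂ) : Prop :=
  ∀ N : ℕ, (fun ξ => f ξ - ∑ j ∈ Finset.range N, F j ξ) =O[𝓟 (far n)] fun ξ => ‖ξ‖ ^ (μ - N)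

theorem norm_rpow_isBigO_of_le {s t : ℝ} (h : s ≤ t) :
    (fun ξ : Eucl n => ‖ξ‖ ^ s) =O[𝓟 (far n)] fun ξ => ‖ξ‖ ^ t := by
  refine isBigO_principal.2 ⟨1, fun ξ hξ => ?_⟩
  rw [one_mul, Real.norm_of_nonneg (by positivity), Real.norm_of_nonneg (by positivity)]
  exact rpow_le_rpow_of_exponent_le hξ h

theorem IsBigO_mul_rpow {f g : Eucl n → ℂ} {s t : ℝ}
    (hf : f =O[𝓟 (far n)] fun ξ => ‖ξ‖ ^ s) (hg : g =O[𝓟 (far n)] fun ξ => ‖ξ‖ ^ t) :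
    (fun ξ => f ξ * g ξ) =O[𝓟 (far n)] fun ξ => ‖ξ‖ ^ (s + t) := by
  refine (hf.mul hg).congr' EventuallyEq.rfl ?_
  filter_upwards [mem_principal_self _] with ξ hξ
  rw [rpow_add (by have : 1 ≤ ‖ξ‖ := hξ; linarith)]

theorem HasExpansion.isBigO {μ : ℝ} {f : Eucl n → ℂ} {F : ℕ → Eucl n → ℂ}
    (h : HasExpansion μ f F) : f =O[𝓟 (far n)] fun ξ => ‖ξ‖ ^ μ := by
  simpa using h 0

/-- Each term is the difference of two consecutive remainders, so its order need not be assumed. -/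
theorem HasExpansion.term_isBigO {μ : ℝ} {f : Eucl n → ℂ} {F : ℕ → Eucl n → ℂ}
    (h : HasExpansion μ f F) (j : ℕ) : F j =O[𝓟 (far n)] fun ξ => ‖ξ‖ ^ (μ - j) := by
  have h1 := (h j).sub ((h (j + 1)).trans (norm_rpow_isBigO_of_le (t := μ - j)
    (by push_cast; linarith)))
  refine h1.congr_left fun ξ => ?_
  rw [Finset.sum_range_succ]
  ring

/-- Expansions whose terms have expansions. -/
theorem hasExpansion_double {μ : ℝ} {f : Eucl n → ℂ} {F : ℕ → Eucl n → ℂ}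
    {G : ℕ → ℕ → Eucl n → ℂ} (h : HasExpansion μ f F)
    (hF : ∀ r : ℕ, HasExpansion (μ - r) (F r) (G r)) :
    HasExpansion μ f (fun j ξ => ∑ r ∈ Finset.range (j + 1), G r (j - r) ξ) := by
  intro N
  have h1 : (fun ξ => ∑ r ∈ Finset.range N, (F r ξ - ∑ e ∈ Finset.range (N - r), G r e ξ))
      =O[𝓟 (far n)] fun ξ => ‖ξ‖ ^ (μ - N) := by
    refine IsBigO.fun_sum fun r hr => ?_
    have := hF r (N - r)
    rw [Nat.cast_sub (Finset.mem_range.1 hr).le] at this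
    simpa using this
  refine ((h N).add h1).congr_left fun ξ => ?_
  rw [Finset.sum_range_diag_flip N (fun r e => G r e ξ), Finset.sum_sub_distrib]
  ring

/-- First `f` is expanded, then `g` inside each term; `hasExpansion_double` regroups by total index.
-/
theorem HasExpansion.mul {μ ν : ℝ} {f g : Eucl n → ℂ} {F G : ℕ → Eucl n → ℂ}
    (hf : HasExpansion μ f F) (hg : HasExpansion ν g G) :
    HasExpansion (μ + ν) (fun ξ => f ξ * g ξ)
      (fun j ξ => ∑ r ∈ Finset.range (j + 1), F r ξ * G (j - r) ξ) := by
  refine hasExpansion_double (F := fun r ξ => F r ξ * g ξ) (G := fun r e ξ => F r ξ * G e ξ) ?_ ?_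
  · intro N
    refine ((IsBigO_mul_rpow (hf N) hg.isBigO).congr_left fun ξ => ?_).congr_right fun ξ => ?_
    · rw [sub_mul, Finset.sum_mul]
    · congr 1; ring
  · intro r N
    refine ((IsBigO_mul_rpow (hf.term_isBigO r) (hg N)).congr_left fun ξ => ?_).congr_right
      fun ξ => ?_
    · rw [mul_sub, Finset.mul_sum]
    · congr 1; ring

theorem HasExpansion.const_mul {μ : ℝ} {f : Eucl n → ℂ} {F : ℕ → Eucl n → ℂ}
    (h : HasExpansion μ f F) (c : ℂ) :
    HasExpansion μ (fun ξ => c * f ξ) (fun j ξ => c * F j ξ) := fun N =>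
  ((h N).const_mul_left c).congr_left fun ξ => by rw [mul_sub, Finset.mul_sum]

theorem HasExpansion.sub {μ : ℝ} {f g : Eucl n → ℂ} {F G : ℕ → Eucl n → ℂ}
    (hf : HasExpansion μ f F) (hg : HasExpansion μ g G) :
    HasExpansion μ (fun ξ => f ξ - g ξ) (fun j ξ => F j ξ - G j ξ) := fun N =>
  ((hf N).sub (hg N)).congr_left fun ξ => by rw [Finset.sum_sub_distrib]; ring

theorem HasExpansion.sum {μ : ℝ} {ι : Type*} (s : Finset ι) {f : ι → Eucl n → ℂ}
    {F : ι → ℕ → Eucl n → ℂ} (h : ∀ i ∈ s, HasExpansion μ (f i) (F i)) :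
    HasExpansion μ (fun ξ => ∑ i ∈ s, f i ξ) (fun j ξ => ∑ i ∈ s, F i j ξ) := fun N =>
  (IsBigO.fun_sum fun i hi => h i hi N).congr_left fun ξ => by
    rw [Finset.sum_sub_distrib, Finset.sum_comm (s := Finset.range N)]

theorem HasExpansion.add_isBigO {μ : ℝ} {f g : Eucl n → ℂ} {F : ℕ → Eucl n → ℂ}
    (h : HasExpansion μ f F) (hg : ∀ N : ℕ, g =O[𝓟 (far n)] fun ξ => ‖ξ‖ ^ (-(N : ℝ))) :
    HasExpansion μ (fun ξ => f ξ + g ξ) F := fun N => by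
  obtain ⟨N', hN'⟩ := exists_nat_ge (N - μ)
  exact ((h N).add ((hg N').trans (norm_rpow_isBigO_of_le (by linarith)))).congr_left
    fun ξ => by ring

theorem hasExpansion_one :
    HasExpansion (n := n) 0 (fun _ => 1) (fun j _ => if j = 0 then 1 else 0) := by
  intro N
  rcases Nat.eq_zero_or_pos N with rfl | hN
  · exact isBigO_principal.2 ⟨1, by simp⟩
  · have : (fun ξ : Eucl n => (1 : ℂ) - ∑ j ∈ Finset.range N, if j = 0 then 1 else 0) =
        fun _ => 0 := by
      ext ξ
      simp [hN]
    rw [this]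
    exact isBigO_zero _ _

theorem norm_rpow_le_of_far {ξ : Eucl n} (hξ : ξ ∈ far n) (s : ℝ) :
    ‖ξ‖ ^ s ≤ 2 ^ |s| * (1 + ‖ξ‖) ^ s := by
  have h1 : 1 ≤ ‖ξ‖ := hξ
  rcases le_total 0 s with hs | hs
  · calc ‖ξ‖ ^ s ≤ (1 + ‖ξ‖) ^ s := rpow_le_rpow (by positivity) (by linarith) hs
      _ ≤ _ := le_mul_of_one_le_left (by positivity) (one_le_rpow (by norm_num) (abs_nonneg s))
  · rw [abs_of_nonpos hs, rpow_neg (by norm_num), ← div_eq_inv_mul,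
      ← div_rpow (by positivity) (by positivity)]
    exact rpow_le_rpow_of_nonpos (by positivity) (by linarith) hs

theorem rpow_le_two_rpow_of_near {ξ : Eucl n} (hξ : ‖ξ‖ ≤ 1) (s : ℝ) :
    (1 + ‖ξ‖) ^ s ≤ 2 ^ |s| := by
  calc (1 + ‖ξ‖) ^ s ≤ (1 + ‖ξ‖) ^ |s| := rpow_one_add_norm_mono ξ (le_abs_self s)
    _ ≤ _ := rpow_le_rpow (by positivity) (by linarith) (abs_nonneg s)

/-- Polynomial growth together with the behaviour at infinity. -/
theorem exists_growth_of_near_far {ι : Type*} {S : Set ι} {f : ι → Eucl n → ℂ} {s C₀ C₁ : ℝ}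
    (h0 : ∀ t ∈ S, ∀ ξ, ‖ξ‖ ≤ 1 → ‖f t ξ‖ ≤ C₀)
    (h1 : ∀ t ∈ S, ∀ ξ ∈ far n, ‖f t ξ‖ ≤ C₁ * ‖ξ‖ ^ s) :
    ∃ C, 0 ≤ C ∧ ∀ t ∈ S, ∀ ξ, ‖f t ξ‖ ≤ C * (1 + ‖ξ‖) ^ s := by
  refine ⟨2 ^ |s| * (|C₀| + |C₁|), by positivity, fun t ht ξ => ?_⟩
  rcases le_total ‖ξ‖ 1 with hξ | hξ
  · have h2 : 1 ≤ 2 ^ |s| * (1 + ‖ξ‖) ^ s := by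
      have := rpow_le_two_rpow_of_near hξ (-s)
      rw [abs_neg, rpow_neg (by positivity)] at this
      calc (1 : ℝ) = ((1 + ‖ξ‖) ^ s)⁻¹ * (1 + ‖ξ‖) ^ s := by
            rw [inv_mul_cancel₀ (by positivity)]
        _ ≤ _ := by gcongr
    calc ‖f t ξ‖ ≤ (|C₀| + |C₁|) * 1 := by
          linarith [h0 t ht ξ hξ, le_abs_self C₀, abs_nonneg C₁]
      _ ≤ (|C₀| + |C₁|) * (2 ^ |s| * (1 + ‖ξ‖) ^ s) := by gcongr
      _ = _ := by ring
  · calc ‖f t ξ‖ ≤ |C₁| * ‖ξ‖ ^ s :=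
          (h1 t ht ξ hξ).trans (mul_le_mul_of_nonneg_right (le_abs_self _) (by positivity))
      _ ≤ (|C₀| + |C₁|) * (2 ^ |s| * (1 + ‖ξ‖) ^ s) := by
          refine mul_le_mul (by linarith [abs_nonneg C₀]) (norm_rpow_le_of_far hξ s)
            (by positivity) (by positivity)
      _ = _ := by ring

/-- Any crude polynomial bound controls the unit ball, so the order is decided by the behaviour at
infinity. -/
theorem exists_growth {f : Eucl n → ℂ} {s C M : ℝ} (h0 : ∀ ξ, ‖f ξ‖ ≤ C * (1 + ‖ξ‖) ^ M)
    (h1 : f =O[𝓟 (far n)] fun ξ => ‖ξ‖ ^ s) :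
    ∃ C, 0 ≤ C ∧ ∀ ξ, ‖f ξ‖ ≤ C * (1 + ‖ξ‖) ^ s := by
  obtain ⟨C₁, hC₁⟩ := isBigO_principal.1 h1
  obtain ⟨C', h, h'⟩ := exists_growth_of_near_far (ι := Unit) (S := Set.univ) (f := fun _ => f)
    (s := s) (C₀ := |C| * 2 ^ |M|) (C₁ := C₁)
    (fun _ _ ξ hξ => (h0 ξ).trans (mul_le_mul (le_abs_self C) (rpow_le_two_rpow_of_near hξ M)
      (by positivity) (abs_nonneg C)))
    (fun _ _ ξ hξ => by
      have := hC₁ ξ hξ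
      rwa [Real.norm_of_nonneg (by positivity)] at this)
  exact ⟨C', h, h' () trivial⟩

/-- The effect of the operator with symbol `f` on a rapidly oscillating function. -/
theorem oscInt_mul_oscillating (f χ : Eucl n → ℂ) (x₀ ζ : Eucl n) :
    oscInt (fun ξ => f ξ * oscInt (fun y => osc ζ y * χ y) (-ξ)) x₀ =
      osc x₀ ζ * ∫ η, osc x₀ η * (f (ζ + η) * oscInt χ (-η)) := by
  simp only [oscInt_osc_mul]
  rw [oscInt, ← integral_add_left_eq_self _ ζ, ← integral_const_mul]
  congr 1 with η
  rw [osc_add_right, show -(ζ + η) + ζ = -η by abel]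
  ring

/-- By homogeneity the scaled leading part is `F (ξ₀ + t⁻¹ η)`, which tends to `F ξ₀`: a fixed shift
of the frequency is invisible in the limit. The error, one order lower, is `O(t⁻¹)`. -/
theorem tendsto_scaled_symbol {μ : ℂ} {f F : Eucl n → ℂ}
    (hf : (fun ξ => f ξ - F ξ) =O[𝓟 (far n)] fun ξ => ‖ξ‖ ^ (μ.re - 1))
    (hhom : ∀ ξ, ξ ≠ 0 → ∀ t : ℝ, 0 < t → F (t • ξ) = (t : ℂ) ^ μ * F ξ)
    {ξ₀ : Eucl n} (hξ₀ : ξ₀ ≠ 0) (hcont : ContinuousAt F ξ₀) (η : Eucl n) :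
    Tendsto (fun t : ℝ => (t : ℂ) ^ (-μ) * f (t • ξ₀ + η)) atTop (𝓝 (F ξ₀)) := by
  obtain ⟨C, hC⟩ := isBigO_principal.1 hf
  have hlim : Tendsto (fun t : ℝ => ξ₀ + t⁻¹ • η) atTop (𝓝 ξ₀) := by
    simpa using (tendsto_const_nhds (x := ξ₀)).add
      ((tendsto_inv_atTop_zero (𝕜 := ℝ)).smul_const η)
  have h1 : Tendsto (fun t : ℝ => F (ξ₀ + t⁻¹ • η)) atTop (𝓝 (F ξ₀)) := hcont.tendsto.comp hlim
  have hn : Tendsto (fun t : ℝ => ‖ξ₀ + t⁻¹ • η‖) atTop (𝓝 ‖ξ₀‖) := hlim.norm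
  have hpos : 0 < ‖ξ₀‖ := norm_pos_iff.2 hξ₀
  have h2 : Tendsto (fun t : ℝ => C * (t⁻¹ * ‖ξ₀ + t⁻¹ • η‖ ^ (μ.re - 1))) atTop (𝓝 0) := by
    have := tendsto_inv_atTop_zero.mul (hn.rpow_const (p := μ.re - 1) (Or.inl hpos.ne'))
    simpa using this.const_mul C
  have hev : ∀ᶠ t : ℝ in atTop, 0 < t ∧ ξ₀ + t⁻¹ • η ≠ 0 ∧ 1 ≤ ‖t • ξ₀ + η‖ := by
    have e1 : ∀ᶠ t : ℝ in atTop, ‖ξ₀‖ / 2 < ‖ξ₀ + t⁻¹ • η‖ :=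
      hn.eventually (lt_mem_nhds (by linarith))
    filter_upwards [e1, eventually_gt_atTop 0, eventually_ge_atTop (2 / ‖ξ₀‖)] with t h h0 h2
    refine ⟨h0, fun h' => by rw [h', norm_zero] at h; linarith, ?_⟩
    have : t • ξ₀ + η = t • (ξ₀ + t⁻¹ • η) := by
      rw [smul_add, smul_smul, mul_inv_cancel₀ h0.ne', one_smul]
    rw [this, norm_smul, Real.norm_of_nonneg h0.le]
    rw [div_le_iff₀ hpos] at h2
    nlinarith
  have h3 : Tendsto (fun t : ℝ => (t : ℂ) ^ (-μ) * f (t • ξ₀ + η) - F (ξ₀ + t⁻¹ • η)) atTop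
      (𝓝 0) := by
    refine squeeze_zero_norm' ?_ h2
    filter_upwards [hev] with t ⟨h0, hne, hfar⟩
    have e : t • ξ₀ + η = t • (ξ₀ + t⁻¹ • η) := by
      rw [smul_add, smul_smul, mul_inv_cancel₀ h0.ne', one_smul]
    have ht : (t : ℂ) ^ (-μ) * (t : ℂ) ^ μ = 1 := by
      rw [← Complex.cpow_add _ _ (by exact_mod_cast h0.ne'), neg_add_cancel, Complex.cpow_zero]
    have e2 : F (ξ₀ + t⁻¹ • η) = (t : ℂ) ^ (-μ) * F (t • ξ₀ + η) := by
      rw [e, hhom _ hne t h0, ← mul_assoc, ht, one_mul]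
    rw [e2, ← mul_sub, norm_mul, Complex.norm_cpow_eq_rpow_re_of_pos h0]
    have hb := hC _ hfar
    rw [Real.norm_of_nonneg (by positivity)] at hb
    calc t ^ (-μ).re * ‖f (t • ξ₀ + η) - F (t • ξ₀ + η)‖
        ≤ t ^ (-μ).re * (C * ‖t • ξ₀ + η‖ ^ (μ.re - 1)) := by gcongr
      _ = C * (t⁻¹ * ‖ξ₀ + t⁻¹ • η‖ ^ (μ.re - 1)) := by
        rw [e, norm_smul, Real.norm_of_nonneg h0.le, mul_rpow h0.le (norm_nonneg _),
          rpow_sub h0, rpow_one, Complex.neg_re, rpow_neg h0.le]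
        have : t ^ μ.re ≠ 0 := (rpow_pos_of_pos h0 _).ne'
        field_simp
  simpa using h3.add h1

/-- Peetre's inequality splits off `η`; what remains is `(t⁻¹ + ‖ξ₀‖) ^ s`, bounded for `t ≥ 1`
whatever the sign of `s`. This provides the dominating function in `expansion_eq_zero`. -/
theorem scaled_symbol_bound {f : Eucl n → ℂ} {C s : ℝ} (hC : 0 ≤ C)
    (hf : ∀ ξ, ‖f ξ‖ ≤ C * (1 + ‖ξ‖) ^ s) {ξ₀ : Eucl n} (hξ₀ : ξ₀ ≠ 0) {t : ℝ} (ht : 1 ≤ t)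
    (η : Eucl n) : t ^ (-s) * ‖f (t • ξ₀ + η)‖ ≤
      C * (‖ξ₀‖ ^ s + (1 + ‖ξ₀‖) ^ s) * (1 + ‖η‖) ^ |s| := by
  have h0 : 0 < t := by linarith
  have hpos : 0 < ‖ξ₀‖ := norm_pos_iff.2 hξ₀
  have h1 : t ^ (-s) * (1 + ‖t • ξ₀‖) ^ s ≤ ‖ξ₀‖ ^ s + (1 + ‖ξ₀‖) ^ s := by
    have e : t ^ (-s) * (1 + ‖t • ξ₀‖) ^ s = (t⁻¹ + ‖ξ₀‖) ^ s := by
      rw [norm_smul, Real.norm_of_nonneg h0.le, rpow_neg h0.le, ← inv_rpow h0.le,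
        ← mul_rpow (by positivity) (by positivity), mul_add, mul_one, ← mul_assoc,
        inv_mul_cancel₀ h0.ne', one_mul]
    rw [e]
    have hi : t⁻¹ ≤ 1 := inv_le_one_of_one_le₀ ht
    have hi0 : 0 < t⁻¹ := inv_pos.2 h0
    rcases le_total 0 s with hs | hs
    · have : (t⁻¹ + ‖ξ₀‖) ^ s ≤ (1 + ‖ξ₀‖) ^ s := rpow_le_rpow (by positivity) (by linarith) hs
      have := rpow_nonneg hpos.le s
      linarith
    · have : (t⁻¹ + ‖ξ₀‖) ^ s ≤ ‖ξ₀‖ ^ s := rpow_le_rpow_of_nonpos hpos (by linarith) hs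
      have : 0 ≤ (1 + ‖ξ₀‖) ^ s := by positivity
      linarith
  calc t ^ (-s) * ‖f (t • ξ₀ + η)‖
      ≤ t ^ (-s) * (C * ((1 + ‖t • ξ₀‖) ^ s * (1 + ‖η‖) ^ |s|)) := by
        gcongr
        exact (hf _).trans (mul_le_mul_of_nonneg_left (peetre _ _ _) hC)
    _ = C * (t ^ (-s) * (1 + ‖t • ξ₀‖) ^ s) * (1 + ‖η‖) ^ |s| := by ring
    _ ≤ _ := by gcongr

/-- If the operator with symbol `f` agrees with an integral operator with smooth kernel `K` at the
point `x₀`, then all the homogeneous components of `f` vanish. -/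
theorem expansion_eq_zero {μ : ℂ} {f : Eucl n → ℂ} {F : ℕ → Eucl n → ℂ} {x₀ : Eucl n}
    {V : Set (Eucl n)} (hV : IsOpen V) (hx₀ : x₀ ∈ V) {K : Eucl n → ℂ} (hK : ContDiffOn ℝ ∞ K V)
    (hmeas : StronglyMeasurable f) {C M : ℝ} (hgrow : ∀ ξ, ‖f ξ‖ ≤ C * (1 + ‖ξ‖) ^ M)
    (hexp : HasExpansion μ.re f F)
    (hhom : ∀ j, ∀ ξ, ξ ≠ 0 → ∀ t : ℝ, 0 < t → F j (t • ξ) = (t : ℂ) ^ (μ - j) * F j ξ)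
    (hcont : ∀ j, ContinuousOn (F j) {0}ᶜ)
    (h : ∀ v : Eucl n → ℂ, ContDiff ℝ ∞ v → HasCompactSupport v → tsupport v ⊆ V →
      ((2 * Real.pi : ℝ) : ℂ) ^ (-(n : ℤ)) * oscInt (fun ξ => f ξ * oscInt v (-ξ)) x₀ =
        ∫ y, K y * v y) (j : ℕ) (ξ₀ : Eucl n) (hξ₀ : ξ₀ ≠ 0) : F j ξ₀ = 0 := by
  -- Once the earlier components vanish, `f` has order `μ - j` and leading part `F j`. The
  -- hypothesis `h` is tested on `χ` times the plane wave of frequency `t ξ₀` and multiplied by `t ^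
  -- (-(μ - j))`. As `t → ∞` the operator side tends to `F j ξ₀` and the kernel side to `0`.
  induction j using Nat.strong_induction_on generalizing ξ₀ with
  | _ j ih =>
  set c : ℂ := ((2 * Real.pi : ℝ) : ℂ) ^ (-(n : ℤ)) with hc
  obtain ⟨χ, hχ, hχc, hχV, W, hW, hxW, hχ1⟩ := exists_cutoff (isCompact_singleton (x := x₀)) hV
    (by simpa using hx₀)
  have hχx : χ x₀ = 1 := hχ1 x₀ (hxW rfl)
  have hne : ∀ ξ ∈ far n, ξ ≠ 0 := by
    rintro ξ hξ rfl
    have : (1 : ℝ) ≤ ‖(0 : Eucl n)‖ := hξ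
    rw [norm_zero] at this
    linarith
  have hsum : ∀ ξ ∈ far n, ∑ i ∈ Finset.range j, F i ξ = 0 := fun ξ hξ =>
    Finset.sum_eq_zero fun i hi => ih i (Finset.mem_range.1 hi) ξ (hne ξ hξ)
  have hre : (μ - j).re = μ.re - j := by simp
  have hO : f =O[𝓟 (far n)] fun ξ => ‖ξ‖ ^ (μ.re - j) := by
    refine (hexp j).congr' ?_ EventuallyEq.rfl
    filter_upwards [mem_principal_self _] with ξ hξ
    rw [hsum ξ hξ, sub_zero]
  have hO1 : (fun ξ => f ξ - F j ξ) =O[𝓟 (far n)] fun ξ => ‖ξ‖ ^ ((μ - j).re - 1) := by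
    refine (hexp (j + 1)).congr' ?_ ?_
    · filter_upwards [mem_principal_self _] with ξ hξ
      rw [Finset.sum_range_succ, hsum ξ hξ, zero_add]
    · refine Eventually.of_forall fun ξ => ?_
      simp only [hre]
      congr 1
      push_cast
      ring
  obtain ⟨C', hC'0, hC'⟩ := exists_growth hgrow hO
  have hKχ : ContDiff ℝ ∞ (fun y => K y * χ y) := by
    refine contDiff_iff_contDiffAt.2 fun y => ?_
    by_cases hy : y ∈ V
    · exact (hK.contDiffAt (hV.mem_nhds hy)).mul hχ.contDiffAt
    · have : (fun y => K y * χ y) =ᶠ[𝓝 y] fun _ => 0 := by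
        filter_upwards [(isClosed_tsupport χ).isOpen_compl.mem_nhds fun h => hy (hχV h)] with z hz
        rw [image_eq_zero_of_notMem_tsupport hz, mul_zero]
      exact contDiffAt_const.congr_of_eventuallyEq this
  have hKc : HasCompactSupport (fun y => K y * χ y) := hχc.mul_left
  -- the limit of the left hand side
  have hlim : Tendsto (fun t : ℝ => ∫ η, osc x₀ η *
      (((t : ℂ) ^ (-(μ - j)) * f (t • ξ₀ + η)) * oscInt χ (-η))) atTop
      (𝓝 (∫ η, osc x₀ η * (F j ξ₀ * oscInt χ (-η)))) := by
    -- The decay of the transform of `χ` has to absorb the power `|μ.re - j|` from Peetre's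
    -- inequality and leave `n + 1` orders for integrability.
    obtain ⟨N, hN⟩ := exists_nat_ge (|μ.re - j| + (n + 1))
    obtain ⟨D, hD0, hD⟩ := oscInt_bound_single hχ hχc N
    have hcχ : Continuous (oscInt χ) := continuous_oscInt (contDiff_integrable hχ hχc)
    refine tendsto_integral_filter_of_dominated_convergence
      (fun η => (C' * (‖ξ₀‖ ^ (μ.re - j) + (1 + ‖ξ₀‖) ^ (μ.re - j))) * D *
        (1 + ‖η‖) ^ (-((n : ℝ) + 1))) ?_ ?_ ?_ ?_
    · refine Eventually.of_forall fun t => ?_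
      refine AEStronglyMeasurable.mul ?_ (AEStronglyMeasurable.mul (.const_mul ?_ _) ?_)
      · exact (continuous_osc.comp (by fun_prop : Continuous fun y => (x₀, y))).aestronglyMeasurable
      · exact (hmeas.comp_measurable (measurable_const_add _)).aestronglyMeasurable
      · exact (hcχ.comp continuous_neg).aestronglyMeasurable
    · filter_upwards [eventually_ge_atTop 1] with t ht
      refine Eventually.of_forall fun η => ?_
      rw [norm_mul, norm_osc, one_mul, norm_mul, norm_mul,
        Complex.norm_cpow_eq_rpow_re_of_pos (by linarith), Complex.neg_re, hre]
      have h1 := scaled_symbol_bound hC'0 hC' hξ₀ ht η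
      have h2 := hD (-η)
      rw [norm_neg] at h2
      calc t ^ (-(μ.re - j)) * ‖f (t • ξ₀ + η)‖ * ‖oscInt χ (-η)‖
          ≤ (C' * (‖ξ₀‖ ^ (μ.re - j) + (1 + ‖ξ₀‖) ^ (μ.re - j)) * (1 + ‖η‖) ^ |μ.re - j|) *
            (D * (1 + ‖η‖) ^ (-(N : ℝ))) :=
            mul_le_mul h1 h2 (norm_nonneg _) (by positivity)
        _ = (C' * (‖ξ₀‖ ^ (μ.re - j) + (1 + ‖ξ₀‖) ^ (μ.re - j))) * D *
            (1 + ‖η‖) ^ (|μ.re - j| - N) := by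
            rw [sub_eq_add_neg |μ.re - j|, rpow_add (by positivity)]; ring
        _ ≤ _ := by
            refine mul_le_mul_of_nonneg_left (rpow_one_add_norm_mono η (by linarith)) ?_
            positivity
    · exact (integrable_one_add_norm_rpow (by linarith)).const_mul _
    · refine Eventually.of_forall fun η => ?_
      exact ((tendsto_scaled_symbol hO1 (hhom j) hξ₀
        ((hcont j).continuousAt (isOpen_compl_singleton.mem_nhds hξ₀)) η).mul_const _).const_mul _
  have hval : c * ∫ η, osc x₀ η * (F j ξ₀ * oscInt χ (-η)) = F j ξ₀ := by
    have := fourier_inversion hχ hχc x₀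
    rw [← hc, hχx] at this
    simp only [mul_left_comm _ (F j ξ₀)]
    rw [integral_const_mul, mul_left_comm]
    rw [oscInt] at this
    rw [this, mul_one]
  -- the limit of the right hand side
  have hlim2 : Tendsto (fun t : ℝ => (t : ℂ) ^ (-(μ - j)) * (osc (-x₀) (t • ξ₀) *
      oscInt (fun y => K y * χ y) (t • ξ₀))) atTop (𝓝 0) := by
    -- The transform of the smooth function `K χ` decays faster than the scaling factor `t ^ (-(μ.re
    -- - j))` can grow.
    obtain ⟨N, hN⟩ := exists_nat_gt (-(μ.re - j))
    obtain ⟨D, hD0, hD⟩ := oscInt_bound_single hKχ hKc N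
    have hpos : 0 < ‖ξ₀‖ := norm_pos_iff.2 hξ₀
    have ht0 : Tendsto (fun t : ℝ => D * ‖ξ₀‖ ^ (-(N : ℝ)) * t ^ (-(μ.re - j + N))) atTop (𝓝 0) := by
      simpa using (tendsto_rpow_neg_atTop (y := μ.re - j + N) (by linarith)).const_mul
        (D * ‖ξ₀‖ ^ (-(N : ℝ)))
    refine squeeze_zero_norm' ?_ ht0
    filter_upwards [eventually_gt_atTop 0] with t ht
    rw [norm_mul, norm_mul, norm_osc, one_mul, Complex.norm_cpow_eq_rpow_re_of_pos ht,
      Complex.neg_re, hre]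
    have h1 : (1 + ‖t • ξ₀‖) ^ (-(N : ℝ)) ≤ t ^ (-(N : ℝ)) * ‖ξ₀‖ ^ (-(N : ℝ)) := by
      rw [norm_smul, Real.norm_of_nonneg ht.le, ← mul_rpow ht.le hpos.le]
      exact rpow_le_rpow_of_nonpos (by positivity) (by linarith) (by simp)
    calc t ^ (-(μ.re - j)) * ‖oscInt (fun y => K y * χ y) (t • ξ₀)‖
        ≤ t ^ (-(μ.re - j)) * (D * (t ^ (-(N : ℝ)) * ‖ξ₀‖ ^ (-(N : ℝ)))) := by
          gcongr
          exact (hD _).trans (mul_le_mul_of_nonneg_left h1 hD0)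
      _ = _ := by
          rw [neg_add (μ.re - j), rpow_add ht]; ring
  have heq : ∀ t : ℝ, c * ∫ η, osc x₀ η *
      (((t : ℂ) ^ (-(μ - j)) * f (t • ξ₀ + η)) * oscInt χ (-η)) =
      (t : ℂ) ^ (-(μ - j)) * (osc (-x₀) (t • ξ₀) *
      oscInt (fun y => K y * χ y) (t • ξ₀)) := by
    intro t
    have hv : ContDiff ℝ ∞ fun y => osc (t • ξ₀) y * χ y := by
      refine ContDiff.mul ?_ hχ
      exact contDiff_osc.comp (contDiff_const.prodMk contDiff_id)
    have h1 := h (fun y => osc (t • ξ₀) y * χ y) hv hχc.mul_left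
      ((tsupport_mul_subset_right).trans hχV)
    rw [oscInt_mul_oscillating] at h1
    have h2 : (∫ y, K y * (osc (t • ξ₀) y * χ y)) = oscInt (fun y => K y * χ y) (t • ξ₀) := by
      rw [oscInt]; congr 1 with y; ring
    rw [h2] at h1
    rw [← h1]
    have h3 : (∫ η, osc x₀ η * (((t : ℂ) ^ (-(μ - j)) * f (t • ξ₀ + η)) * oscInt χ (-η))) =
        (t : ℂ) ^ (-(μ - j)) * ∫ η, osc x₀ η * (f (t • ξ₀ + η) * oscInt χ (-η)) := by
      rw [← integral_const_mul]; congr 1 with η; ring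
    rw [h3]
    -- The modulation produces the phase `osc x₀ (t • ξ₀)`, which its inverse at `-x₀` cancels.
    linear_combination (-(c * (t : ℂ) ^ (-(μ - j)) *
      ∫ η, osc x₀ η * (f (t • ξ₀ + η) * oscInt χ (-η)))) * osc_mul_osc_neg x₀ (t • ξ₀)
  have := tendsto_nhds_unique ((hlim.const_mul c).congr heq) hlim2
  rwa [hval] at this

end Expansions

/-! ### The symbol of a composition -/

section Composition

open MeasureTheory Real Filter Asymptotics

theorem sum_fin_succ_arrow {M : Type*} [AddCommMonoid M] {r : ℕ}
    (f : (Fin (r + 1) → Fin n) → M) :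
    ∑ J, f J = ∑ i, ∑ J : Fin r → Fin n, f (Fin.cons i J) := by
  rw [← (Fin.consEquiv fun _ : Fin (r + 1) => Fin n).sum_comp, Fintype.sum_prod_type]
  rfl

/-- The derivatives of `p` along a line. -/
theorem iteratedDeriv_line {p : Eucl n → ℂ} (hp : ContDiff ℝ ∞ p) (ξ ζ : Eucl n) (r : ℕ) :
    iteratedDeriv r (fun t : ℝ => p (ξ + t • ζ)) = fun t =>
      ∑ J : Fin r → Fin n, ((∏ k, ζ (J k) : ℝ) : ℂ) * pd (List.ofFn J) p (ξ + t • ζ) := by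
  induction r with
  | zero => ext t; simp [pd]
  | succ r ih =>
    rw [iteratedDeriv_succ, ih]
    ext t
    have hline : HasDerivAt (fun t : ℝ => ξ + t • ζ) ζ t := by
      simpa using ((hasDerivAt_id t).smul_const ζ).const_add ξ
    have h1 : ∀ J : Fin r → Fin n, HasDerivAt (fun t : ℝ => ((∏ k, ζ (J k) : ℝ) : ℂ) *
        pd (List.ofFn J) p (ξ + t • ζ)) (((∏ k, ζ (J k) : ℝ) : ℂ) *
          ∑ i, ((ζ i : ℝ) : ℂ) * pd (i :: List.ofFn J) p (ξ + t • ζ)) t := by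
      intro J
      have hd : HasFDerivAt (pd (List.ofFn J) p) _ (ξ + t • ζ) :=
        (((contDiff_pd hp _).differentiable (by simp)) _).hasFDerivAt
      have := (hd.comp_hasDerivAt t hline).const_mul ((∏ k, ζ (J k) : ℝ) : ℂ)
      rw [fderiv_apply_eq_sum] at this
      simpa [pd] using this
    rw [(HasDerivAt.fun_sum fun J _ => h1 J).deriv, sum_fin_succ_arrow, Finset.sum_comm]
    refine Finset.sum_congr rfl fun J _ => ?_
    rw [Finset.mul_sum]
    refine Finset.sum_congr rfl fun i _ => ?_
    rw [List.ofFn_cons, Fin.prod_univ_succ]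
    simp only [Fin.cons_zero, Fin.cons_succ]
    push_cast
    ring

/-- The term of order `r` in the Taylor expansion of `p` at `ξ`. -/
def taylorTerm (p : Eucl n → ℂ) (r : ℕ) (ξ ζ : Eucl n) : ℂ :=
  ((r.factorial : ℝ)⁻¹ : ℝ) *
    ∑ J : Fin r → Fin n, ((∏ k, ζ (J k) : ℝ) : ℂ) * pd (List.ofFn J) p ξ

/-- The one-variable Taylor formula on the segment from `ξ` to `ξ + ζ`. The inverse factorial in the
remainder is at most one and is dropped. -/
theorem taylor_remainder {p : Eucl n → ℂ} (hp : ContDiff ℝ ∞ p) (ξ ζ : Eucl n) (N : ℕ) {B : ℝ}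
    (hB : ∀ t ∈ Set.Icc (0 : ℝ) 1, ‖∑ J : Fin N → Fin n,
      ((∏ k, ζ (J k) : ℝ) : ℂ) * pd (List.ofFn J) p (ξ + t • ζ)‖ ≤ B) :
    ‖p (ξ + ζ) - ∑ r ∈ Finset.range N, taylorTerm p r ξ ζ‖ ≤ B := by
  have hB0 : 0 ≤ B := (norm_nonneg _).trans (hB 0 ⟨le_rfl, zero_le_one⟩)
  cases N with
  | zero => simpa [pd] using hB 1 ⟨zero_le_one, le_rfl⟩
  | succ N =>
    have hsm : ContDiff ℝ ∞ (fun t : ℝ => p (ξ + t • ζ)) :=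
      hp.comp (contDiff_const.add (contDiff_id.smul contDiff_const))
    have hw : ∀ k : ℕ, ∀ t ∈ Set.Icc (0 : ℝ) 1, iteratedDerivWithin k (fun t : ℝ => p (ξ + t • ζ))
        (Set.Icc 0 1) t = iteratedDeriv k (fun t : ℝ => p (ξ + t • ζ)) t := fun k t ht =>
      iteratedDerivWithin_eq_iteratedDeriv (uniqueDiffOn_Icc zero_lt_one)
        (hsm.contDiffAt.of_le (by exact_mod_cast le_top)) ht
    have h := taylor_mean_remainder_bound (f := fun t : ℝ => p (ξ + t • ζ)) (a := 0) (b := 1)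
      (C := B) (x := 1) (n := N) zero_le_one (hsm.contDiffOn.of_le (by exact_mod_cast le_top))
      ⟨zero_le_one, le_rfl⟩ (fun t ht => by
        rw [hw _ t ht, iteratedDeriv_line hp]; exact hB t ht)
    rw [taylor_within_apply] at h
    have e : ∀ k ∈ Finset.range (N + 1), (((k.factorial : ℝ)⁻¹ * ((1 : ℝ) - 0) ^ k) •
        iteratedDerivWithin k (fun t : ℝ => p (ξ + t • ζ)) (Set.Icc 0 1) 0) =
        taylorTerm p k ξ ζ := by
      intro k _
      rw [hw k 0 ⟨le_rfl, zero_le_one⟩, iteratedDeriv_line hp, taylorTerm]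
      simp
    rw [Finset.sum_congr rfl e] at h
    simp only [one_smul, sub_zero, one_pow, mul_one] at h
    refine h.trans (div_le_self hB0 ?_)
    exact_mod_cast Nat.one_le_iff_ne_zero.2 (Nat.factorial_ne_zero N)

/-- Symbol estimates of order `m` on `ℝⁿ`. -/
structure SymbolBound (p : Eucl n → ℂ) (m : ℝ) : Prop where
  smooth : ContDiff ℝ ∞ p
  bound : ∀ l : List (Fin n), ∃ C, ∀ ξ, ‖pd l p ξ‖ ≤ C * (1 + ‖ξ‖) ^ (m - l.length)

theorem abs_prod_coord_le (ζ : Eucl n) {r : ℕ} (J : Fin r → Fin n) :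
    |∏ k, ζ (J k)| ≤ (1 + ‖ζ‖) ^ (r : ℝ) := by
  rw [Finset.abs_prod, rpow_natCast]
  calc ∏ k, |ζ (J k)| ≤ ∏ _k : Fin r, (1 + ‖ζ‖) :=
        Finset.prod_le_prod (fun _ _ => abs_nonneg _) fun k _ => by
          linarith [abs_coord_le_norm ζ (J k)]
    _ = _ := by simp

/-- Derivatives of order `N` gain `N` orders of decay at `ξ + tζ`. Peetre's inequality moves this
decay to `ξ` at the price of a power of `1 + ‖ζ‖`, so no smallness of `ζ` relative to `ξ` is
required. -/
theorem SymbolBound.taylor {p : Eucl n → ℂ} {m : ℝ} (hp : SymbolBound p m) (N : ℕ) :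
    ∃ C, 0 ≤ C ∧ ∀ ξ ζ, ‖p (ξ + ζ) - ∑ r ∈ Finset.range N, taylorTerm p r ξ ζ‖ ≤
      C * (1 + ‖ξ‖) ^ (m - N) * (1 + ‖ζ‖) ^ (N + |m - N|) := by
  choose C hC using fun J : Fin N → Fin n => hp.bound (List.ofFn J)
  refine ⟨∑ J, |C J|, Finset.sum_nonneg fun _ _ => abs_nonneg _, fun ξ ζ => ?_⟩
  refine taylor_remainder hp.smooth ξ ζ N fun t ht => ?_
  rw [Finset.sum_mul, Finset.sum_mul]
  refine (norm_sum_le _ _).trans (Finset.sum_le_sum fun J _ => ?_)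
  rw [norm_mul, Complex.norm_real, Real.norm_eq_abs]
  have h1 := hC J (ξ + t • ζ)
  rw [List.length_ofFn] at h1
  have h2 : (1 + ‖t • ζ‖) ^ |m - N| ≤ (1 + ‖ζ‖) ^ |m - N| := by
    refine rpow_le_rpow (by positivity) ?_ (abs_nonneg _)
    rw [norm_smul, Real.norm_of_nonneg ht.1]
    nlinarith [ht.2, norm_nonneg ζ]
  calc |∏ k, ζ (J k)| * ‖pd (List.ofFn J) p (ξ + t • ζ)‖
      ≤ (1 + ‖ζ‖) ^ (N : ℝ) * (|C J| * ((1 + ‖ξ‖) ^ (m - N) * (1 + ‖ζ‖) ^ |m - N|)) := by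
        refine mul_le_mul (abs_prod_coord_le ζ J) (h1.trans ?_) (norm_nonneg _) (by positivity)
        refine mul_le_mul (le_abs_self _) ?_ (by positivity) (abs_nonneg _)
        exact (peetre _ _ _).trans (mul_le_mul_of_nonneg_left h2 (by positivity))
    _ = _ := by rw [rpow_add (by positivity)]; ring

/-- Amplitudes of order `s` with support in `L × ℝⁿ`. -/
structure AmplitudeBound (Q : Eucl n → Eucl n → ℂ) (L : Set (Eucl n)) (s : ℝ) : Prop where
  smooth : ContDiff ℝ ∞ (Function.uncurry Q)
  support : ∀ ξ, ∀ y ∉ L, Q y ξ = 0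
  bound : ∀ l : List (Fin n), ∃ C, ∀ ξ, ∀ y ∈ L, ‖pd l (fun y => Q y ξ) y‖ ≤ C * (1 + ‖ξ‖) ^ s

variable {Q : Eucl n → Eucl n → ℂ} {L : Set (Eucl n)} {s : ℝ}

theorem AmplitudeBound.smooth_slice (hQ : AmplitudeBound Q L s) (ξ : Eucl n) :
    ContDiff ℝ ∞ (fun y => Q y ξ) :=
  hQ.smooth.comp (contDiff_id.prodMk contDiff_const)

theorem AmplitudeBound.tsupport_subset (hQ : AmplitudeBound Q L s) (hL : IsCompact L) (ξ : Eucl n) :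
    tsupport (fun y => Q y ξ) ⊆ L :=
  closure_minimal (fun y hy => by by_contra h; exact hy (hQ.support ξ y h)) hL.isClosed

theorem AmplitudeBound.hasCompactSupport (hQ : AmplitudeBound Q L s) (hL : IsCompact L)
    (ξ : Eucl n) : HasCompactSupport (fun y => Q y ξ) :=
  hL.of_isClosed_subset (isClosed_tsupport _) (hQ.tsupport_subset hL ξ)

/-- The Fourier transform of an amplitude in the first variable. -/
def amplitudeFT (Q : Eucl n → Eucl n → ℂ) (ξ ζ : Eucl n) : ℂ := oscInt (fun y => Q y ξ) (-ζ)

theorem AmplitudeBound.ft_bound (hQ : AmplitudeBound Q L s) (hL : IsCompact L) (N : ℕ) :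
    ∃ C, 0 ≤ C ∧ ∀ ξ ζ, ‖amplitudeFT Q ξ ζ‖ ≤ C * (1 + ‖ξ‖) ^ s * (1 + ‖ζ‖) ^ (-(N : ℝ)) := by
  obtain ⟨C, h0, hC⟩ := oscInt_bound_family (S := Set.univ) hL (v := fun ξ y => Q y ξ)
    (A := fun ξ => (1 + ‖ξ‖) ^ s) (fun ξ _ => by positivity) (fun ξ _ => hQ.smooth_slice ξ)
    (fun ξ _ => hQ.tsupport_subset hL ξ) (fun l => by
      obtain ⟨C, hC⟩ := hQ.bound l
      exact ⟨C, fun ξ _ => hC ξ⟩) N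
  exact ⟨C, h0, fun ξ ζ => by simpa [amplitudeFT] using hC ξ trivial (-ζ)⟩

theorem AmplitudeBound.stronglyMeasurable_ft (hQ : AmplitudeBound Q L s) :
    StronglyMeasurable (fun q : Eucl n × Eucl n => amplitudeFT Q q.1 q.2) := by
  have hc : Continuous fun z : (Eucl n × Eucl n) × Eucl n => osc (-z.1.2) z.2 * Q z.2 z.1.1 := by
    refine (continuous_osc.comp (by fun_prop : Continuous fun z : (Eucl n × Eucl n) × Eucl n =>
      (-z.1.2, z.2))).mul ?_
    exact hQ.smooth.continuous.comp (by fun_prop : Continuous fun z : (Eucl n × Eucl n) × Eucl n =>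
      (z.2, z.1.1))
  exact hc.stronglyMeasurable.integral_prod_right'

/-- The symbol, at the point `x₀`, of the composition of the operators with symbols `p` and `Q`. -/
def compSymbol (p : Eucl n → ℂ) (Q : Eucl n → Eucl n → ℂ) (x₀ ξ : Eucl n) : ℂ :=
  ((2 * Real.pi : ℝ) : ℂ) ^ (-(n : ℤ)) * oscInt (fun ζ => p (ξ + ζ) * amplitudeFT Q ξ ζ) x₀

theorem stronglyMeasurable_compSymbol {p : Eucl n → ℂ} (hp : Continuous p)
    (hQ : AmplitudeBound Q L s) (x₀ : Eucl n) : StronglyMeasurable (compSymbol p Q x₀) := by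
  have h1 : StronglyMeasurable fun q : Eucl n × Eucl n =>
      osc x₀ q.2 * (p (q.1 + q.2) * amplitudeFT Q q.1 q.2) := by
    refine StronglyMeasurable.mul ?_ (StronglyMeasurable.mul ?_ hQ.stronglyMeasurable_ft)
    · exact (continuous_osc.comp (by fun_prop : Continuous fun z : Eucl n × Eucl n =>
        (x₀, z.2))).stronglyMeasurable
    · exact (hp.comp (continuous_fst.add continuous_snd)).stronglyMeasurable
  exact h1.integral_prod_right'.const_mul _

theorem oscInt_pd {v : Eucl n → ℂ} (hv : ContDiff ℝ ∞ v) (hc : HasCompactSupport v)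
    (l : List (Fin n)) (ζ : Eucl n) : oscInt (pd l v) (-ζ) =
      (l.map fun i => Complex.I * ((ζ i : ℝ) : ℂ)).prod * oscInt v (-ζ) := by
  induction l with
  | nil => simp [pd]
  | cons i l ih =>
    rw [pd_cons_eq_pd_singleton, oscInt_pd_singleton (contDiff_pd hv l) (hasCompactSupport_pd hc l),
      ih, List.map_cons, List.prod_cons]
    simp
    ring

/-- A monomial in `ζ` on the Fourier side is `(-i) ^ r` times a derivative of `v`, which Fourier
inversion evaluates at `x₀`. -/
theorem oscInt_coord_mul {v : Eucl n → ℂ} (hv : ContDiff ℝ ∞ v) (hc : HasCompactSupport v)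
    {r : ℕ} (J : Fin r → Fin n) (x₀ : Eucl n) :
    ((2 * Real.pi : ℝ) : ℂ) ^ (-(n : ℤ)) *
      oscInt (fun ζ => ((∏ k, ζ (J k) : ℝ) : ℂ) * oscInt v (-ζ)) x₀ =
      (-Complex.I) ^ r * pd (List.ofFn J) v x₀ := by
  have h : ∀ ζ : Eucl n, ((∏ k, ζ (J k) : ℝ) : ℂ) * oscInt v (-ζ) =
      (-Complex.I) ^ r * oscInt (pd (List.ofFn J) v) (-ζ) := by
    intro ζ
    rw [oscInt_pd hv hc, List.map_ofFn, List.prod_ofFn, ← mul_assoc]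
    congr 1
    simp only [Function.comp]
    rw [Finset.prod_mul_distrib, Finset.prod_const, Finset.card_univ, Fintype.card_fin,
      ← mul_assoc, ← mul_pow]
    simp
  simp only [h]
  rw [oscInt_const_mul, mul_left_comm, fourier_inversion (contDiff_pd hv _)
    (hasCompactSupport_pd hc _)]

/-- The term of order `r` in the expansion of `compSymbol p Q x₀`. -/
def compTerm (p : Eucl n → ℂ) (q : Eucl n → Eucl n → ℂ) (r : ℕ) (x₀ ξ : Eucl n) : ℂ :=
  ((r.factorial : ℝ)⁻¹ : ℝ) * ∑ J : Fin r → Fin n,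
    pd (List.ofFn J) p ξ * ((-Complex.I) ^ r * pd (List.ofFn J) (fun y => q y ξ) x₀)

/-- In the integral for `compSymbol`, `p (ξ + ζ)` is expanded in powers of `ζ`. The polynomial terms
are computed by `oscInt_coord_mul`; the growth of the Taylor remainder in `ζ` is absorbed by the
rapid decay of `amplitudeFT`. -/
theorem compSymbol_expansion {p : Eucl n → ℂ} {m : ℝ} (hp : SymbolBound p m)
    (hQ : AmplitudeBound Q L s) (hL : IsCompact L) (x₀ : Eucl n) (N : ℕ) :
    ∃ C, 0 ≤ C ∧ ∀ ξ, ‖compSymbol p Q x₀ ξ - ∑ r ∈ Finset.range N, compTerm p Q r x₀ ξ‖ ≤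
      C * (1 + ‖ξ‖) ^ (m + s - N) := by
  set c : ℂ := ((2 * Real.pi : ℝ) : ℂ) ^ (-(n : ℤ)) with hc
  obtain ⟨C₁, h₁, hC₁⟩ := hp.taylor N
  -- The remainder grows like the power `N + |m - N|` of `1 + ‖ζ‖`; the other `n + 1` orders make
  -- the product integrable.
  obtain ⟨N', hN'⟩ := exists_nat_ge (N + |m - N| + (n + 1))
  obtain ⟨C₂, h₂, hC₂⟩ := hQ.ft_bound hL N'
  obtain ⟨C₃, h₃, hC₃⟩ := hp.taylor 0
  have hGm : ∀ ξ, AEStronglyMeasurable (amplitudeFT Q ξ) volume := fun ξ =>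
    (hQ.stronglyMeasurable_ft.comp_measurable (measurable_const.prodMk measurable_id :
      Measurable fun ζ : Eucl n => (ξ, ζ))).aestronglyMeasurable
  have hJ : ∀ ξ, ∀ (r : ℕ) (J : Fin r → Fin n),
      Integrable fun ζ : Eucl n => ((∏ k, ζ (J k) : ℝ) : ℂ) * amplitudeFT Q ξ ζ := by
    intro ξ r J
    obtain ⟨C, h0, hC⟩ := hQ.ft_bound hL (r + (n + 1))
    refine integrable_of_norm_le_rpow (C := C * (1 + ‖ξ‖) ^ s) (t := -(n + 1 : ℝ))
      (AEStronglyMeasurable.mul (Continuous.aestronglyMeasurable (by fun_prop)) (hGm ξ))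
      (by linarith) fun ζ => ?_
    rw [norm_mul, Complex.norm_real, Real.norm_eq_abs]
    calc |∏ k, ζ (J k)| * ‖amplitudeFT Q ξ ζ‖ ≤ (1 + ‖ζ‖) ^ (r : ℝ) *
          (C * (1 + ‖ξ‖) ^ s * (1 + ‖ζ‖) ^ (-((r + (n + 1) : ℕ) : ℝ))) :=
          mul_le_mul (abs_prod_coord_le ζ J) (hC ξ ζ) (norm_nonneg _) (by positivity)
      _ = C * (1 + ‖ξ‖) ^ s * ((1 + ‖ζ‖) ^ (r : ℝ) * (1 + ‖ζ‖) ^ (-((r + (n + 1) : ℕ) : ℝ))) := by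
          ring
      _ = _ := by
          rw [← rpow_add (by positivity)]
          congr 2
          push_cast
          ring
  have hterm : ∀ ξ r, c * oscInt (fun ζ => taylorTerm p r ξ ζ * amplitudeFT Q ξ ζ) x₀ =
      compTerm p Q r x₀ ξ := by
    intro ξ r
    have e : (fun ζ => taylorTerm p r ξ ζ * amplitudeFT Q ξ ζ) = fun ζ =>
        (((r.factorial : ℝ)⁻¹ : ℝ) : ℂ) * ∑ J : Fin r → Fin n, pd (List.ofFn J) p ξ *
          (((∏ k, ζ (J k) : ℝ) : ℂ) * amplitudeFT Q ξ ζ) := by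
      ext ζ
      rw [taylorTerm, mul_assoc, Finset.sum_mul]
      congr 1
      exact Finset.sum_congr rfl fun J _ => by ring
    rw [e, oscInt_const_mul, oscInt_sum _ (fun J _ => (hJ ξ r J).const_mul _), compTerm,
      mul_left_comm, Finset.mul_sum]
    congr 1
    refine Finset.sum_congr rfl fun J _ => ?_
    rw [oscInt_const_mul, mul_left_comm]
    congr 1
    exact oscInt_coord_mul (hQ.smooth_slice ξ) (hQ.hasCompactSupport hL ξ) J x₀
  have hR : ∀ ξ ζ, ‖(p (ξ + ζ) - ∑ r ∈ Finset.range N, taylorTerm p r ξ ζ) *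
      amplitudeFT Q ξ ζ‖ ≤ C₁ * C₂ * (1 + ‖ξ‖) ^ (m + s - N) * (1 + ‖ζ‖) ^ (-(n + 1 : ℝ)) := by
    intro ξ ζ
    rw [norm_mul]
    calc _ ≤ (C₁ * (1 + ‖ξ‖) ^ (m - N) * (1 + ‖ζ‖) ^ (N + |m - N|)) *
          (C₂ * (1 + ‖ξ‖) ^ s * (1 + ‖ζ‖) ^ (-(N' : ℝ))) :=
          mul_le_mul (hC₁ ξ ζ) (hC₂ ξ ζ) (norm_nonneg _) (by positivity)
      _ = C₁ * C₂ * (1 + ‖ξ‖) ^ (m + s - N) * (1 + ‖ζ‖) ^ (N + |m - N| - N') := by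
          rw [show m + s - N = (m - N) + s by ring, rpow_add (x := 1 + ‖ξ‖) (by positivity),
            sub_eq_add_neg (N + |m - N|), rpow_add (x := 1 + ‖ζ‖) (z := -(N' : ℝ)) (by positivity)]
          ring
      _ ≤ _ := mul_le_mul_of_nonneg_left (rpow_one_add_norm_mono ζ (by linarith)) (by positivity)
  have hTm : ∀ ξ r, Continuous fun ζ => taylorTerm p r ξ ζ := by
    intro ξ r
    unfold taylorTerm
    fun_prop
  have hRi : ∀ ξ, Integrable fun ζ => (p (ξ + ζ) - ∑ r ∈ Finset.range N, taylorTerm p r ξ ζ) *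
      amplitudeFT Q ξ ζ := by
    intro ξ
    refine integrable_of_norm_le_rpow ?_ (by linarith) (hR ξ)
    refine AEStronglyMeasurable.mul (Continuous.aestronglyMeasurable ?_) (hGm ξ)
    exact (hp.smooth.continuous.comp (continuous_const.add continuous_id)).sub
      (continuous_finsetSum _ fun r _ => hTm ξ r)
  have hTi : ∀ ξ r, Integrable fun ζ => taylorTerm p r ξ ζ * amplitudeFT Q ξ ζ := by
    intro ξ r
    have : (fun ζ => taylorTerm p r ξ ζ * amplitudeFT Q ξ ζ) = fun ζ =>
        (((r.factorial : ℝ)⁻¹ : ℝ) : ℂ) * ∑ J : Fin r → Fin n, pd (List.ofFn J) p ξ *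
          (((∏ k, ζ (J k) : ℝ) : ℂ) * amplitudeFT Q ξ ζ) := by
      ext ζ
      rw [taylorTerm, mul_assoc, Finset.sum_mul]
      congr 1
      exact Finset.sum_congr rfl fun J _ => by ring
    rw [this]
    exact (integrable_finsetSum _ fun J _ => (hJ ξ r J).const_mul _).const_mul _
  set D : ℝ := ∫ ζ : Eucl n, (1 + ‖ζ‖) ^ (-(n + 1 : ℝ)) with hD
  have hD0 : 0 ≤ D := integral_nonneg fun ζ => by positivity
  refine ⟨‖c‖ * (C₁ * C₂ * D), by positivity, fun ξ => ?_⟩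
  have hsplit : compSymbol p Q x₀ ξ - ∑ r ∈ Finset.range N, compTerm p Q r x₀ ξ =
      c * oscInt (fun ζ => (p (ξ + ζ) - ∑ r ∈ Finset.range N, taylorTerm p r ξ ζ) *
        amplitudeFT Q ξ ζ) x₀ := by
    have e1 : (fun ζ => p (ξ + ζ) * amplitudeFT Q ξ ζ) = fun ζ =>
        (p (ξ + ζ) - ∑ r ∈ Finset.range N, taylorTerm p r ξ ζ) * amplitudeFT Q ξ ζ +
          ∑ r ∈ Finset.range N, taylorTerm p r ξ ζ * amplitudeFT Q ξ ζ := by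
      ext ζ
      rw [sub_mul, Finset.sum_mul]
      ring
    rw [compSymbol, e1, oscInt_add (hRi ξ) (integrable_finsetSum _ fun r _ => hTi ξ r),
      oscInt_sum _ (fun r _ => hTi ξ r), mul_add, Finset.mul_sum,
      Finset.sum_congr rfl fun r _ => hterm ξ r]
    ring
  rw [hsplit, norm_mul, mul_assoc]
  refine mul_le_mul_of_nonneg_left ?_ (norm_nonneg _)
  refine (norm_oscInt_le _ _).trans ?_
  calc _ ≤ ∫ ζ, C₁ * C₂ * (1 + ‖ξ‖) ^ (m + s - N) * (1 + ‖ζ‖) ^ (-(n + 1 : ℝ)) :=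
        integral_mono (hRi ξ).norm
          ((integrable_one_add_norm_rpow (by linarith)).const_mul _) (hR ξ)
    _ = _ := by rw [integral_const_mul, ← hD]; ring

theorem rpow_one_add_norm_le_of_far {ξ : Eucl n} (hξ : ξ ∈ far n) (s : ℝ) :
    (1 + ‖ξ‖) ^ s ≤ 2 ^ |s| * ‖ξ‖ ^ s := by
  have h1 : 1 ≤ ‖ξ‖ := hξ
  rcases le_total 0 s with hs | hs
  · rw [abs_of_nonneg hs, ← mul_rpow (by norm_num) (by positivity)]
    exact rpow_le_rpow (by positivity) (by linarith) hs
  · calc (1 + ‖ξ‖) ^ s ≤ ‖ξ‖ ^ s := rpow_le_rpow_of_nonpos (by linarith) (by linarith) hs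
      _ ≤ _ := le_mul_of_one_le_left (by positivity) (one_le_rpow (by norm_num) (abs_nonneg s))

theorem isBigO_of_growth {f : Eucl n → ℂ} {C t : ℝ} (hC : 0 ≤ C)
    (h : ∀ ξ, ‖f ξ‖ ≤ C * (1 + ‖ξ‖) ^ t) : f =O[𝓟 (far n)] fun ξ => ‖ξ‖ ^ t := by
  refine isBigO_principal.2 ⟨C * 2 ^ |t|, fun ξ hξ => (h ξ).trans ?_⟩
  rw [Real.norm_of_nonneg (by positivity), mul_assoc]
  exact mul_le_mul_of_nonneg_left (rpow_one_add_norm_le_of_far hξ t) hC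

theorem hasExpansion_compSymbol {p : Eucl n → ℂ} {m : ℝ} (hp : SymbolBound p m)
    (hQ : AmplitudeBound Q L s) (hL : IsCompact L) (x₀ : Eucl n) :
    HasExpansion (m + s) (compSymbol p Q x₀) (fun r => compTerm p Q r x₀) := fun N => by
  obtain ⟨C, h0, hC⟩ := compSymbol_expansion hp hQ hL x₀ N
  exact isBigO_of_growth h0 hC

theorem integrable_prod_of_bound {f : Eucl n × Eucl n → ℂ} (hf : StronglyMeasurable f) {C : ℝ}
    (h : ∀ y ξ, ‖f (y, ξ)‖ ≤ C * ((1 + ‖y‖) ^ (-(n + 1 : ℝ)) * (1 + ‖ξ‖) ^ (-(n + 1 : ℝ)))) :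
    Integrable f (volume.prod volume) := by
  have h1 := integrable_one_add_norm_rpow (n := n) (t := -(n + 1 : ℝ)) (by linarith)
  exact ((h1.mul_prod h1).const_mul C).mono' hf.aestronglyMeasurable
    (Eventually.of_forall fun z => h z.1 z.2)

/-- Trades compact support in `y` for an integrable weight, as `integrable_prod_of_bound` requires.
-/
theorem one_le_of_mem_compact (hL : IsCompact L) : ∃ D, 0 ≤ D ∧ ∀ y ∈ L,
    1 ≤ D * (1 + ‖y‖) ^ (-(n + 1 : ℝ)) := by
  obtain ⟨D, hD⟩ := hL.exists_bound_of_continuousOn (f := fun y : Eucl n =>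
    (1 + ‖y‖) ^ (n + 1 : ℝ)) (Continuous.continuousOn
      (Continuous.rpow_const (by fun_prop) fun y => Or.inr (by positivity)))
  refine ⟨|D|, abs_nonneg D, fun y hy => ?_⟩
  have := hD y hy
  rw [Real.norm_of_nonneg (by positivity)] at this
  rw [rpow_neg (by positivity), ← div_eq_mul_inv, le_div_iff₀ (by positivity), one_mul]
  exact this.trans (le_abs_self D)

/-- By Fubini, the transform of the output is a superposition over input frequencies `ξ`, in which
`Q` enters through its transform at the frequency shift `η - ξ`. -/
theorem oscInt_amplitude (hQ : AmplitudeBound Q L s) (hL : IsCompact L) {V : Eucl n → ℂ}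
    (hVc : Continuous V) (hV : ∀ N : ℕ, ∃ C, 0 ≤ C ∧ ∀ ξ, ‖V ξ‖ ≤ C * (1 + ‖ξ‖) ^ (-(N : ℝ)))
    (c : ℂ) (η : Eucl n) :
    oscInt (fun y => c * oscInt (fun ξ => Q y ξ * V ξ) y) (-η) =
      ∫ ξ, c * (V ξ * amplitudeFT Q ξ (η - ξ)) := by
  obtain ⟨D, hD0, hD⟩ := one_le_of_mem_compact hL
  obtain ⟨C₀, hC₀⟩ := hQ.bound []
  obtain ⟨N, hN⟩ := exists_nat_ge (s + (n + 1))
  obtain ⟨C₁, h₁, hC₁⟩ := hV N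
  have hint : Integrable (fun z : Eucl n × Eucl n => osc (-η) z.1 * (osc z.1 z.2 *
      (Q z.1 z.2 * V z.2))) (volume.prod volume) := by
    refine integrable_prod_of_bound (C := |C₀| * C₁ * D) ?_ fun y ξ => ?_
    · refine Continuous.stronglyMeasurable ?_
      refine (continuous_osc.comp (by fun_prop : Continuous fun z : Eucl n × Eucl n =>
        (-η, z.1))).mul (continuous_osc.mul ?_)
      exact hQ.smooth.continuous.mul (hVc.comp continuous_snd)
    · simp only [norm_mul, norm_osc, one_mul]
      by_cases hy : y ∈ L
      · calc ‖Q y ξ‖ * ‖V ξ‖ ≤ (|C₀| * (1 + ‖ξ‖) ^ s) * (C₁ * (1 + ‖ξ‖) ^ (-(N : ℝ))) := by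
              refine mul_le_mul ((hC₀ ξ y hy).trans ?_) (hC₁ ξ) (norm_nonneg _) (by positivity)
              exact mul_le_mul_of_nonneg_right (le_abs_self _) (by positivity)
          _ = |C₀| * C₁ * 1 * (1 + ‖ξ‖) ^ (s - N) := by
              rw [sub_eq_add_neg, rpow_add (by positivity)]; ring
          _ ≤ |C₀| * C₁ * (D * (1 + ‖y‖) ^ (-(n + 1 : ℝ))) * (1 + ‖ξ‖) ^ (-(n + 1 : ℝ)) := by
              refine mul_le_mul (mul_le_mul_of_nonneg_left (hD y hy) (by positivity))
                (rpow_one_add_norm_mono ξ (by linarith)) (by positivity) (by positivity)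
          _ = _ := by ring
      · rw [hQ.support ξ y hy, norm_zero, zero_mul]
        positivity
  have e1 : oscInt (fun y => c * oscInt (fun ξ => Q y ξ * V ξ) y) (-η) =
      c * ∫ y, ∫ ξ, osc (-η) y * (osc y ξ * (Q y ξ * V ξ)) := by
    rw [oscInt_const_mul]
    simp only [oscInt, integral_const_mul]
  rw [e1, integral_integral_swap hint, integral_const_mul]
  congr 2 with ξ
  rw [amplitudeFT, oscInt, ← integral_const_mul]
  congr 1 with y
  rw [neg_sub, sub_eq_neg_add, osc_add_left, osc_comm ξ y]
  ring

theorem AmplitudeBound.stronglyMeasurable_ft_sub (hQ : AmplitudeBound Q L s) :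
    StronglyMeasurable (fun z : Eucl n × Eucl n => amplitudeFT Q z.2 (z.1 - z.2)) := by
  have hm : Measurable (fun z : Eucl n × Eucl n => (z.2, z.1 - z.2)) :=
    (continuous_snd.prodMk (continuous_fst.sub continuous_snd)).measurable
  have h := hQ.stronglyMeasurable_ft
  have h' := h.comp_measurable hm
  exact h'

theorem integrable_comp {p : Eucl n → ℂ} {m : ℝ} (hp : SymbolBound p m)
    (hQ : AmplitudeBound Q L s) (hL : IsCompact L) (x₀ : Eucl n) {V : Eucl n → ℂ}
    (hVc : Continuous V) (hV : ∀ N : ℕ, ∃ C, 0 ≤ C ∧ ∀ ξ, ‖V ξ‖ ≤ C * (1 + ‖ξ‖) ^ (-(N : ℝ)))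
    (c : ℂ) :
    Integrable (fun z : Eucl n × Eucl n => osc x₀ z.1 * (p z.1 * (c * (V z.2 *
      amplitudeFT Q z.2 (z.1 - z.2))))) (volume.prod volume) := by
  have hft := hQ.stronglyMeasurable_ft_sub
  have h₁ : StronglyMeasurable (fun z : Eucl n × Eucl n => osc x₀ z.1) :=
    (continuous_osc.comp (by fun_prop : Continuous fun z : Eucl n × Eucl n =>
      (x₀, z.1))).stronglyMeasurable
  have h₂ : StronglyMeasurable (fun z : Eucl n × Eucl n => p z.1) :=
    (hp.smooth.continuous.comp continuous_fst).stronglyMeasurable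
  have h₃ : StronglyMeasurable (fun z : Eucl n × Eucl n => V z.2) :=
    (hVc.comp continuous_snd).stronglyMeasurable
  obtain ⟨C₀, hC₀⟩ := hp.bound []
  simp only [List.length_nil, Nat.cast_zero, sub_zero, pd] at hC₀
  -- Decay of order `N₁` in `η - ξ` becomes, by Peetre's inequality, decay in `η` sufficient against
  -- the growth of `p`, at the price of `N₁` powers of `1 + ‖ξ‖`. The decay `N₂` of `V` pays for
  -- these and for the growth `s` of `Q`.
  obtain ⟨N₁, hN₁⟩ := exists_nat_ge (m + (n + 1))
  obtain ⟨C₁, hp₁, hC₁⟩ := hQ.ft_bound hL N₁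
  obtain ⟨N₂, hN₂⟩ := exists_nat_ge (s + N₁ + (n + 1))
  obtain ⟨C₂, hp₂, hC₂⟩ := hV N₂
  have hbound : ∀ η ξ, ‖osc x₀ η * (p η * (c * (V ξ * amplitudeFT Q ξ (η - ξ))))‖ ≤
      |C₀| * ‖c‖ * C₂ * C₁ * ((1 + ‖η‖) ^ (-(n + 1 : ℝ)) * (1 + ‖ξ‖) ^ (-(n + 1 : ℝ))) := by
    intro η ξ
    simp only [norm_mul, norm_osc, one_mul]
    have h3 : (1 + ‖η - ξ‖) ^ (-(N₁ : ℝ)) ≤ (1 + ‖η‖) ^ (-(N₁ : ℝ)) * (1 + ‖ξ‖) ^ (N₁ : ℝ) := by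
      have := peetre η (-ξ) (-(N₁ : ℝ))
      rwa [← sub_eq_add_neg, norm_neg, abs_neg, abs_of_nonneg (Nat.cast_nonneg _)] at this
    have ha : ‖p η‖ ≤ |C₀| * (1 + ‖η‖) ^ m :=
      (hC₀ η).trans (mul_le_mul_of_nonneg_right (le_abs_self _) (by positivity))
    have hb := (hC₁ ξ (η - ξ)).trans (mul_le_mul_of_nonneg_left h3 (by positivity))
    have hd := mul_le_mul (hC₂ ξ) hb (norm_nonneg _) (by positivity)
    calc ‖p η‖ * (‖c‖ * (‖V ξ‖ * ‖amplitudeFT Q ξ (η - ξ)‖))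
        ≤ (|C₀| * (1 + ‖η‖) ^ m) * (‖c‖ * ((C₂ * (1 + ‖ξ‖) ^ (-(N₂ : ℝ))) *
          (C₁ * (1 + ‖ξ‖) ^ s * ((1 + ‖η‖) ^ (-(N₁ : ℝ)) * (1 + ‖ξ‖) ^ (N₁ : ℝ))))) :=
          mul_le_mul ha (mul_le_mul_of_nonneg_left hd (norm_nonneg _)) (by positivity)
            (by positivity)
      _ = |C₀| * ‖c‖ * C₂ * C₁ * ((1 + ‖η‖) ^ (m - N₁) * (1 + ‖ξ‖) ^ (-N₂ + s + N₁)) := by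
          rw [sub_eq_add_neg, rpow_add (x := 1 + ‖η‖) (by positivity),
            rpow_add (x := 1 + ‖ξ‖) (by positivity), rpow_add (x := 1 + ‖ξ‖) (by positivity)]
          ring
      _ ≤ _ := by
          refine mul_le_mul_of_nonneg_left ?_ (by positivity)
          exact mul_le_mul (rpow_one_add_norm_mono η (by linarith))
            (rpow_one_add_norm_mono ξ (by linarith)) (by positivity) (by positivity)
  exact integrable_prod_of_bound (h₁.mul (h₂.mul ((h₃.mul hft).const_mul c))) hbound

/-- The composition formula. -/
theorem comp_eq {p : Eucl n → ℂ} {m : ℝ} (hp : SymbolBound p m)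
    (hQ : AmplitudeBound Q L s) (hL : IsCompact L) (x₀ : Eucl n) {V : Eucl n → ℂ}
    (hVc : Continuous V) (hV : ∀ N : ℕ, ∃ C, 0 ≤ C ∧ ∀ ξ, ‖V ξ‖ ≤ C * (1 + ‖ξ‖) ^ (-(N : ℝ))) :
    oscInt (fun η => p η * oscInt (fun y => ((2 * Real.pi : ℝ) : ℂ) ^ (-(n : ℤ)) *
      oscInt (fun ξ => Q y ξ * V ξ) y) (-η)) x₀ =
      oscInt (fun ξ => compSymbol p Q x₀ ξ * V ξ) x₀ := by
  have e1 : ∀ c : ℂ, oscInt (fun η => p η * oscInt (fun y => c *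
      oscInt (fun ξ => Q y ξ * V ξ) y) (-η)) x₀ =
      ∫ η, ∫ ξ, osc x₀ η * (p η * (c * (V ξ * amplitudeFT Q ξ (η - ξ)))) := by
    intro c
    simp only [oscInt_amplitude hQ hL hVc hV, integral_const_mul]
    rfl
  rw [e1, integral_integral_swap (integrable_comp hp hQ hL x₀ hVc hV _), oscInt]
  congr 1 with ξ
  -- The translation `η = ξ + ζ` turns the inner integral into the one defining `compSymbol`.
  rw [← integral_add_left_eq_self _ ξ, compSymbol, oscInt, ← integral_const_mul,
    ← integral_mul_const, ← integral_const_mul]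
  congr 1 with ζ
  rw [add_sub_cancel_left, osc_add_right]
  ring

end Composition

/-! ### Symbols with pointwise estimates, smoothing operators as pseudodifferential operators -/

section LocalSymbols

open MeasureTheory Real Filter Asymptotics

/-- The open sets `Ω` and `Aᶜ` cover `s`; the function is smooth on the first and zero on the
second. -/
theorem contDiffOn_of_zero_off {E F : Type*} [NormedAddCommGroup E] [NormedSpace ℝ E]
    [NormedAddCommGroup F] [NormedSpace ℝ F] {f : E → F} {s Ω A : Set E} (hΩ : IsOpen Ω)
    (hf : ContDiffOn ℝ ∞ f Ω) (hA : IsClosed A) (hAΩ : ∀ x ∈ s, x ∈ A → x ∈ Ω)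
    (h0 : ∀ x ∉ A, f x = 0) : ContDiffOn ℝ ∞ f s := by
  intro x hx
  by_cases hxA : x ∈ A
  · exact (hf.contDiffAt (hΩ.mem_nhds (hAΩ x hx hxA))).contDiffWithinAt
  · have : f =ᶠ[𝓝 x] fun _ => 0 := by
      filter_upwards [hA.isOpen_compl.mem_nhds hxA] with y hy using h0 y hy
    exact (contDiffAt_const.congr_of_eventuallyEq this).contDiffWithinAt

theorem contDiff_of_zero_off {E F : Type*} [NormedAddCommGroup E] [NormedSpace ℝ E]
    [NormedAddCommGroup F] [NormedSpace ℝ F] {f : E → F} {Ω A : Set E} (hΩ : IsOpen Ω)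
    (hf : ContDiffOn ℝ ∞ f Ω) (hA : IsClosed A) (hAΩ : A ⊆ Ω)
    (h0 : ∀ x ∉ A, f x = 0) : ContDiff ℝ ∞ f :=
  contDiffOn_univ.1 (contDiffOn_of_zero_off hΩ hf hA (fun _ _ h => hAΩ h) h0)

theorem far_subset : far n ⊆ {0}ᶜ := by
  rintro ξ hξ rfl
  have : (1 : ℝ) ≤ ‖(0 : Eucl n)‖ := hξ
  rw [norm_zero] at this
  linarith

/-- The pointwise estimates satisfied by symbols. -/
structure IsLocalSymbol (U : Set (Eucl n)) (m : ℂ) (p : Eucl n → Eucl n → ℂ)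
    (σ : ℕ → Eucl n → Eucl n → ℂ) : Prop where
  smooth : ContDiffOn ℝ ∞ (Function.uncurry p) (U ×ˢ Set.univ)
  bound_snd : ∀ x ∈ U, SymbolBound (p x) m.re
  expansion_snd : ∀ x ∈ U, ∀ l : List (Fin n),
    HasExpansion (m.re - l.length) (pd l (p x)) (fun j => pd l (σ j x))
  bound_fst : ∀ K : Set (Eucl n), IsCompact K → K ⊆ U → ∀ l : List (Fin n),
    ∃ C, ∀ x ∈ K, ∀ ξ, ‖pd l (fun x' => p x' ξ) x‖ ≤ C * (1 + ‖ξ‖) ^ m.re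
  expansion_fst : ∀ x ∈ U, ∀ l : List (Fin n),
    HasExpansion m.re (fun ξ => pd l (fun x' => p x' ξ) x) (fun j ξ => pd l (fun x' => σ j x' ξ) x)

theorem bddOn_near {U K : Set (Eucl n)} (hK : IsCompact K) (hKU : K ⊆ U)
    {f : Eucl n → Eucl n → ℂ} (hf : ContinuousOn (Function.uncurry f) (U ×ˢ Set.univ)) :
    ∃ C, ∀ x ∈ K, ∀ ξ, ‖ξ‖ ≤ 1 → ‖f x ξ‖ ≤ C := by
  obtain ⟨C, hC⟩ := (hK.prod (isCompact_closedBall (0 : Eucl n) 1)).exists_bound_of_continuousOn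
    (hf.mono (Set.prod_mono hKU (Set.subset_univ _)))
  exact ⟨C, fun x hx ξ hξ => hC (x, ξ) ⟨hx, by simpa using hξ⟩⟩

/-- For `‖ξ‖ ≥ 1` everything follows from `bound`, with `N = 0` for the growth estimates; the region
`‖ξ‖ ≤ 1` is handled by compactness. Derivatives of a remainder split termwise only away from `ξ =
0`, where the homogeneous components are smooth. -/
theorem HasSymbolExpansion.isLocalSymbol {U : Set (Eucl n)} (hU : IsOpen U) {m : ℂ}
    {p : Eucl n → Eucl n → ℂ} {σ : ℕ → Eucl n → Eucl n → ℂ} (h : HasSymbolExpansion U m p σ) :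
    IsLocalSymbol U m p σ where
  smooth := h.smooth
  bound_snd x hx := by
    refine ⟨contDiffOn_univ.1 (contDiffOn_slice_snd h.smooth hx), fun l => ?_⟩
    obtain ⟨C₁, hC₁⟩ := h.bound 0 {x} isCompact_singleton (by simpa using hx) [] l
    obtain ⟨C₀, hC₀⟩ := bddOn_near (isCompact_singleton (x := x)) (by simpa using hx)
      (contDiffOn_pd_snd (hU.prod isOpen_univ) h.smooth l).continuousOn
    obtain ⟨C, -, hC⟩ := exists_growth_of_near_far (S := {x}) (f := fun x => pd l (p x))
      (s := m.re - l.length) hC₀ (fun t ht ξ hξ => by simpa [pd] using hC₁ t ht ξ hξ)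
    exact ⟨C, hC x rfl⟩
  expansion_snd x hx l N := by
    obtain ⟨C, hC⟩ := h.bound N {x} isCompact_singleton (by simpa using hx) [] l
    refine isBigO_principal.2 ⟨C, fun ξ hξ => ?_⟩
    rw [Real.norm_of_nonneg (by positivity)]
    refine le_trans (le_of_eq ?_) (hC x rfl ξ hξ)
    have ho : IsOpen ({0}ᶜ : Set (Eucl n)) := isOpen_compl_singleton
    have hσ : ∀ j ∈ Finset.range N, ContDiffOn ℝ ∞ (σ j x) {0}ᶜ := fun j _ =>
      contDiffOn_slice_snd (h.homogeneous j).smooth hx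
    have h1 := pd_sub ho ((contDiffOn_slice_snd h.smooth hx).mono (Set.subset_univ _))
      (ContDiffOn.sum hσ) l (far_subset hξ)
    have h2 := pd_sum ho _ hσ l (far_subset hξ)
    simp only [pd] at h1 h2 ⊢
    rw [h1, h2]
  bound_fst K hK hKU l := by
    obtain ⟨C₁, hC₁⟩ := h.bound 0 K hK hKU l []
    obtain ⟨C₀, hC₀⟩ := bddOn_near hK hKU
      (contDiffOn_pd_fst (hU.prod isOpen_univ) h.smooth l).continuousOn
    obtain ⟨C, -, hC⟩ := exists_growth_of_near_far (S := K)
      (f := fun x ξ => pd l (fun x' => p x' ξ) x) (s := m.re) hC₀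
      (fun t ht ξ hξ => by simpa [pd] using hC₁ t ht ξ hξ)
    exact ⟨C, hC⟩
  expansion_fst x hx l N := by
    obtain ⟨C, hC⟩ := h.bound N {x} isCompact_singleton (by simpa using hx) l []
    refine isBigO_principal.2 ⟨C, fun ξ hξ => ?_⟩
    rw [Real.norm_of_nonneg (by positivity)]
    refine le_trans (le_of_eq ?_) ((hC x rfl ξ hξ).trans (le_of_eq (by simp)))
    have hσ : ∀ j ∈ Finset.range N, ContDiffOn ℝ ∞ (fun x' => σ j x' ξ) U := fun j _ =>
      contDiffOn_slice_fst (h.homogeneous j).smooth (far_subset hξ)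
    have h1 := pd_sub hU (contDiffOn_slice_fst h.smooth (Set.mem_univ ξ))
      (ContDiffOn.sum hσ) l hx
    have h2 := pd_sum hU _ hσ l hx
    simp only [pd] at h1 h2 ⊢
    rw [h1, h2]

theorem isBigO_of_rapid {f : Eucl n → ℂ}
    (h : ∀ N : ℕ, ∃ C, ∀ ξ, ‖f ξ‖ ≤ C * (1 + ‖ξ‖) ^ (-(N : ℝ))) (N : ℕ) :
    f =O[𝓟 (far n)] fun ξ => ‖ξ‖ ^ (-(N : ℝ)) := by
  obtain ⟨C, hC⟩ := h N
  exact isBigO_of_growth (abs_nonneg C) fun ξ =>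
    (hC ξ).trans (mul_le_mul_of_nonneg_right (le_abs_self C) (by positivity))

theorem exists_bound_of_rapid {ι : Type*} {S : Set ι} {f : ι → Eucl n → ℂ}
    (h : ∀ N : ℕ, ∃ C, ∀ t ∈ S, ∀ ξ, ‖f t ξ‖ ≤ C * (1 + ‖ξ‖) ^ (-(N : ℝ))) (s : ℝ) :
    ∃ C, ∀ t ∈ S, ∀ ξ, ‖f t ξ‖ ≤ C * (1 + ‖ξ‖) ^ s := by
  obtain ⟨N, hN⟩ := exists_nat_ge (-s)
  obtain ⟨C, hC⟩ := h N
  refine ⟨|C|, fun t ht ξ => (hC t ht ξ).trans ?_⟩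
  exact mul_le_mul (le_abs_self C) (rpow_one_add_norm_mono ξ (by linarith)) (by positivity)
    (abs_nonneg C)

/-- Rapidly decreasing terms change no homogeneous component, so smoothing remainders can be
absorbed into the symbol. -/
theorem IsLocalSymbol.add_rapid {U : Set (Eucl n)} (hU : IsOpen U) {m : ℂ}
    {p r : Eucl n → Eucl n → ℂ} {σ : ℕ → Eucl n → Eucl n → ℂ} (h : IsLocalSymbol U m p σ)
    (hr : RapidDecay U r) (hr' : ∀ x ∈ U, ∀ (l : List (Fin n)) (N : ℕ),
      ∃ C, ∀ ξ, ‖pd l (r x) ξ‖ ≤ C * (1 + ‖ξ‖) ^ (-(N : ℝ))) :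
    IsLocalSymbol U m (fun x ξ => p x ξ + r x ξ) σ := by
  have e2 : ∀ x ∈ U, ∀ l : List (Fin n), pd l (fun ξ => p x ξ + r x ξ) =
      fun ξ => pd l (p x) ξ + pd l (r x) ξ := fun x hx l => by
    ext ξ
    exact pd_add isOpen_univ (contDiffOn_slice_snd h.smooth hx) (contDiffOn_slice_snd hr.smooth hx)
      l (Set.mem_univ ξ)
  have e1 : ∀ x ∈ U, ∀ (l : List (Fin n)) (ξ : Eucl n), pd l (fun x' => p x' ξ + r x' ξ) x =
      pd l (fun x' => p x' ξ) x + pd l (fun x' => r x' ξ) x := fun x hx l ξ =>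
    pd_add hU (contDiffOn_slice_fst h.smooth (Set.mem_univ ξ))
      (contDiffOn_slice_fst hr.smooth (Set.mem_univ ξ)) l hx
  refine ⟨h.smooth.add hr.smooth, fun x hx => ⟨?_, fun l => ?_⟩, fun x hx l => ?_,
    fun K hK hKU l => ?_, fun x hx l => ?_⟩
  · exact (h.bound_snd x hx).smooth.add (contDiffOn_univ.1 (contDiffOn_slice_snd hr.smooth hx))
  · obtain ⟨C₁, h₁⟩ := (h.bound_snd x hx).bound l
    obtain ⟨C₂, h₂⟩ := exists_bound_of_rapid (S := {x}) (f := fun x => pd l (r x))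
      (by simpa using hr' x hx l) (m.re - l.length)
    refine ⟨C₁ + C₂, fun ξ => ?_⟩
    rw [e2 x hx, add_mul]
    exact (norm_add_le _ _).trans (add_le_add (h₁ ξ) (h₂ x rfl ξ))
  · rw [e2 x hx]
    exact (h.expansion_snd x hx l).add_isBigO (isBigO_of_rapid (hr' x hx l))
  · obtain ⟨C₁, h₁⟩ := h.bound_fst K hK hKU l
    obtain ⟨C₂, h₂⟩ := exists_bound_of_rapid (S := K)
      (f := fun x ξ => pd l (fun x' => r x' ξ) x) (hr.bound K hK hKU l) m.re
    refine ⟨C₁ + C₂, fun x hx ξ => ?_⟩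
    rw [e1 x (hKU hx), add_mul]
    exact (norm_add_le _ _).trans (add_le_add (h₁ x hx ξ) (h₂ x hx ξ))
  · simp only [e1 x hx]
    refine (h.expansion_fst x hx l).add_isBigO (isBigO_of_rapid fun N => ?_)
    obtain ⟨C, hC⟩ := hr.bound {x} isCompact_singleton (by simpa using hx) l N
    exact ⟨C, hC x rfl⟩

/-- Fubini: multiplication by a Fourier transform is a convolution. -/
theorem oscInt_oscInt_mul {h V : Eucl n → ℂ} (hh : Integrable h) (hV : Integrable V)
    (x : Eucl n) : oscInt (fun ξ => oscInt h ξ * V ξ) x = ∫ z, h z * oscInt V (x + z) := by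
  have hint : Integrable (fun q : Eucl n × Eucl n => osc x q.1 * (osc q.1 q.2 * (V q.1 * h q.2)))
      (volume.prod volume) := by
    refine ((hV.mul_prod hh).bdd_mul (c := 1) ?_ (Eventually.of_forall fun q => by simp)).bdd_mul
      (c := 1) ?_ (Eventually.of_forall fun q => by simp)
    · exact continuous_osc.aestronglyMeasurable
    · exact (continuous_osc.comp (by fun_prop : Continuous fun q : Eucl n × Eucl n =>
        (x, q.1))).aestronglyMeasurable
  have e1 : oscInt (fun ξ => oscInt h ξ * V ξ) x =
      ∫ ξ, ∫ z, osc x ξ * (osc ξ z * (V ξ * h z)) := by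
    rw [oscInt]
    congr 1 with ξ
    rw [oscInt, ← integral_mul_const, ← integral_const_mul]
    congr 1 with z
    ring
  rw [e1, integral_integral_swap hint]
  congr 1 with z
  rw [oscInt, ← integral_const_mul]
  congr 1 with ξ
  rw [osc_add_left, osc_comm ξ z]
  ring

/-- A smoothing operator, restricted to functions with support in a fixed compact set, is a
pseudodifferential operator with rapidly decreasing symbol. -/
theorem exists_rapid_symbol {U L : Set (Eucl n)} (hU : IsOpen U) (hL : IsCompact L) (hLU : L ⊆ U)
    {k : Eucl n → Eucl n → ℂ} (hk : ContDiffOn ℝ ∞ (Function.uncurry k) (U ×ˢ U)) :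
    ∃ r : Eucl n → Eucl n → ℂ, RapidDecay U r ∧
      (∀ x ∈ U, ∀ (l : List (Fin n)) (N : ℕ),
        ∃ C, ∀ ξ, ‖pd l (r x) ξ‖ ≤ C * (1 + ‖ξ‖) ^ (-(N : ℝ))) ∧
      ∀ v : Eucl n → ℂ, ContDiff ℝ ∞ v → tsupport v ⊆ L → ∀ x ∈ U,
        quantize r v x = ∫ y in U, k x y * v y := by
  obtain ⟨ψ, hψ, hψc, hψU, W, hW, hLW, hψ1⟩ := exists_cutoff hL hU hLU
  -- The kernel in the variable `z = y - x`, cut off by a function that is one near `L` and hence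
  -- not seen by functions supported in `L`. Its transform in `z` is the required symbol.
  set h : Eucl n → Eucl n → ℂ := fun x z => k x (x + z) * ψ (x + z) with hh
  have hsm : ContDiffOn ℝ ∞ (Function.uncurry h) (U ×ˢ Set.univ) := by
    have hΩ : IsOpen ((fun q : Eucl n × Eucl n => (q.1, q.1 + q.2)) ⁻¹' (U ×ˢ U)) :=
      (hU.prod hU).preimage (by fun_prop)
    have hA : IsClosed ((fun q : Eucl n × Eucl n => q.1 + q.2) ⁻¹' tsupport ψ) :=
      (isClosed_tsupport ψ).preimage (by fun_prop)
    refine contDiffOn_of_zero_off hΩ ?_ hA ?_ ?_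
    · refine ContDiffOn.mul ?_ ?_
      · exact hk.comp (by fun_prop : ContDiff ℝ ∞ fun q : Eucl n × Eucl n =>
          (q.1, q.1 + q.2)).contDiffOn fun _ hq => hq
      · exact (hψ.comp (contDiff_fst.add contDiff_snd)).contDiffOn
    · exact fun q hq hq' => ⟨hq.1, hψU hq'⟩
    · intro q hq
      simp only [Function.uncurry, hh]
      rw [image_eq_zero_of_notMem_tsupport hq, mul_zero]
  have hsupp : ∀ K : Set (Eucl n), IsCompact K → K ⊆ U → ∃ K' : Set (Eucl n), IsCompact K' ∧
      ∀ x ∈ K, ∀ z ∉ K', h x z = 0 := by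
    intro K hK _
    refine ⟨(fun q : Eucl n × Eucl n => q.1 - q.2) '' (tsupport ψ ×ˢ K),
      (hψc.isCompact.prod hK).image (by fun_prop), fun x hx z hz => ?_⟩
    simp only [hh]
    rw [image_eq_zero_of_notMem_tsupport (f := ψ), mul_zero]
    exact fun h' => hz ⟨(x + z, x), ⟨h', hx⟩, by simp⟩
  have hslice : ∀ x ∈ U, ContDiff ℝ ∞ (h x) ∧ HasCompactSupport (h x) := by
    intro x hx
    refine ⟨contDiffOn_univ.1 (contDiffOn_slice_snd hsm hx), ?_⟩
    obtain ⟨K', hK', h0⟩ := hsupp {x} isCompact_singleton (by simpa using hx)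
    exact HasCompactSupport.intro hK' (h0 x rfl)
  refine ⟨fun x ξ => oscInt (h x) ξ, RapidDecay.oscInt_of_support hU hsm hsupp,
    fun x hx l N => pd_oscInt_bound (hslice x hx).1 (hslice x hx).2 l N, fun v hv hvL x hx => ?_⟩
  have hvc : HasCompactSupport v := hL.of_isClosed_subset (isClosed_tsupport _) hvL
  have hVi : Integrable fun ξ => oscInt v (-ξ) := (integrable_oscInt hv hvc).comp_neg
  rw [quantize_eq, oscInt_oscInt_mul (contDiff_integrable (hslice x hx).1 (hslice x hx).2) hVi,
    ← integral_const_mul]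
  have e1 : ∀ z, ((2 * Real.pi : ℝ) : ℂ) ^ (-(n : ℤ)) *
      (h x z * oscInt (fun ξ => oscInt v (-ξ)) (x + z)) = k x (x + z) * v (x + z) := by
    intro z
    rw [mul_left_comm, fourier_inversion hv hvc, hh]
    by_cases hz : x + z ∈ tsupport v
    · simp only
      rw [hψ1 _ (hLW (hvL hz)), mul_one]
    · rw [image_eq_zero_of_notMem_tsupport hz, mul_zero, mul_zero]
  simp only [e1]
  rw [integral_add_left_eq_self (fun y => k x y * v y) x]
  refine (setIntegral_eq_integral_of_forall_compl_eq_zero fun y hy => ?_).symm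
  rw [image_eq_zero_of_notMem_tsupport fun h' => hy (hLU (hvL h')), mul_zero]

end LocalSymbols

/-! ### Test functions and local coordinates -/

section LocalCoordinates

open MeasureTheory Filter

variable {M : SmoothMfd.{u} n} {φ ψ : OpenPartialHomeomorph M (Eucl n)}

theorem IsLocalCoord.contMDiffOn (hφ : IsLocalCoord M φ) : ContMDiffOn (𝓡 n) (𝓡 n) ∞ φ φ.source :=
  contMDiffOn_of_mem_maximalAtlas hφ

theorem IsLocalCoord.contMDiffOn_symm (hφ : IsLocalCoord M φ) :
    ContMDiffOn (𝓡 n) (𝓡 n) ∞ φ.symm φ.target :=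
  contMDiffOn_symm_of_mem_maximalAtlas hφ

theorem IsLocalCoord.restr (hφ : IsLocalCoord M φ) {s : Set M} (hs : IsOpen s) :
    IsLocalCoord M (φ.restr s) :=
  restr_mem_maximalAtlas _ hφ hs

theorem isLocalCoord_chartAt (x : M) : IsLocalCoord M (chartAt (Eucl n) x) :=
  IsManifold.chart_mem_maximalAtlas x

theorem IsLocalCoord.contDiffOn_transition (hφ : IsLocalCoord M φ) (hψ : IsLocalCoord M ψ) :
    ContDiffOn ℝ ∞ (ψ ∘ φ.symm) (φ.target ∩ φ.symm ⁻¹' ψ.source) := by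
  refine contMDiffOn_iff_contDiffOn.1 ?_
  exact hψ.contMDiffOn.comp (hφ.contMDiffOn_symm.mono Set.inter_subset_left) fun x hx => hx.2

theorem contMDiff_of_zero_off {f : M → ℂ} {O A : Set M} (hO : IsOpen O)
    (hf : ContMDiffOn (𝓡 n) 𝓘(ℝ, ℂ) ∞ f O) (hA : IsClosed A) (hAO : A ⊆ O)
    (h0 : ∀ x ∉ A, f x = 0) : ContMDiff (𝓡 n) 𝓘(ℝ, ℂ) ∞ f := by
  intro x
  by_cases hx : x ∈ A
  · exact hf.contMDiffAt (hO.mem_nhds (hAO hx))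
  · have : f =ᶠ[𝓝 x] fun _ => 0 := by
      filter_upwards [hA.isOpen_compl.mem_nhds hx] with y hy using h0 y hy
    exact contMDiffAt_const.congr_of_eventuallyEq this

/-- The representative in local coordinates of a function with support in the domain. -/
def coordRep (φ : OpenPartialHomeomorph M (Eucl n)) (f : M → ℂ) : Eucl n → ℂ :=
  φ.target.indicator (f ∘ φ.symm)

theorem coordRep_apply {f : M → ℂ} {x : Eucl n} (hx : x ∈ φ.target) :
    coordRep φ f x = f (φ.symm x) := Set.indicator_of_mem hx _

theorem IsLocalCoord.contDiffOn_coordRep (hφ : IsLocalCoord M φ) {f : M → ℂ}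
    (hf : ContMDiff (𝓡 n) 𝓘(ℝ, ℂ) ∞ f) : ContDiffOn ℝ ∞ (coordRep φ f) φ.target := by
  refine ContDiffOn.congr (f := f ∘ φ.symm) ?_ fun x hx => coordRep_apply hx
  exact contMDiffOn_iff_contDiffOn.1 (hf.comp_contMDiffOn hφ.contMDiffOn_symm)

theorem coordRep_eq_zero {f : M → ℂ} {x : Eucl n} (hx : x ∉ φ '' tsupport f) :
    coordRep φ f x = 0 := by
  by_cases h : x ∈ φ.target
  · rw [coordRep_apply h]
    exact image_eq_zero_of_notMem_tsupport fun h' => hx ⟨_, h', φ.right_inv h⟩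
  · exact Set.indicator_of_notMem h _

theorem isCompact_image_tsupport {f : M → ℂ} (hc : HasCompactSupport f)
    (hs : tsupport f ⊆ φ.source) : IsCompact (φ '' tsupport f) :=
  hc.isCompact.image_of_continuousOn (φ.continuousOn.mono hs)

theorem image_tsupport_subset_target {f : M → ℂ} (hs : tsupport f ⊆ φ.source) :
    φ '' tsupport f ⊆ φ.target := by
  rintro _ ⟨x, hx, rfl⟩
  exact φ.map_source (hs hx)

theorem tsupport_coordRep_subset {f : M → ℂ} (hc : HasCompactSupport f)
    (hs : tsupport f ⊆ φ.source) : tsupport (coordRep φ f) ⊆ φ '' tsupport f :=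
  closure_minimal (fun _ hx => by_contra fun h => hx (coordRep_eq_zero h))
    (isCompact_image_tsupport hc hs).isClosed

theorem hasCompactSupport_coordRep {f : M → ℂ} (hc : HasCompactSupport f)
    (hs : tsupport f ⊆ φ.source) : HasCompactSupport (coordRep φ f) :=
  HasCompactSupport.intro (isCompact_image_tsupport hc hs) fun _ => coordRep_eq_zero

theorem IsLocalCoord.contDiff_coordRep (hφ : IsLocalCoord M φ) {f : M → ℂ}
    (hf : ContMDiff (𝓡 n) 𝓘(ℝ, ℂ) ∞ f) (hc : HasCompactSupport f)
    (hs : tsupport f ⊆ φ.source) : ContDiff ℝ ∞ (coordRep φ f) :=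
  contDiff_of_zero_off φ.open_target (hφ.contDiffOn_coordRep hf)
    (isCompact_image_tsupport hc hs).isClosed (image_tsupport_subset_target hs)
    fun _ => coordRep_eq_zero

/-- The function on `M` that is given by `v` in the local coordinates `φ`. -/
def coordLift (φ : OpenPartialHomeomorph M (Eucl n)) (v : Eucl n → ℂ) : M → ℂ :=
  φ.source.indicator (v ∘ φ)

theorem coordLift_apply {v : Eucl n → ℂ} {x : M} (hx : x ∈ φ.source) :
    coordLift φ v x = v (φ x) := Set.indicator_of_mem hx _

theorem coordLift_symm {v : Eucl n → ℂ} {x : Eucl n} (hx : x ∈ φ.target) :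
    coordLift φ v (φ.symm x) = v x := by
  rw [coordLift_apply (φ.map_target hx), φ.right_inv hx]

theorem coordLift_eq_zero {v : Eucl n → ℂ} {x : M} (hx : x ∉ φ.symm '' tsupport v) :
    coordLift φ v x = 0 := by
  by_cases h : x ∈ φ.source
  · rw [coordLift_apply h]
    exact image_eq_zero_of_notMem_tsupport fun h' => hx ⟨_, h', φ.left_inv h⟩
  · exact Set.indicator_of_notMem h _

theorem isCompact_symm_image {L : Set (Eucl n)} (hL : IsCompact L) (hs : L ⊆ φ.target) :
    IsCompact (φ.symm '' L) :=
  hL.image_of_continuousOn (φ.continuousOn_symm.mono hs)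

theorem symm_image_subset_source {L : Set (Eucl n)} (hs : L ⊆ φ.target) :
    φ.symm '' L ⊆ φ.source := by
  rintro _ ⟨x, hx, rfl⟩
  exact φ.map_target (hs hx)

theorem tsupport_coordLift_subset {v : Eucl n → ℂ} (hc : HasCompactSupport v)
    (hs : tsupport v ⊆ φ.target) : tsupport (coordLift φ v) ⊆ φ.symm '' tsupport v :=
  closure_minimal (fun _ hx => by_contra fun h => hx (coordLift_eq_zero h))
    (isCompact_symm_image hc hs).isClosed

theorem IsLocalCoord.coordLift_mem (hφ : IsLocalCoord M φ) {v : Eucl n → ℂ} (hv : ContDiff ℝ ∞ v)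
    (hc : HasCompactSupport v) (hs : tsupport v ⊆ φ.target) : coordLift φ v ∈ TestFn M := by
  refine ⟨?_, HasCompactSupport.intro (isCompact_symm_image hc hs) fun _ => coordLift_eq_zero⟩
  refine contMDiff_of_zero_off φ.open_source ?_ (isCompact_symm_image hc hs).isClosed
    (symm_image_subset_source hs) fun _ => coordLift_eq_zero
  exact (hv.contMDiff.comp_contMDiffOn hφ.contMDiffOn).congr fun x hx => coordLift_apply hx

/-- The test function on `M` that is given by `v` in the local coordinates `φ`. -/
def IsLocalCoord.liftTest (hφ : IsLocalCoord M φ) {v : Eucl n → ℂ} (hv : ContDiff ℝ ∞ v)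
    (hc : HasCompactSupport v) (hs : tsupport v ⊆ φ.target) : TestFn M :=
  ⟨coordLift φ v, hφ.coordLift_mem hv hc hs⟩

theorem coordRep_coordLift {v : Eucl n → ℂ} (hs : tsupport v ⊆ φ.target) :
    coordRep φ (coordLift φ v) = v := by
  ext x
  by_cases h : x ∈ φ.target
  · rw [coordRep_apply h, coordLift_symm h]
  · rw [image_eq_zero_of_notMem_tsupport fun h' => h (hs h')]
    exact Set.indicator_of_notMem h _

theorem contMDiff_mul {f g : M → ℂ} (hf : ContMDiff (𝓡 n) 𝓘(ℝ, ℂ) ∞ f)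
    (hg : ContMDiff (𝓡 n) 𝓘(ℝ, ℂ) ∞ g) : ContMDiff (𝓡 n) 𝓘(ℝ, ℂ) ∞ fun x => f x * g x :=
  ((contDiff_fst.mul contDiff_snd : ContDiff ℝ ∞ fun z : ℂ × ℂ => z.1 * z.2).contMDiff).comp
    (hf.prodMk_space hg)

theorem mul_mem_testFn {g : M → ℂ} (hg : ContMDiff (𝓡 n) 𝓘(ℝ, ℂ) ∞ g) (u : TestFn M) :
    (fun x => g x * (u : M → ℂ) x) ∈ TestFn M :=
  ⟨contMDiff_mul hg u.2.1, u.2.2.mul_left⟩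

/-- The product of a smooth function and a test function. -/
def mulTest {g : M → ℂ} (hg : ContMDiff (𝓡 n) 𝓘(ℝ, ℂ) ∞ g) (u : TestFn M) : TestFn M :=
  ⟨fun x => g x * (u : M → ℂ) x, mul_mem_testFn hg u⟩

theorem setIntegral_coordRep (k : Eucl n → ℂ) (f : M → ℂ) :
    ∫ y in φ.target, k y * f (φ.symm y) = ∫ y, k y * coordRep φ f y := by
  rw [← integral_indicator φ.open_target.measurableSet]
  congr 1 with y
  by_cases h : y ∈ φ.target
  · rw [Set.indicator_of_mem h, coordRep_apply h]
  · rw [Set.indicator_of_notMem h, coordRep, Set.indicator_of_notMem h, mul_zero]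

/-- A finite smooth partition of unity on a compact set. -/
theorem exists_finite_partition {s : Set M} (hs : IsCompact s) {U : M → Set M}
    (hU : ∀ x ∈ s, IsOpen (U x) ∧ x ∈ U x) :
    ∃ (t : Finset M) (ρ : M → TestFn M), (∀ i ∈ t, i ∈ s ∧ tsupport (ρ i : M → ℂ) ⊆ U i) ∧
      ∀ y ∈ s, ∑ i ∈ t, (ρ i : M → ℂ) y = 1 := by
  classical
  have : LocallyCompactSpace M := Manifold.locallyCompact_of_finiteDimensional (𝓡 n)
  -- Subordination to interiors of compact neighbourhoods makes the functions of the partition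
  -- compactly supported.
  have hD : ∀ x ∈ s, ∃ D : Set M, IsCompact D ∧ x ∈ interior D ∧ D ⊆ U x := fun x hx =>
    exists_compact_subset (hU x hx).1 (hU x hx).2
  choose! D hDc hxD hDU using hD
  obtain ⟨t, hts, hst⟩ := hs.elim_nhds_subcover (fun x => interior (D x)) fun x hx =>
    isOpen_interior.mem_nhds (hxD x hx)
  obtain ⟨f, hf⟩ := SmoothPartitionOfUnity.exists_isSubordinate (𝓡 n) hs.isClosed
    (fun i : t => interior (D i)) (fun i => isOpen_interior) (by
      intro x hx
      obtain ⟨i, hi, hxi⟩ := Set.mem_iUnion₂.1 (hst hx)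
      exact Set.mem_iUnion.2 ⟨⟨i, hi⟩, hxi⟩)
  have hsm : ∀ i : t, (fun x => ((f i x : ℝ) : ℂ)) ∈ TestFn M ∧
      tsupport (fun x => ((f i x : ℝ) : ℂ)) ⊆ U i := by
    intro i
    have h1 : tsupport (fun x => ((f i x : ℝ) : ℂ)) ⊆ tsupport (f i) :=
      closure_mono fun x hx h => hx (by simp [h])
    have h2 : tsupport (f i) ⊆ D i := (hf i).trans interior_subset
    refine ⟨⟨?_, (hDc i (hts i i.2)).of_isClosed_subset (isClosed_tsupport _) (h1.trans h2)⟩,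
      h1.trans (h2.trans (hDU i (hts i i.2)))⟩
    exact (Complex.ofRealCLM.contDiff (n := ∞)).contMDiff.comp (f i).contMDiff
  refine ⟨t, fun i => if h : i ∈ t then ⟨_, (hsm ⟨i, h⟩).1⟩ else 0, fun i hi => ⟨hts i hi, ?_⟩,
    fun y hy => ?_⟩
  · simpa only [dif_pos hi] using (hsm ⟨i, hi⟩).2
  · have h1 := f.sum_eq_one hy
    rw [finsum_eq_sum_of_fintype] at h1
    rw [← Finset.sum_coe_sort t, ← Complex.ofReal_one, ← h1, Complex.ofReal_sum]
    refine Finset.sum_congr rfl fun i _ => ?_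
    beta_reduce
    rw [dif_pos i.2]

end LocalCoordinates

/-! ### Kernels -/

section Kernels

open MeasureTheory Filter

variable {M : SmoothMfd.{u} n} {φ ψ : OpenPartialHomeomorph M (Eucl n)}

theorem contDiff_mul_of_tsupport {V : Set (Eucl n)} (hV : IsOpen V) {K v : Eucl n → ℂ}
    (hK : ContDiffOn ℝ ∞ K V) (hv : ContDiff ℝ ∞ v) (hvV : tsupport v ⊆ V) :
    ContDiff ℝ ∞ fun y => K y * v y :=
  contDiff_of_zero_off hV (hK.mul hv.contDiffOn) (isClosed_tsupport v) hvV fun y hy => by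
    rw [image_eq_zero_of_notMem_tsupport hy, mul_zero]

theorem integrable_mul_of_tsupport {V : Set (Eucl n)} (hV : IsOpen V) {K v : Eucl n → ℂ}
    (hK : ContDiffOn ℝ ∞ K V) (hv : ContDiff ℝ ∞ v) (hc : HasCompactSupport v)
    (hvV : tsupport v ⊆ V) : Integrable fun y => K y * v y :=
  contDiff_integrable (contDiff_mul_of_tsupport hV hK hv hvV) hc.mul_left

/-- The composed kernel is an integral over the compact support of `κ`, hence smooth in `z`; Fubini
identifies its action. It is written as `oscInt` at frequency `0`, the plain integral, so that the
smoothness result for oscillatory integrals applies. -/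
theorem exists_composed_kernel {Ω V : Set (Eucl n)} (hΩ : IsOpen Ω) (hV : IsOpen V)
    {κ : Eucl n → ℂ} (hκ : ContDiff ℝ ∞ κ) (hκc : HasCompactSupport κ) (hκΩ : tsupport κ ⊆ Ω)
    {k : Eucl n → Eucl n → ℂ} (hk : ContDiffOn ℝ ∞ (Function.uncurry k) (Ω ×ˢ V)) :
    ∃ K : Eucl n → ℂ, ContDiffOn ℝ ∞ K V ∧ ∀ v : Eucl n → ℂ, ContDiff ℝ ∞ v →
      HasCompactSupport v → tsupport v ⊆ V →
        ∫ y, κ y * ∫ z, k y z * v z = ∫ z, K z * v z := by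
  have hr : ContDiffOn ℝ ∞ (Function.uncurry fun z y => k y z * κ y) (V ×ˢ Set.univ) := by
    refine contDiffOn_of_zero_off (Ω := V ×ˢ Ω) (A := Prod.snd ⁻¹' tsupport κ) (hV.prod hΩ) ?_
      ((isClosed_tsupport κ).preimage continuous_snd) (fun q hq hq' => ⟨hq.1, hκΩ hq'⟩)
      fun q hq => ?_
    · refine ContDiffOn.mul ?_ (hκ.comp contDiff_snd).contDiffOn
      exact hk.comp (contDiff_snd.prodMk contDiff_fst).contDiffOn fun q hq => ⟨hq.2, hq.1⟩
    · change _ * κ q.2 = 0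
      rw [image_eq_zero_of_notMem_tsupport hq, mul_zero]
  have hR := RapidDecay.of_support hV hr fun K _ _ => ⟨tsupport κ, hκc, fun z _ y hy => by
    rw [image_eq_zero_of_notMem_tsupport hy, mul_zero]⟩
  refine ⟨fun z => oscInt (fun y => k y z * κ y) 0, ?_, fun v hv hc hvV => ?_⟩
  · exact contDiffOn_slice_fst (hR.contDiffOn_oscInt hV) (Set.mem_univ 0)
  · have hF : ContDiff ℝ ∞ fun q : Eucl n × Eucl n => κ q.1 * (k q.1 q.2 * v q.2) := by
      refine contDiff_of_zero_off (hΩ.prod hV) (A := tsupport κ ×ˢ tsupport v) ?_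
        ((isClosed_tsupport κ).prod (isClosed_tsupport v)) (Set.prod_mono hκΩ hvV) ?_
      · exact (hκ.comp contDiff_fst).contDiffOn.mul (hk.mul (hv.comp contDiff_snd).contDiffOn)
      · intro q hq
        rcases not_and_or.1 hq with h | h
        · rw [image_eq_zero_of_notMem_tsupport h, zero_mul]
        · rw [image_eq_zero_of_notMem_tsupport h, mul_zero, mul_zero]
    have hFc : HasCompactSupport fun q : Eucl n × Eucl n => κ q.1 * (k q.1 q.2 * v q.2) := by
      refine HasCompactSupport.intro (hκc.isCompact.prod hc.isCompact) fun q hq => ?_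
      rcases not_and_or.1 hq with h | h
      · rw [image_eq_zero_of_notMem_tsupport h, zero_mul]
      · rw [image_eq_zero_of_notMem_tsupport h, mul_zero, mul_zero]
    have h1 := integral_integral_swap_of_hasCompactSupport (μ := volume) (ν := volume)
      (f := fun y z => κ y * (k y z * v z)) hF.continuous hFc
    simp only [integral_const_mul] at h1
    rw [h1]
    congr 1 with z
    change _ = (∫ y, osc 0 y * (k y z * κ y)) * v z
    rw [← integral_mul_const]
    congr 1 with y
    simp [osc]
    ring

theorem HasSmoothKernelOn.exists_kernel {T : Op M} (h : HasSmoothKernelOn T φ ψ) :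
    ∃ k : Eucl n → Eucl n → ℂ, ContDiffOn ℝ ∞ (Function.uncurry k) (φ.target ×ˢ ψ.target) ∧
      ∀ u : TestFn M, tsupport (u : M → ℂ) ⊆ ψ.source → ∀ x ∈ φ.target,
        (T u : M → ℂ) (φ.symm x) = ∫ y, k x y * coordRep ψ u y := by
  obtain ⟨k, hk, h⟩ := h
  exact ⟨k, hk, fun u hu x hx => by rw [h u hu x hx, setIntegral_coordRep]⟩

theorem hasSmoothKernelOn_of_kernel {T : Op M} {k : Eucl n → Eucl n → ℂ}
    (hk : ContDiffOn ℝ ∞ (Function.uncurry k) (φ.target ×ˢ ψ.target))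
    (h : ∀ u : TestFn M, tsupport (u : M → ℂ) ⊆ ψ.source → ∀ x ∈ φ.target,
      (T u : M → ℂ) (φ.symm x) = ∫ y, k x y * coordRep ψ u y) : HasSmoothKernelOn T φ ψ :=
  ⟨k, hk, fun u hu x hx => by rw [h u hu x hx, setIntegral_coordRep]⟩

theorem IsLocalCoord.integrable_kernel (hψ : IsLocalCoord M ψ) {k : Eucl n → Eucl n → ℂ}
    {A : Set (Eucl n)} (hk : ContDiffOn ℝ ∞ (Function.uncurry k) (A ×ˢ ψ.target))
    (u : TestFn M) (hu : tsupport (u : M → ℂ) ⊆ ψ.source) {x : Eucl n} (hx : x ∈ A) :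
    Integrable fun y => k x y * coordRep ψ u y :=
  integrable_mul_of_tsupport ψ.open_target (contDiffOn_slice_snd hk hx)
    (hψ.contDiff_coordRep u.2.1 u.2.2 hu) (hasCompactSupport_coordRep u.2.2 hu)
    ((tsupport_coordRep_subset u.2.2 hu).trans (image_tsupport_subset_target hu))

theorem HasSmoothKernelOn.sub {T S : Op M} (hψ : IsLocalCoord M ψ)
    (hT : HasSmoothKernelOn T φ ψ) (hS : HasSmoothKernelOn S φ ψ) :
    HasSmoothKernelOn (T - S) φ ψ := by
  obtain ⟨k, hk, hT⟩ := hT.exists_kernel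
  obtain ⟨l, hl, hS⟩ := hS.exists_kernel
  refine hasSmoothKernelOn_of_kernel (k := fun x y => k x y - l x y) (hk.sub hl)
    fun u hu x hx => ?_
  simp only [sub_mul]
  rw [integral_sub (hψ.integrable_kernel hk u hu hx) (hψ.integrable_kernel hl u hu hx),
    ← hT u hu x hx, ← hS u hu x hx]
  rfl

theorem HasSmoothKernelOn.smul {T : Op M} (c : ℂ) (hT : HasSmoothKernelOn T φ ψ) :
    HasSmoothKernelOn (c • T) φ ψ := by
  obtain ⟨k, hk, hT⟩ := hT.exists_kernel
  refine hasSmoothKernelOn_of_kernel (k := fun x y => c * k x y) (contDiffOn_const.mul hk)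
    fun u hu x hx => ?_
  simp only [mul_assoc]
  rw [integral_const_mul, ← hT u hu x hx]
  rfl

theorem HasKernelSmoothOffDiagonal.sub {T S : Op M} (hT : HasKernelSmoothOffDiagonal T)
    (hS : HasKernelSmoothOffDiagonal S) : HasKernelSmoothOffDiagonal (T - S) :=
  fun φ ψ hφ hψ h => (hT φ ψ hφ hψ h).sub hψ (hS φ ψ hφ hψ h)

theorem HasKernelSmoothOffDiagonal.smul {T : Op M} (c : ℂ) (hT : HasKernelSmoothOffDiagonal T) :
    HasKernelSmoothOffDiagonal (c • T) :=
  fun φ ψ hφ hψ h => (hT φ ψ hφ hψ h).smul c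

theorem HasKernelSmoothOffDiagonal.congr_smoothing {T S : Op M}
    (hT : HasKernelSmoothOffDiagonal T) (h : IsSmoothing (T - S)) :
    HasKernelSmoothOffDiagonal S := by
  have := hT.sub (S := T - S) fun φ ψ hφ hψ _ => h φ ψ hφ hψ
  have e : T - (T - S) = S := sub_sub_cancel T S
  rwa [e] at this

/-- The symbol `p` is kept; the kernel of `T - S` goes into the remainder. -/
theorem HasSymbolInCoord.congr_smoothing {T S : Op M} {m : ℂ} {σ : ℕ → Eucl n → Eucl n → ℂ}
    (hφ : IsLocalCoord M φ) (hT : HasSymbolInCoord m T φ σ) (h : IsSmoothing (T - S)) :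
    HasSymbolInCoord m S φ σ := by
  obtain ⟨p, k, hp, hk, hT⟩ := hT
  obtain ⟨l, hl, h⟩ := (h φ φ hφ hφ).exists_kernel
  refine ⟨p, fun x y => k x y - l x y, hp, hk.sub hl, fun u hu x hx => ?_⟩
  have h1 := hT u hu x hx
  have h2 := h u hu x hx
  have h3 : ((T - S) u : M → ℂ) (φ.symm x) = (T u : M → ℂ) (φ.symm x) - (S u : M → ℂ) (φ.symm x) :=
    rfl
  rw [setIntegral_coordRep] at h1 ⊢
  simp only [sub_mul]
  rw [integral_sub (hφ.integrable_kernel hk u hu hx) (hφ.integrable_kernel hl u hu hx), ← h2, h3,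
    h1]
  ring

/-- The restriction of local coordinates to the preimage of `V`. -/
def coordRestr (φ : OpenPartialHomeomorph M (Eucl n)) (V : Set (Eucl n)) :
    OpenPartialHomeomorph M (Eucl n) := φ.restr (φ.source ∩ φ ⁻¹' V)

theorem isOpen_coord_preimage {V : Set (Eucl n)} (hV : IsOpen V) :
    IsOpen (φ.source ∩ φ ⁻¹' V) := φ.isOpen_inter_preimage hV

theorem coordRestr_source {V : Set (Eucl n)} (hV : IsOpen V) :
    (coordRestr φ V).source = φ.source ∩ φ ⁻¹' V := by
  rw [coordRestr, φ.restr_source' _ (isOpen_coord_preimage hV), ← Set.inter_assoc, Set.inter_self]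

theorem coordRestr_target {V : Set (Eucl n)} (hV : IsOpen V) (hVφ : V ⊆ φ.target) :
    (coordRestr φ V).target = V := by
  rw [coordRestr, φ.restr_target, (isOpen_coord_preimage hV).interior_eq]
  ext x
  constructor
  · rintro ⟨h1, -, h2⟩
    simpa [φ.right_inv h1] using h2
  · intro h
    exact ⟨hVφ h, φ.map_target (hVφ h), by simpa [φ.right_inv (hVφ h)] using h⟩

theorem coordRestr_symm_apply (V : Set (Eucl n)) (x : Eucl n) :
    (coordRestr φ V).symm x = φ.symm x := rfl

theorem IsLocalCoord.coordRestr (hφ : IsLocalCoord M φ) {V : Set (Eucl n)} (hV : IsOpen V) :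
    IsLocalCoord M (coordRestr φ V) := hφ.restr (isOpen_coord_preimage hV)

theorem coordRep_coordRestr {V : Set (Eucl n)} (hV : IsOpen V) (hVφ : V ⊆ φ.target) {f : M → ℂ}
    (hf : tsupport f ⊆ φ.source ∩ φ ⁻¹' V) : coordRep (InvPsiDO.coordRestr φ V) f = coordRep φ f := by
  ext x
  by_cases h : x ∈ V
  · rw [coordRep_apply (by rwa [coordRestr_target hV hVφ]), coordRep_apply (hVφ h)]
    rfl
  · have h1 : coordRep (InvPsiDO.coordRestr φ V) f x = 0 :=
      Set.indicator_of_notMem (by rwa [coordRestr_target hV hVφ]) _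
    rw [h1]
    symm
    refine coordRep_eq_zero ?_
    rintro ⟨y, hy, rfl⟩
    exact h (hf hy).2

end Kernels

/-! ### Products away from the diagonal -/

section OffDiagonalProducts

open MeasureTheory Filter

variable {M : SmoothMfd.{u} n} {φ ψ : OpenPartialHomeomorph M (Eucl n)}

theorem tsupport_mulTest_subset {g : M → ℂ} (hg : ContMDiff (𝓡 n) 𝓘(ℝ, ℂ) ∞ g) (u : TestFn M) :
    tsupport (mulTest hg u : M → ℂ) ⊆ tsupport g :=
  closure_mono fun x hx h => hx (show g x * (u : M → ℂ) x = 0 by rw [h, zero_mul])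

/-- The factor `ρ` confines the intermediate point to one chart `θ`, where the two smooth kernels
can be composed. The output point `x₀` stays fixed, which is all that the symbol comparison needs.
-/
theorem exists_composed_kernel_coord {T S : Op M} (hS : IsProperlySupported S)
    {φ' θ : OpenPartialHomeomorph M (Eucl n)} (hφ' : IsLocalCoord M φ') (hθ : IsLocalCoord M θ)
    (hTk : HasSmoothKernelOn T φ' θ) (hSk : HasSmoothKernelOn S θ φ') (ρ : TestFn M)
    (hρ : tsupport (ρ : M → ℂ) ⊆ θ.source) {x₀ : Eucl n} (hx₀ : x₀ ∈ φ'.target) :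
    ∃ K : Eucl n → ℂ, ContDiffOn ℝ ∞ K φ'.target ∧ ∀ u : TestFn M,
      tsupport (u : M → ℂ) ⊆ φ'.source →
        (T (mulTest ρ.2.1 (hS.toTest u)) : M → ℂ) (φ'.symm x₀) = ∫ z, K z * coordRep φ' u z := by
  obtain ⟨k, hk, hT⟩ := hTk.exists_kernel
  obtain ⟨l, hl, hS'⟩ := hSk.exists_kernel
  have hρs : tsupport (coordRep θ ρ) ⊆ θ.target :=
    (tsupport_coordRep_subset ρ.2.2 hρ).trans (image_tsupport_subset_target hρ)
  have hρsm := hθ.contDiff_coordRep ρ.2.1 ρ.2.2 hρ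
  have hρc := hasCompactSupport_coordRep (φ := θ) ρ.2.2 hρ
  have hκ := contDiff_mul_of_tsupport θ.open_target (contDiffOn_slice_snd hk hx₀) hρsm hρs
  obtain ⟨K, hK, hKv⟩ := exists_composed_kernel θ.open_target φ'.open_target hκ hρc.mul_left
    ((tsupport_mul_subset_right).trans hρs) hl
  refine ⟨K, hK, fun u hu => ?_⟩
  rw [hT _ ((tsupport_mulTest_subset _ _).trans hρ) _ hx₀, ← hKv _
    (hφ'.contDiff_coordRep u.2.1 u.2.2 hu) (hasCompactSupport_coordRep u.2.2 hu)
    ((tsupport_coordRep_subset u.2.2 hu).trans (image_tsupport_subset_target hu))]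
  congr 1 with y
  rw [mul_assoc]
  congr 1
  by_cases hy : y ∈ θ.target
  · rw [coordRep_apply hy, coordRep_apply hy, ← hS' u hu y hy]
    rfl
  · rw [image_eq_zero_of_notMem_tsupport fun h => hy (hρs h), zero_mul]
    exact Set.indicator_of_notMem hy _

/-- As `g` vanishes near `x₀`, the intermediate point keeps away from a small ball about `x₀`. With
inputs supported in that ball and the output taken at `x₀`, both kernels are used only off the
diagonal. Proper support of `S` confines the intermediate point to a compact set, so a finite
partition of unity reduces to `exists_composed_kernel_coord`. -/
theorem exists_offDiagonal_kernel {T S : Op M} (hT : HasKernelSmoothOffDiagonal T)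
    (hS : HasKernelSmoothOffDiagonal S) (hSp : IsProperlySupported S) (hφ : IsLocalCoord M φ)
    {g : M → ℂ} (hg : ContMDiff (𝓡 n) 𝓘(ℝ, ℂ) ∞ g) {W : Set (Eucl n)} (hW : IsOpen W)
    (hWφ : W ⊆ φ.target) (hgW : ∀ x ∈ W, g (φ.symm x) = 0) {x₀ : Eucl n} (hx₀ : x₀ ∈ W) :
    ∃ (V : Set (Eucl n)) (K : Eucl n → ℂ), IsOpen V ∧ x₀ ∈ V ∧ V ⊆ φ.target ∧ ContDiffOn ℝ ∞ K V ∧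
      ∀ u : TestFn M, tsupport (u : M → ℂ) ⊆ φ.source ∩ φ ⁻¹' V →
        (T (mulTest hg (hSp.toTest u)) : M → ℂ) (φ.symm x₀) = ∫ z, K z * coordRep φ u z := by
  classical
  obtain ⟨ε, hε, hεW⟩ := Metric.nhds_basis_closedBall.mem_iff.1 (hW.mem_nhds hx₀)
  set B := Metric.closedBall x₀ ε with hB
  set V := Metric.ball x₀ ε with hV
  have hVo : IsOpen V := Metric.isOpen_ball
  have hVB : V ⊆ B := Metric.ball_subset_closedBall
  have hVφ : V ⊆ φ.target := hVB.trans (hεW.trans hWφ)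
  have hxV : x₀ ∈ V := Metric.mem_ball_self hε
  have hC : IsCompact (φ.symm '' B) := isCompact_symm_image (isCompact_closedBall _ _)
    (hεW.trans hWφ)
  set φ' := InvPsiDO.coordRestr φ V with hφ'def
  have hφ' : IsLocalCoord M φ' := hφ.coordRestr hVo
  have hsrc : φ'.source = φ.source ∩ φ ⁻¹' V := coordRestr_source hVo
  have htgt : φ'.target = V := coordRestr_target hVo hVφ
  have hsrcC : φ'.source ⊆ φ.symm '' B := by
    rw [hsrc]
    rintro x ⟨h1, h2⟩
    exact ⟨φ x, hVB h2, φ.left_inv h1⟩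
  obtain ⟨L, hL, hSL⟩ := hSp.left _ hC
  have hW' : IsOpen (φ.source ∩ φ ⁻¹' W) := isOpen_coord_preimage hW
  have hCW : φ.symm '' B ⊆ φ.source ∩ φ ⁻¹' W := by
    rintro _ ⟨x, hx, rfl⟩
    have hxt := hWφ (hεW hx)
    exact ⟨φ.map_target hxt, by simpa [φ.right_inv hxt] using hεW hx⟩
  set s := L \ (φ.source ∩ φ ⁻¹' W) with hs
  have hsc : IsCompact s := hL.diff hW'
  have hCo : IsOpen (φ.symm '' B)ᶜ := hC.isClosed.isOpen_compl
  set θ : M → OpenPartialHomeomorph M (Eucl n) := fun y =>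
    (chartAt (Eucl n) y).restr (φ.symm '' B)ᶜ with hθ
  have hθc : ∀ y, IsLocalCoord M (θ y) := fun y => (isLocalCoord_chartAt y).restr hCo
  have hθs : ∀ y, (θ y).source = (chartAt (Eucl n) y).source ∩ (φ.symm '' B)ᶜ := fun y =>
    OpenPartialHomeomorph.restr_source' _ _ hCo
  have hdisj : ∀ y, Disjoint φ'.source (θ y).source := fun y => by
    rw [hθs]
    exact Set.disjoint_left.2 fun x hx hx' => hx'.2 (hsrcC hx)
  obtain ⟨t, ρ, hρ, hsum⟩ := exists_finite_partition hsc (U := fun y => (θ y).source)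
    fun y hy => ⟨(θ y).open_source, by
      rw [hθs]
      exact ⟨mem_chart_source _ y, fun h => hy.2 (hCW h)⟩⟩
  have hρg : ∀ i ∈ t, tsupport (mulTest hg (ρ i) : M → ℂ) ⊆ (θ i).source := fun i hi =>
    (tsupport_mul_subset_right (f := g) (g := (ρ i : M → ℂ))).trans (hρ i hi).2
  have key : ∀ i ∈ t, ∃ K : Eucl n → ℂ, ContDiffOn ℝ ∞ K φ'.target ∧ ∀ u : TestFn M,
      tsupport (u : M → ℂ) ⊆ φ'.source →
        (T (mulTest (mulTest hg (ρ i)).2.1 (hSp.toTest u)) : M → ℂ) (φ'.symm x₀) =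
          ∫ z, K z * coordRep φ' u z := fun i hi =>
    exists_composed_kernel_coord hSp hφ' (hθc i) (hT _ _ hφ' (hθc i) (hdisj i))
      (hS _ _ (hθc i) hφ' (hdisj i).symm) _ (hρg i hi) (by rwa [htgt])
  choose! K hK hKu using key
  rw [htgt] at hK
  refine ⟨V, fun z => ∑ i ∈ t, K i z, hVo, hxV, hVφ, ContDiffOn.sum fun i hi => hK i hi,
    fun u hu => ?_⟩
  have hu' : tsupport (u : M → ℂ) ⊆ φ'.source := by rwa [hsrc]
  -- Outside `L` the function `S u` vanishes, over `W` the factor `g` does, and on the remaining set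
  -- `s` the partition sums to one.
  have hdec : mulTest hg (hSp.toTest u) =
      ∑ i ∈ t, mulTest (mulTest hg (ρ i)).2.1 (hSp.toTest u) := by
    refine Subtype.ext (funext fun y => ?_)
    rw [AddSubmonoidClass.coe_finsetSum, Finset.sum_apply]
    change g y * (S u : M → ℂ) y = ∑ i ∈ t, g y * (ρ i : M → ℂ) y * (S u : M → ℂ) y
    by_cases hyL : y ∈ L
    · by_cases hyW : y ∈ φ.source ∩ φ ⁻¹' W
      · have : g y = 0 := by
          rw [← φ.left_inv hyW.1]
          exact hgW _ hyW.2
        simp [this]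
      · rw [← Finset.sum_mul, ← Finset.mul_sum, hsum y ⟨hyL, hyW⟩, mul_one]
    · have : (S u : M → ℂ) y = 0 :=
        image_eq_zero_of_notMem_tsupport fun h => hyL (hSL u (hu'.trans hsrcC) h)
      simp [this]
  have hrep : coordRep φ' (u : M → ℂ) = coordRep φ u := coordRep_coordRestr hVo hVφ hu
  rw [hdec, map_sum, AddSubmonoidClass.coe_finsetSum, Finset.sum_apply]
  simp only [Finset.sum_mul]
  have hus : tsupport (coordRep φ u) ⊆ V := by
    rw [← hrep, ← htgt]
    exact (tsupport_coordRep_subset u.2.2 hu').trans (image_tsupport_subset_target hu')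
  have hu0 : tsupport (u : M → ℂ) ⊆ φ.source := hu.trans Set.inter_subset_left
  rw [integral_finsetSum _ fun i hi => integrable_mul_of_tsupport hVo (hK i hi)
    (hφ.contDiff_coordRep u.2.1 u.2.2 hu0) (hasCompactSupport_coordRep u.2.2 hu0) hus]
  refine Finset.sum_congr rfl fun i hi => ?_
  rw [← hrep]
  exact hKu i hi u hu'

theorem integrable_symbol_mul {p : Eucl n → ℂ} (hp : Continuous p) {C s : ℝ}
    (hb : ∀ ξ, ‖p ξ‖ ≤ C * (1 + ‖ξ‖) ^ s) {v : Eucl n → ℂ} (hv : ContDiff ℝ ∞ v)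
    (hc : HasCompactSupport v) : Integrable fun ξ => p ξ * oscInt v (-ξ) := by
  obtain ⟨N, hN⟩ := exists_nat_ge (s + (n + 1))
  obtain ⟨C', h0, hC'⟩ := oscInt_bound_single hv hc N
  refine integrable_of_norm_le_rpow (C := |C| * C') (t := s - N) ?_ (by linarith) fun ξ => ?_
  · exact (hp.mul ((continuous_oscInt (contDiff_integrable hv hc)).comp
      continuous_neg)).aestronglyMeasurable
  · rw [norm_mul]
    have h1 := hC' (-ξ)
    rw [norm_neg] at h1
    calc _ ≤ (|C| * (1 + ‖ξ‖) ^ s) * (C' * (1 + ‖ξ‖) ^ (-(N : ℝ))) :=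
          mul_le_mul ((hb ξ).trans (mul_le_mul_of_nonneg_right (le_abs_self C) (by positivity))) h1
            (norm_nonneg _) (by positivity)
      _ = _ := by rw [sub_eq_add_neg, Real.rpow_add (by positivity)]; ring

theorem quantize_add {p r : Eucl n → Eucl n → ℂ} {v : Eucl n → ℂ} {x : Eucl n}
    (hp : Integrable fun ξ => p x ξ * oscInt v (-ξ))
    (hr : Integrable fun ξ => r x ξ * oscInt v (-ξ)) :
    quantize (fun x ξ => p x ξ + r x ξ) v x = quantize p v x + quantize r v x := by
  rw [quantize_eq, quantize_eq, quantize_eq, ← mul_add, ← oscInt_add hp hr]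
  simp only [add_mul]

/-- On functions with support in a fixed compact subset of a coordinate domain, a
pseudodifferential operator is given by a symbol, without a remainder. -/
theorem HasSymbolInCoord.exists_localSymbol {T : Op M} {m : ℂ} {σ : ℕ → Eucl n → Eucl n → ℂ}
    (hφ : IsLocalCoord M φ) (hT : HasSymbolInCoord m T φ σ) {L : Set (Eucl n)} (hL : IsCompact L)
    (hLφ : L ⊆ φ.target) : ∃ p, IsLocalSymbol φ.target m p σ ∧ ∀ u : TestFn M,
      tsupport (u : M → ℂ) ⊆ φ.source → tsupport (coordRep φ u) ⊆ L → ∀ x ∈ φ.target,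
        (T u : M → ℂ) (φ.symm x) = quantize p (coordRep φ u) x := by
  obtain ⟨p, k, hp, hk, hT⟩ := hT
  obtain ⟨r, hr, hr', hrk⟩ := exists_rapid_symbol φ.open_target hL hLφ hk
  have hp' := hp.isLocalSymbol φ.open_target
  refine ⟨_, hp'.add_rapid φ.open_target hr hr', fun u hu huL x hx => ?_⟩
  have hv := hφ.contDiff_coordRep u.2.1 u.2.2 hu
  have hc := hasCompactSupport_coordRep (φ := φ) u.2.2 hu
  obtain ⟨C, hC⟩ := (hp'.bound_snd x hx).bound []
  obtain ⟨C', hC'⟩ := hr' x hx [] 0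
  rw [hT u hu x hx, quantize_add
    (integrable_symbol_mul (hp'.bound_snd x hx).smooth.continuous hC hv hc)
    (integrable_symbol_mul (hr.continuous_slice hx) hC' hv hc), hrk _ hv huL x hx]
  congr 1
  refine setIntegral_congr_fun φ.open_target.measurableSet fun y hy => ?_
  simp only [coordRep_apply hy]

end OffDiagonalProducts

/-! ### The formal product of symbols -/

section SymbolProducts

open MeasureTheory Filter

/-- The contribution of the `r`-th derivatives of `σ` to the formal product of `σ` and `τ`, the
components of `σ` and `τ` having total index `e`. -/
def prodTerm (σ τ : ℕ → Eucl n → Eucl n → ℂ) (r e : ℕ) (x ξ : Eucl n) : ℂ :=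
  ((r.factorial : ℝ)⁻¹ : ℝ) * ∑ J : Fin r → Fin n, ∑ k ∈ Finset.range (e + 1),
    pd (List.ofFn J) (σ k x) ξ * ((-Complex.I) ^ r * pd (List.ofFn J) (fun y => τ (e - k) y ξ) x)

/-- The formal product of symbols. -/
def symProd (σ τ : ℕ → Eucl n → Eucl n → ℂ) (j : ℕ) (x ξ : Eucl n) : ℂ :=
  ∑ r ∈ Finset.range (j + 1), prodTerm σ τ r (j - r) x ξ

/-- Differentiating the homogeneity relation produces one factor `t` on the left by the chain rule,
so each derivative lowers the degree by one. -/
theorem pd_homogeneous {f : Eucl n → ℂ} (hf : ContDiffOn ℝ ∞ f {0}ᶜ) {μ : ℂ}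
    (hh : ∀ ξ, ξ ≠ 0 → ∀ t : ℝ, 0 < t → f (t • ξ) = (t : ℂ) ^ μ * f ξ) (l : List (Fin n)) :
    ∀ ξ, ξ ≠ 0 → ∀ t : ℝ, 0 < t → pd l f (t • ξ) = (t : ℂ) ^ (μ - l.length) * pd l f ξ := by
  have ho : IsOpen ({0}ᶜ : Set (Eucl n)) := isOpen_compl_singleton
  induction l with
  | nil => simpa [pd] using hh
  | cons i l ih =>
    intro ξ hξ t ht
    have htξ : t • ξ ≠ 0 := smul_ne_zero ht.ne' hξ
    have hd : ∀ ζ : Eucl n, ζ ≠ 0 → DifferentiableAt ℝ (pd l f) ζ := fun ζ hζ =>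
      ((contDiffOn_pd ho hf l).contDiffAt (ho.mem_nhds hζ)).differentiableAt (by simp)
    have h1 : fderiv ℝ (fun ζ => pd l f (t • ζ)) ξ =
        fderiv ℝ (fun ζ => (t : ℂ) ^ (μ - l.length) * pd l f ζ) ξ :=
      Filter.EventuallyEq.fderiv_eq (by
        filter_upwards [ho.mem_nhds hξ] with ζ hζ using ih ζ hζ t ht)
    have h2 : fderiv ℝ (fun ζ => pd l f (t • ζ)) ξ (stdVec i) = t * pd (i :: l) f (t • ξ) := by
      have h3 : HasFDerivAt (fun ζ : Eucl n => t • ζ) (t • ContinuousLinearMap.id ℝ (Eucl n)) ξ :=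
        (hasFDerivAt_id ξ).const_smul t
      have h4 := ((hd _ htξ).hasFDerivAt.comp ξ h3).fderiv
      have h5 : (pd l f ∘ fun ζ : Eucl n => t • ζ) = fun ζ => pd l f (t • ζ) := rfl
      rw [h5] at h4
      rw [h4]
      simp [pd]
    have h6 : fderiv ℝ (fun ζ => (t : ℂ) ^ (μ - l.length) * pd l f ζ) ξ (stdVec i) =
        (t : ℂ) ^ (μ - l.length) * pd (i :: l) f ξ := by
      rw [fderiv_const_mul (hd ξ hξ)]
      rfl
    have htc : (t : ℂ) ≠ 0 := by exact_mod_cast ht.ne'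
    have h7 : (t : ℂ) * pd (i :: l) f (t • ξ) = (t : ℂ) ^ (μ - l.length) * pd (i :: l) f ξ := by
      rw [← h2, h1, h6]
    have h8 : μ - ((i :: l).length : ℂ) = (μ - l.length) - 1 := by
      push_cast [List.length_cons]; ring
    rw [h8, Complex.cpow_sub _ _ htc, Complex.cpow_one, div_mul_eq_mul_div, ← h7]
    field_simp

variable {U : Set (Eucl n)} {m m' : ℂ} {σ τ : ℕ → Eucl n → Eucl n → ℂ}

theorem IsHomogeneousSymbol.pd_snd {p : Eucl n → Eucl n → ℂ} (hp : IsHomogeneousSymbol U m p)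
    {x : Eucl n} (hx : x ∈ U) (l : List (Fin n)) {ξ : Eucl n} (hξ : ξ ≠ 0) {t : ℝ} (ht : 0 < t) :
    pd l (p x) (t • ξ) = (t : ℂ) ^ (m - l.length) * pd l (p x) ξ :=
  pd_homogeneous (contDiffOn_slice_snd hp.smooth hx) (hp.homogeneous x hx) l ξ hξ t ht

theorem IsHomogeneousSymbol.pd_fst {p : Eucl n → Eucl n → ℂ} (hU : IsOpen U)
    (hp : IsHomogeneousSymbol U m p)
    {x : Eucl n} (hx : x ∈ U) (l : List (Fin n)) {ξ : Eucl n} (hξ : ξ ≠ 0) {t : ℝ} (ht : 0 < t) :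
    pd l (fun y => p y (t • ξ)) x = (t : ℂ) ^ m * pd l (fun y => p y ξ) x := by
  refine Eq.trans ?_ (pd_const_mul hU (contDiffOn_slice_fst hp.smooth hξ) ((t : ℂ) ^ m) l hx)
  exact pd_congr hU (fun y hy => hp.homogeneous y hy ξ hξ t ht) l hx

/-- The `r` derivatives in `ξ` lower the degree by `r` and those in `x` leave it unchanged; the
indices add up as `r + k + (j - r - k) = j`. -/
theorem symProd_homogeneous (hU : IsOpen U) (hσ : ∀ j : ℕ, IsHomogeneousSymbol U (m - j) (σ j))
    (hτ : ∀ j : ℕ, IsHomogeneousSymbol U (m' - j) (τ j)) (j : ℕ) {x : Eucl n} (hx : x ∈ U)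
    {ξ : Eucl n} (hξ : ξ ≠ 0) {t : ℝ} (ht : 0 < t) :
    symProd σ τ j x (t • ξ) = (t : ℂ) ^ (m + m' - j) * symProd σ τ j x ξ := by
  have htc : (t : ℂ) ≠ 0 := by exact_mod_cast ht.ne'
  simp only [symProd, prodTerm]
  rw [Finset.mul_sum]
  refine Finset.sum_congr rfl fun r hr => ?_
  rw [mul_left_comm]
  congr 1
  rw [Finset.mul_sum]
  refine Finset.sum_congr rfl fun J _ => ?_
  rw [Finset.mul_sum]
  refine Finset.sum_congr rfl fun k hk => ?_
  rw [(hσ k).pd_snd hx _ hξ ht, (hτ (j - r - k)).pd_fst hU hx _ hξ ht, List.length_ofFn]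
  have h1 : r + k + (j - r - k) = j := by
    have := Finset.mem_range.1 hr
    have := Finset.mem_range.1 hk
    omega
  have h2 : m + m' - j = (m - k - r) + (m' - (j - r - k : ℕ)) := by
    rw [← h1]
    push_cast
    have h3 : ((r + k + (j - r - k) - r - k : ℕ) : ℂ) = ((j - r - k : ℕ) : ℂ) := by
      congr 1; omega
    rw [h3]; ring
  rw [h2, Complex.cpow_add _ _ htc]
  ring

theorem continuousOn_symProd (hU : IsOpen U) (hσ : ∀ j : ℕ, IsHomogeneousSymbol U (m - j) (σ j))
    (hτ : ∀ j : ℕ, IsHomogeneousSymbol U (m' - j) (τ j)) (j : ℕ) {x : Eucl n} (hx : x ∈ U) :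
    ContinuousOn (symProd σ τ j x) {0}ᶜ := by
  have ho : IsOpen (U ×ˢ ({0}ᶜ : Set (Eucl n))) := hU.prod isOpen_compl_singleton
  refine continuousOn_finsetSum _ fun r _ => ContinuousOn.mul continuousOn_const ?_
  refine continuousOn_finsetSum _ fun J _ => continuousOn_finsetSum _ fun k _ =>
    ContinuousOn.mul ?_ (ContinuousOn.mul continuousOn_const ?_)
  · exact (contDiffOn_slice_snd (contDiffOn_pd_snd ho (hσ k).smooth _) hx).continuousOn
  · exact (contDiffOn_slice_snd (contDiffOn_pd_fst ho (hτ _).smooth _) hx).continuousOn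

theorem IsLocalSymbol.amplitudeBound {q : Eucl n → Eucl n → ℂ} (hU : IsOpen U)
    (hq : IsLocalSymbol U m q τ) {ψ : Eucl n → ℂ} (hψ : ContDiff ℝ ∞ ψ) (hψc : HasCompactSupport ψ)
    (hψU : tsupport ψ ⊆ U) : AmplitudeBound (fun y ξ => ψ y * q y ξ) (tsupport ψ) m.re where
  smooth := by
    refine contDiff_of_zero_off (hU.prod isOpen_univ) (A := Prod.fst ⁻¹' tsupport ψ) ?_
      ((isClosed_tsupport ψ).preimage continuous_fst) (fun q hq => ⟨hψU hq, trivial⟩) fun q hq => ?_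
    · exact (hψ.comp contDiff_fst).contDiffOn.mul hq.smooth
    · change ψ q.1 * _ = 0
      rw [image_eq_zero_of_notMem_tsupport hq, zero_mul]
  support ξ y hy := by rw [image_eq_zero_of_notMem_tsupport hy, zero_mul]
  bound l := by
    obtain ⟨C, hC⟩ := exists_bound_pd_mul (S := Set.univ) (U := U) (K := tsupport ψ)
      (f := fun _ : Eucl n => ψ) (g := fun ξ y => q y ξ) (A := fun _ => 1)
      (B := fun ξ => (1 + ‖ξ‖) ^ m.re) hU hψU (fun _ _ => hψ.contDiffOn)
      (fun ξ _ => contDiffOn_slice_fst hq.smooth (Set.mem_univ ξ))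
      (fun l => by
        obtain ⟨C, _, hC⟩ := exists_bound_pd isOpen_univ hψc (Set.subset_univ _) hψ.contDiffOn l
        exact ⟨C, fun _ _ y hy => by simpa using hC y hy⟩)
      (fun l => by
        obtain ⟨C, hC⟩ := hq.bound_fst _ hψc hψU l
        exact ⟨C, fun ξ _ y hy => hC y hy ξ⟩) l
    exact ⟨C, fun ξ y hy => by simpa using hC ξ trivial y hy⟩

/-- The expansion of the composite by number of derivatives is combined with the expansions of `p`
and `q` inside each term. The cutoff is one near `x₀`, so its derivatives contribute nothing there.
-/
theorem IsLocalSymbol.hasExpansion_symProd {p q : Eucl n → Eucl n → ℂ} (hU : IsOpen U)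
    (hp : IsLocalSymbol U m p σ) (hq : IsLocalSymbol U m' q τ) {ψ : Eucl n → ℂ}
    (hψ : ContDiff ℝ ∞ ψ) (hψc : HasCompactSupport ψ) (hψU : tsupport ψ ⊆ U) {x₀ : Eucl n}
    (hx₀ : x₀ ∈ U) (hψ1 : ψ =ᶠ[𝓝 x₀] fun _ => 1) :
    HasExpansion (m.re + m'.re) (compSymbol (p x₀) (fun y ξ => ψ y * q y ξ) x₀)
      (fun j => symProd σ τ j x₀) := by
  refine hasExpansion_double (G := fun r e => prodTerm σ τ r e x₀)
    (hasExpansion_compSymbol (hp.bound_snd x₀ hx₀) (hq.amplitudeBound hU hψ hψc hψU) hψc x₀)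
    fun r => ?_
  refine HasExpansion.const_mul (f := fun ξ => ∑ J : Fin r → Fin n, pd (List.ofFn J) (p x₀) ξ *
    ((-Complex.I) ^ r * pd (List.ofFn J) (fun y => ψ y * q y ξ) x₀)) (HasExpansion.sum _ fun J _ => ?_) _
  have h1 := hp.expansion_snd x₀ hx₀ (List.ofFn J)
  have h2 := (hq.expansion_fst x₀ hx₀ (List.ofFn J)).const_mul ((-Complex.I) ^ r)
  have h3 := h1.mul h2
  rw [List.length_ofFn] at h3
  have e1 : m.re + m'.re - r = m.re - r + m'.re := by ring
  have e2 : ∀ ξ, pd (List.ofFn J) (fun y => ψ y * q y ξ) x₀ =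
      pd (List.ofFn J) (fun y => q y ξ) x₀ := fun ξ => by
    refine (pd_eventuallyEq ?_ _).eq_of_nhds
    filter_upwards [hψ1] with y hy
    rw [hy, one_mul]
  rw [e1]
  simp only [e2]
  exact h3

variable {M : SmoothMfd.{u} n} {φ : OpenPartialHomeomorph M (Eucl n)}

/-- Every condition on the components concerns `x ∈ U` and `ξ ≠ 0`, and derivatives are taken on
open sets, so values elsewhere are irrelevant. -/
theorem HasSymbolExpansion.congr_symbol {p : Eucl n → Eucl n → ℂ} (hp : HasSymbolExpansion U m p σ)
    (hU : IsOpen U) (h : ∀ j, ∀ x ∈ U, ∀ ξ, ξ ≠ 0 → σ j x ξ = τ j x ξ) :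
    HasSymbolExpansion U m p τ where
  smooth := hp.smooth
  homogeneous j :=
    ⟨(hp.homogeneous j).smooth.congr fun q hq => (h j q.1 hq.1 q.2 hq.2).symm,
      fun x hx ξ hξ t ht => by
        rw [← h j x hx ξ hξ, ← h j x hx _ (smul_ne_zero ht.ne' hξ)]
        exact (hp.homogeneous j).homogeneous x hx ξ hξ t ht⟩
  bound N K hK hKU α β := by
    obtain ⟨C, hC⟩ := hp.bound N K hK hKU α β
    refine ⟨C, fun x hx ξ hξ => (le_of_eq ?_).trans (hC x hx ξ hξ)⟩
    have ho : IsOpen ({0}ᶜ : Set (Eucl n)) := isOpen_compl_singleton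
    congr 1
    refine pd_congr hU (fun y hy => ?_) α (hKU hx)
    refine pd_congr ho (fun ζ hζ => ?_) β (far_subset hξ)
    congr 1
    exact Finset.sum_congr rfl fun j _ => (h j y hy ζ hζ).symm

theorem HasSymbolInCoord.congr_symbol {T : Op M} (hT : HasSymbolInCoord m T φ σ)
    (h : ∀ j, ∀ x ∈ φ.target, ∀ ξ, ξ ≠ 0 → σ j x ξ = τ j x ξ) : HasSymbolInCoord m T φ τ := by
  obtain ⟨p, k, hp, hk, hT⟩ := hT
  exact ⟨p, k, hp.congr_symbol φ.open_target h, hk, hT⟩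

end SymbolProducts

/-! ### The symbol of a parametrix -/

section SymbolOfParametrix

open MeasureTheory Filter

variable {M : SmoothMfd.{u} n} {φ : OpenPartialHomeomorph M (Eucl n)}
  {m m' : ℂ} {σ τ : ℕ → Eucl n → Eucl n → ℂ}

theorem quantize_mul_left (ψ : Eucl n → ℂ) (q : Eucl n → Eucl n → ℂ) (v : Eucl n → ℂ)
    (x : Eucl n) : ψ x * quantize q v x = quantize (fun y ξ => ψ y * q y ξ) v x := by
  rw [quantize_eq, quantize_eq, mul_left_comm, ← oscInt_const_mul]
  simp only [mul_assoc]

theorem IsLocalCoord.tsupport_liftTest_subset (hφ : IsLocalCoord M φ) {v : Eucl n → ℂ}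
    (hv : ContDiff ℝ ∞ v) (hc : HasCompactSupport v) (hs : tsupport v ⊆ φ.target)
    {V : Set (Eucl n)} (hV : tsupport v ⊆ V) :
    tsupport (hφ.liftTest hv hc hs : M → ℂ) ⊆ φ.source ∩ φ ⁻¹' V := by
  refine (tsupport_coordLift_subset hc hs).trans ?_
  rintro _ ⟨x, hx, rfl⟩
  exact ⟨φ.map_target (hs hx), by simpa [φ.right_inv (hs hx)] using hV hx⟩

theorem IsLocalSymbol.compSymbol_eq_quantize {U : Set (Eucl n)} (hU : IsOpen U)
    {p q : Eucl n → Eucl n → ℂ}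
    (hp : IsLocalSymbol U m p σ) (hq : IsLocalSymbol U m' q τ) {ψ : Eucl n → ℂ}
    (hψ : ContDiff ℝ ∞ ψ) (hψc : HasCompactSupport ψ) (hψU : tsupport ψ ⊆ U) {x₀ : Eucl n}
    (hx₀ : x₀ ∈ U) {v : Eucl n → ℂ} (hv : ContDiff ℝ ∞ v) (hc : HasCompactSupport v) :
    quantize p (fun x => ψ x * quantize q v x) x₀ =
      quantize (fun x => compSymbol (p x) (fun y ξ => ψ y * q y ξ) x) v x₀ := by
  simp only [quantize_mul_left]
  simp only [quantize_eq]
  congr 1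
  refine comp_eq (V := fun ξ => oscInt v (-ξ)) (hp.bound_snd x₀ hx₀)
    (hq.amplitudeBound hU hψ hψc hψU) hψc x₀
    ((continuous_oscInt (contDiff_integrable hv hc)).comp continuous_neg) fun N => ?_
  obtain ⟨C, h0, hC⟩ := oscInt_bound_single hv hc N
  exact ⟨C, h0, fun ξ => by simpa using hC (-ξ)⟩

/-- If `T S = 1` modulo smoothing operators, then the formal product of the symbols is `1`. -/
theorem symProd_eq_one {T S : Op M} (hS : IsProperlySupported S)
    (hTo : HasKernelSmoothOffDiagonal T) (hSo : HasKernelSmoothOffDiagonal S)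
    (hφ : IsLocalCoord M φ) (hm : m + m' = 0) (hTσ : HasSymbolInCoord m T φ σ)
    (hSτ : HasSymbolInCoord m' S φ τ) (h : IsSmoothing (T ∘ₗ hS.toTest - idOp M)) (j : ℕ)
    {x₀ : Eucl n} (hx₀ : x₀ ∈ φ.target) {ξ₀ : Eucl n} (hξ₀ : ξ₀ ≠ 0) :
    symProd σ τ j x₀ ξ₀ = if j = 0 then 1 else 0 := by
  set c : ℂ := ((2 * Real.pi : ℝ) : ℂ) ^ (-(n : ℤ)) with hcdef
  have hU := φ.open_target
  obtain ⟨ψ, hψ, hψc, hψU, W, hW, hxW, hψ1⟩ := exists_cutoff (isCompact_singleton (x := x₀)) hU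
    (by simpa using hx₀)
  replace hxW : x₀ ∈ W := hxW rfl
  have hW'o : IsOpen (W ∩ φ.target) := hW.inter hU
  set Ψ := hφ.liftTest hψ hψc hψU with hΨ
  have hΨx : ∀ x ∈ φ.target, (Ψ : M → ℂ) (φ.symm x) = ψ x := fun x hx => coordLift_symm hx
  have hg : ContMDiff (𝓡 n) 𝓘(ℝ, ℂ) ∞ fun x => 1 - (Ψ : M → ℂ) x :=
    contMDiff_const.sub Ψ.2.1
  -- The part of `T S` that passes through `1 - Ψ`, which vanishes near `x₀`, contributes a smooth
  -- kernel at `x₀`.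
  obtain ⟨V, K, hV, hxV, hVφ, hK, hTK⟩ := exists_offDiagonal_kernel hTo hSo hS hφ hg hW'o
    Set.inter_subset_right (fun x hx => by
      simp only [hΨx x hx.2, hψ1 x hx.1, sub_self]) ⟨hxW, hx₀⟩
  -- Here `T` acts on functions cut off by `ψ`, and `S` below on functions supported in a ball about
  -- `x₀`; with these supports fixed, both operators are given by symbols without remainder.
  obtain ⟨p, hp, hTp⟩ := hTσ.exists_localSymbol hφ hψc hψU
  obtain ⟨ε, hε, hεV⟩ := Metric.nhds_basis_closedBall.mem_iff.1 (hV.mem_nhds hxV)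
  obtain ⟨q, hq, hSq⟩ := hSτ.exists_localSymbol hφ (isCompact_closedBall x₀ ε) (hεV.trans hVφ)
  obtain ⟨l, hl, hTS⟩ := (h φ φ hφ hφ).exists_kernel
  have hBV : Metric.ball x₀ ε ⊆ V := Metric.ball_subset_closedBall.trans hεV
  set Q : Eucl n → Eucl n → ℂ := fun y ξ => ψ y * q y ξ with hQ
  have hamp := hq.amplitudeBound hU hψ hψc hψU
  have hψ1' : ψ =ᶠ[𝓝 x₀] fun _ => 1 := by
    filter_upwards [hW.mem_nhds hxW] with y hy using hψ1 y hy
  have hexp := hp.hasExpansion_symProd hU hq hψ hψc hψU hx₀ hψ1'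
  have hre : m.re + m'.re = 0 := by rw [← Complex.add_re, hm, Complex.zero_re]
  rw [hre] at hexp
  have hexp1 := hexp.sub hasExpansion_one
  obtain ⟨C, hC0, hC⟩ := compSymbol_expansion (hp.bound_snd x₀ hx₀) hamp hψc x₀ 0
  have hsm := stronglyMeasurable_compSymbol (hp.bound_snd x₀ hx₀).smooth.continuous hamp x₀
  have hC' : ∀ ξ, ‖compSymbol (p x₀) Q x₀ ξ‖ ≤ C * (1 + ‖ξ‖) ^ (0 : ℝ) := fun ξ => by
    have := hC ξ
    rwa [Finset.range_zero, Finset.sum_empty, sub_zero, hre, Nat.cast_zero, sub_zero] at this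
  rw [← sub_eq_zero]
  obtain ⟨p₀, -, hp₀, -, -⟩ := hTσ
  obtain ⟨q₀, -, hq₀, -, -⟩ := hSτ
  -- The identity has symbol `1`, and `l` is the kernel of `T S - 1`. At `x₀` the operator with
  -- symbol `compSymbol - 1` is therefore integration against `l x₀ - K`.
  refine expansion_eq_zero (μ := 0) (f := fun ξ => compSymbol (p x₀) Q x₀ ξ - 1)
    (F := fun j ξ => symProd σ τ j x₀ ξ - if j = 0 then 1 else 0)
    (K := fun y => l x₀ y - K y)
    (Metric.isOpen_ball (x := x₀) (ε := ε)) (Metric.mem_ball_self hε)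
    (((contDiffOn_slice_snd hl hx₀).mono (hBV.trans hVφ)).sub (hK.mono hBV))
    (hsm.sub stronglyMeasurable_const) (C := C + 1) (M := 0) (fun ξ => ?_) (by simpa using hexp1)
    (fun j ξ hξ t ht => ?_) (fun j => ?_) (fun v hv hvc hvB => ?_) j ξ₀ hξ₀
  · refine (norm_sub_le _ _).trans ?_
    have := hC' ξ
    simp only [Real.rpow_zero, mul_one, norm_one] at this ⊢
    linarith
  · beta_reduce
    rw [symProd_homogeneous hU hp₀.homogeneous hq₀.homogeneous j hx₀ hξ ht, hm]
    rcases eq_or_ne j 0 with rfl | hj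
    · simp
    · simp [hj]
  · exact (continuousOn_symProd hU hp₀.homogeneous hq₀.homogeneous j hx₀).sub continuousOn_const
  · have hvV : tsupport v ⊆ V := hvB.trans hBV
    have hvφ : tsupport v ⊆ φ.target := hvV.trans hVφ
    set u := hφ.liftTest hv hvc hvφ with hu
    have hrep : coordRep φ (u : M → ℂ) = v := coordRep_coordLift hvφ
    have hus := hφ.tsupport_liftTest_subset hv hvc hvφ hvV
    have hus' : tsupport (u : M → ℂ) ⊆ φ.source := hus.trans Set.inter_subset_left
    have e1 := hTK u hus
    have e2 := hTS u hus' x₀ hx₀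
    rw [hrep] at e1 e2
    have e3 : ∀ x ∈ φ.target, (S u : M → ℂ) (φ.symm x) = quantize q v x := fun x hx => by
      rw [hSq u hus' (by rw [hrep]; exact hvB.trans Metric.ball_subset_closedBall) x hx, hrep]
    have hΨs : tsupport (mulTest Ψ.2.1 (hS.toTest u) : M → ℂ) ⊆ φ.source :=
      (tsupport_mulTest_subset _ _).trans ((hφ.tsupport_liftTest_subset hψ hψc hψU hψU).trans
        Set.inter_subset_left)
    have hΨrep : coordRep φ (mulTest Ψ.2.1 (hS.toTest u) : M → ℂ) =
        fun x => ψ x * quantize q v x := by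
      ext x
      by_cases hx : x ∈ φ.target
      · rw [coordRep_apply hx, ← e3 x hx, ← hΨx x hx]
        rfl
      · rw [image_eq_zero_of_notMem_tsupport fun h' => hx (hψU h'), zero_mul]
        exact Set.indicator_of_notMem hx _
    have e4 := hTp _ hΨs (by
      rw [hΨrep]
      exact tsupport_mul_subset_left (f := ψ) (g := fun x => quantize q v x)) x₀ hx₀
    rw [hΨrep, hp.compSymbol_eq_quantize hU hq hψ hψc hψU hx₀ hv hvc] at e4
    have e5 : hS.toTest u = mulTest Ψ.2.1 (hS.toTest u) + mulTest hg (hS.toTest u) := by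
      refine Subtype.ext (funext fun x => ?_)
      change (S u : M → ℂ) x = (Ψ : M → ℂ) x * (S u : M → ℂ) x +
        (1 - (Ψ : M → ℂ) x) * (S u : M → ℂ) x
      ring
    have e6 : ((T ∘ₗ hS.toTest - idOp M) u : M → ℂ) (φ.symm x₀) =
        (T (mulTest Ψ.2.1 (hS.toTest u)) : M → ℂ) (φ.symm x₀) +
        (T (mulTest hg (hS.toTest u)) : M → ℂ) (φ.symm x₀) - (u : M → ℂ) (φ.symm x₀) := by
      change (T (hS.toTest u) : M → ℂ) (φ.symm x₀) - (u : M → ℂ) (φ.symm x₀) = _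
      have h1 : (T (hS.toTest u) : M → ℂ) (φ.symm x₀) = (T (mulTest Ψ.2.1 (hS.toTest u) +
          mulTest hg (hS.toTest u)) : M → ℂ) (φ.symm x₀) := by rw [← e5]
      rw [h1, map_add]
      rfl
    have e7 : (u : M → ℂ) (φ.symm x₀) = c * oscInt (fun ξ => oscInt v (-ξ)) x₀ := by
      rw [hcdef, fourier_inversion hv hvc]
      exact coordLift_symm hx₀
    rw [e6, e4, e1, e7, quantize_eq] at e2
    have hi1 : Integrable fun ξ => compSymbol (p x₀) Q x₀ ξ * oscInt v (-ξ) := by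
      obtain ⟨C₁, h1, hC₁⟩ := oscInt_bound_single hv hvc (n + 1)
      refine integrable_of_norm_le_rpow (C := C * C₁) (t := -((n + 1 : ℕ) : ℝ)) ?_
        (by push_cast; linarith) fun ξ => ?_
      · exact hsm.aestronglyMeasurable.mul ((continuous_oscInt (contDiff_integrable hv hvc)).comp
          continuous_neg).aestronglyMeasurable
      · rw [norm_mul, mul_assoc]
        have h2 := hC₁ (-ξ)
        have h3 := hC' ξ
        rw [norm_neg] at h2
        rw [Real.rpow_zero, mul_one] at h3
        exact mul_le_mul h3 h2 (norm_nonneg _) hC0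
    have hi2 : Integrable fun ξ => oscInt v (-ξ) := (integrable_oscInt hv hvc).comp_neg
    have hK1 := integrable_mul_of_tsupport hV hK hv hvc hvV
    have hl1 := integrable_mul_of_tsupport hU (contDiffOn_slice_snd hl hx₀) hv hvc hvφ
    simp only [sub_mul, one_mul]
    rw [oscInt_sub hi1 hi2, integral_sub hl1 hK1, ← e2, mul_sub]
    ring

end SymbolOfParametrix

/-! ### Universal symbols -/

section UniversalSymbols

/-- The symmetric part of a matrix. -/
def symPart (A : Fin n → Fin n → ℝ) : Fin n → Fin n → ℝ := fun i j => (A i j + A j i) / 2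

theorem contDiff_symPart : ContDiff ℝ ∞ (symPart (n := n)) :=
  contDiff_pi.2 fun i => contDiff_pi.2 fun j => by unfold symPart; fun_prop

theorem symPart_of_posDef {A : Fin n → Fin n → ℝ} (hA : A ∈ posDefMatrices n) : symPart A = A := by
  ext i j
  have h : (Matrix.of A).PosDef := hA
  have h1 : A j i = A i j := by simpa using h.1.apply i j
  simp only [symPart, h1]
  ring

/-- The matrices with positive definite symmetric part. -/
def posDefSymPart (n : ℕ) : Set (Fin n → Fin n → ℝ) := {A | symPart A ∈ posDefMatrices n}

theorem posDefMatrices_subset : posDefMatrices n ⊆ posDefSymPart n := fun A hA => by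
  rw [posDefSymPart, Set.mem_ofPred_eq, symPart_of_posDef hA]
  exact hA

/-- By homogeneity positivity need only be tested on the unit sphere, whose compactness gives
openness in `isOpen_posDefSymPart`. -/
theorem mem_posDefSymPart_iff {A : Fin n → Fin n → ℝ} : A ∈ posDefSymPart n ↔
    ∀ x ∈ Metric.sphere (0 : Fin n → ℝ) 1, 0 < ∑ i, ∑ j, x i * symPart A i j * x j := by
  have hdot : ∀ x : Fin n → ℝ, star x ⬝ᵥ ((Matrix.of (symPart A)).mulVec x) =
      ∑ i, ∑ j, x i * symPart A i j * x j := fun x => by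
    simp only [dotProduct, Matrix.mulVec, Finset.mul_sum, Matrix.of_apply, star_trivial, mul_assoc]
  have hherm : (Matrix.of (symPart A)).IsHermitian := by
    ext i j
    simp only [Matrix.conjTranspose_apply, Matrix.of_apply, symPart, star_trivial]
    ring
  have hmem : A ∈ posDefSymPart n ↔ (Matrix.of (symPart A)).PosDef := Iff.rfl
  rw [hmem, Matrix.posDef_iff_dotProduct_mulVec]
  refine ⟨fun h x hx => ?_, fun h => ⟨hherm, fun x hx => ?_⟩⟩
  · rw [← hdot]
    refine h.2 ?_
    rintro rfl
    simp at hx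
  · rw [hdot]
    have h1 := h (‖x‖⁻¹ • x) (by
      rw [mem_sphere_zero_iff_norm, norm_smul, norm_inv, norm_norm,
        inv_mul_cancel₀ (norm_ne_zero_iff.2 hx)])
    have h2 : ∑ i, ∑ j, (‖x‖⁻¹ • x) i * symPart A i j * (‖x‖⁻¹ • x) j =
        ‖x‖⁻¹ ^ 2 * ∑ i, ∑ j, x i * symPart A i j * x j := by
      simp only [Finset.mul_sum, Pi.smul_apply, smul_eq_mul]
      exact Finset.sum_congr rfl fun i _ => Finset.sum_congr rfl fun j _ => by ring
    rw [h2] at h1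
    exact pos_of_mul_pos_right h1 (by positivity)

theorem isOpen_posDefSymPart : IsOpen (posDefSymPart n) := by
  rw [isOpen_iff_mem_nhds]
  intro A hA
  have hc : Continuous fun q : (Fin n → Fin n → ℝ) × (Fin n → ℝ) =>
      ∑ i, ∑ j, q.2 i * symPart q.1 i j * q.2 j := by
    unfold symPart
    fun_prop
  have := (isCompact_sphere (0 : Fin n → ℝ) 1).eventually_forall_of_forall_eventually
    (x₀ := A) (P := fun A x => 0 < ∑ i, ∑ j, x i * symPart A i j * x j) fun x hx => by
      have h0 := mem_posDefSymPart_iff.1 hA x hx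
      exact (hc.continuousAt (x := (A, x))).eventually (lt_mem_nhds h0)
  filter_upwards [this] with B hB using mem_posDefSymPart_iff.2 hB

namespace IsUniversalSymbol

variable {μ ν : ℂ} {a b : (Fin n → Fin n → ℝ) → Eucl n → ℂ}

theorem zero (μ : ℂ) : IsUniversalSymbol n μ 0 where
  smooth := contDiffOn_const
  homogeneous _ _ _ _ _ _ := by simp

theorem one : IsUniversalSymbol n 0 fun _ _ => 1 where
  smooth := contDiffOn_const
  homogeneous _ _ _ _ _ _ := by simp

theorem add (ha : IsUniversalSymbol n μ a) (hb : IsUniversalSymbol n μ b) :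
    IsUniversalSymbol n μ (a + b) where
  smooth := ha.smooth.add hb.smooth
  homogeneous A hA ξ hξ t ht := by
    simp only [Pi.add_apply]
    rw [ha.homogeneous A hA ξ hξ t ht, hb.homogeneous A hA ξ hξ t ht, mul_add]

theorem const_mul (c : ℂ) (ha : IsUniversalSymbol n μ a) :
    IsUniversalSymbol n μ fun A ξ => c * a A ξ where
  smooth := contDiffOn_const.mul ha.smooth
  homogeneous A hA ξ hξ t ht := by rw [ha.homogeneous A hA ξ hξ t ht, mul_left_comm]

theorem mul (ha : IsUniversalSymbol n μ a) (hb : IsUniversalSymbol n ν b) :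
    IsUniversalSymbol n (μ + ν) fun A ξ => a A ξ * b A ξ where
  smooth := ha.smooth.mul hb.smooth
  homogeneous A hA ξ hξ t ht := by
    rw [ha.homogeneous A hA ξ hξ t ht, hb.homogeneous A hA ξ hξ t ht,
      Complex.cpow_add _ _ (by exact_mod_cast ht.ne')]
    ring

theorem inv (ha : IsUniversalSymbol n μ a)
    (h : ∀ A ∈ posDefMatrices n, ∀ ξ : Eucl n, ξ ≠ 0 → a A ξ ≠ 0) :
    IsUniversalSymbol n (-μ) fun A ξ => (a A ξ)⁻¹ where
  smooth := ha.smooth.inv fun q hq => h q.1 hq.1 q.2 hq.2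
  homogeneous A hA ξ hξ t ht := by
    rw [ha.homogeneous A hA ξ hξ t ht, Complex.cpow_neg, mul_inv]

/-- The positive definite matrices lie among the symmetric ones and need not be open among all
matrices. Precomposition with `symPart` extends the symbol to an open set, where `fderiv` can be
used, without changing it on positive definite matrices. -/
theorem contDiffOn_extension (ha : IsUniversalSymbol n μ a) :
    ContDiffOn ℝ ∞ (Function.uncurry fun A ξ => a (symPart A) ξ) (posDefSymPart n ×ˢ {0}ᶜ) :=
  ha.smooth.comp ((contDiff_symPart.comp contDiff_fst).prodMk contDiff_snd).contDiffOn
    fun _ hq => ⟨hq.1, hq.2⟩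

theorem pd_snd (ha : IsUniversalSymbol n μ a) (l : List (Fin n)) :
    IsUniversalSymbol n (μ - l.length) fun A ξ => pd l (a A) ξ where
  smooth := by
    have h1 := contDiffOn_pd_snd (isOpen_posDefSymPart.prod isOpen_compl_singleton)
      ha.contDiffOn_extension l
    refine (h1.mono (Set.prod_mono posDefMatrices_subset subset_rfl)).congr fun q hq => ?_
    simp only [Function.uncurry, symPart_of_posDef hq.1]
  homogeneous A hA ξ hξ t ht :=
    pd_homogeneous (ha.smooth.comp (contDiffOn_const.prodMk contDiffOn_id) fun _ hξ => ⟨hA, hξ⟩)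
      (ha.homogeneous A hA) l ξ hξ t ht

theorem contDiffOn_slice (ha : IsUniversalSymbol n μ a) {ξ : Eucl n} (hξ : ξ ≠ 0) :
    ContDiffOn ℝ ∞ (fun A => a (symPart A) ξ) (posDefSymPart n) :=
  ha.contDiffOn_extension.comp (contDiffOn_id.prodMk contDiffOn_const) fun _ hA => ⟨hA, hξ⟩

/-- Derivatives of universal symbols with respect to the matrix variable. -/
theorem fderiv_matrix (ha : IsUniversalSymbol n μ a) (H : Fin n → Fin n → ℝ) :
    IsUniversalSymbol n μ fun A ξ => fderiv ℝ (fun B => a (symPart B) ξ) A H where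
  smooth := by
    set Ω : Set ((Fin n → Fin n → ℝ) × Eucl n) := posDefSymPart n ×ˢ {0}ᶜ with hΩdef
    have hΩ : IsOpen Ω := isOpen_posDefSymPart.prod isOpen_compl_singleton
    have h1 : ContDiffOn ℝ ∞ (fun q => fderiv ℝ (Function.uncurry fun A ξ => a (symPart A) ξ) q
        (H, 0)) Ω :=
      (ha.contDiffOn_extension.fderiv_of_isOpen hΩ (m := ∞) le_rfl).clm_apply contDiffOn_const
    refine (h1.mono (Set.prod_mono posDefMatrices_subset subset_rfl)).congr fun q hq => ?_
    have hq' : q ∈ Ω := ⟨posDefMatrices_subset hq.1, hq.2⟩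
    have h2 : HasFDerivAt (Function.uncurry fun A ξ => a (symPart A) ξ)
        (fderiv ℝ (Function.uncurry fun A ξ => a (symPart A) ξ) q) (q.1, q.2) :=
      ((ha.contDiffOn_extension.contDiffAt (hΩ.mem_nhds hq')).differentiableAt
        (by simp)).hasFDerivAt
    have h3 := h2.comp q.1 (hasFDerivAt_prodMk_left (𝕜 := ℝ) q.1 q.2)
    have h4 := h3.fderiv
    change fderiv ℝ (fun B => a (symPart B) q.2) q.1 H = _
    rw [show (fun B => a (symPart B) q.2) = (Function.uncurry fun A ξ => a (symPart A) ξ) ∘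
      (fun B => (B, q.2)) from rfl, h4]
    simp
  homogeneous A hA ξ hξ t ht := by
    have hA' := posDefMatrices_subset hA
    have h1 : (fun B => a (symPart B) (t • ξ)) =ᶠ[𝓝 A]
        fun B => (t : ℂ) ^ μ * a (symPart B) ξ := by
      filter_upwards [isOpen_posDefSymPart.mem_nhds hA'] with B hB
        using ha.homogeneous _ hB ξ hξ t ht
    have h2 : DifferentiableAt ℝ (fun B => a (symPart B) ξ) A :=
      ((ha.contDiffOn_slice hξ).contDiffAt (isOpen_posDefSymPart.mem_nhds hA')).differentiableAt
        (by simp)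
    rw [h1.fderiv_eq, fderiv_const_mul h2]
    rfl

end IsUniversalSymbol

/-- `G` is a smooth function with values in the positive definite matrices on the open set `U`. -/
structure IsMetricOn (U : Set (Eucl n)) (G : Eucl n → Fin n → Fin n → ℝ) : Prop where
  isOpen : IsOpen U
  smooth : ContDiffOn ℝ ∞ G U
  posDef : ∀ x ∈ U, G x ∈ posDefMatrices n

theorem IsMetricOn.entry {U : Set (Eucl n)} {G : Eucl n → Fin n → Fin n → ℝ} (h : IsMetricOn U G)
    (k l : Fin n) : ContDiffOn ℝ ∞ (fun y => G y k l) U :=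
  contDiffOn_pi.1 (contDiffOn_pi.1 h.smooth k) l

theorem IsMetricOn.contDiffOn_jetMonomial {U : Set (Eucl n)} {G : Eucl n → Fin n → Fin n → ℝ}
    (h : IsMetricOn U G) (β : JetExponent n) : ContDiffOn ℝ ∞ (jetMonomial G β) U := by
  unfold jetMonomial Finsupp.prod
  exact contDiffOn_prod fun v _ => (contDiffOn_pd h.isOpen (h.entry _ _) _).pow _

theorem IsMetricOn.contDiffOn_ofReal_jetMonomial {U : Set (Eucl n)}
    {G : Eucl n → Fin n → Fin n → ℝ} (h : IsMetricOn U G) (β : JetExponent n) :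
    ContDiffOn ℝ ∞ (fun y => (jetMonomial G β y : ℂ)) U := by
  have h1 := h.contDiffOn_jetMonomial β
  exact Complex.ofRealCLM.contDiff.comp_contDiffOn (f := jetMonomial G β) h1

theorem IsMetricOn.contDiffOn_symbol {U : Set (Eucl n)} {G : Eucl n → Fin n → Fin n → ℝ}
    (h : IsMetricOn U G) {μ : ℂ} {b : (Fin n → Fin n → ℝ) → Eucl n → ℂ}
    (hb : IsUniversalSymbol n μ b) :
    ContDiffOn ℝ ∞ (Function.uncurry fun x ξ => b (G x) ξ) (U ×ˢ {0}ᶜ) :=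
  hb.smooth.comp ((h.smooth.comp contDiff_fst.contDiffOn fun _ hq => hq.1).prodMk
    contDiff_snd.contDiffOn) fun _ hq => ⟨h.posDef _ hq.1, hq.2⟩

theorem jetMonomial_zero (G : Eucl n → Fin n → Fin n → ℝ) : jetMonomial G 0 = fun _ => 1 := by
  ext x
  simp [jetMonomial]

theorem jetMonomial_add (G : Eucl n → Fin n → Fin n → ℝ) (β γ : JetExponent n) :
    jetMonomial G (β + γ) = fun x => jetMonomial G β x * jetMonomial G γ x := by
  ext x
  classical
  exact Finsupp.prod_add_index' (fun _ => pow_zero _) fun _ _ _ => pow_add _ _ _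

theorem jetMonomial_single (G : Eucl n → Fin n → Fin n → ℝ) (v : List (Fin n) × Fin n × Fin n)
    (k : ℕ) : jetMonomial G (Finsupp.single v k) =
      fun x => pd v.1 (fun y => G y v.2.1 v.2.2) x ^ k := by
  ext x
  exact Finsupp.prod_single_index (pow_zero _)

/-- Expressions in a metric `G` that are given by universal formulas, homogeneous of degree `μ`. -/
def IsUniv (μ : ℂ) (E : (Eucl n → Fin n → Fin n → ℝ) → Eucl n → Eucl n → ℂ) : Prop :=
  ∃ a : JetExponent n →₀ ((Fin n → Fin n → ℝ) → Eucl n → ℂ),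
    (∀ β, IsUniversalSymbol n μ (a β)) ∧ ∀ G U, IsMetricOn U G → ∀ x ∈ U, ∀ ξ : Eucl n, ξ ≠ 0 →
      E G x ξ = universalExpr a G x ξ

namespace IsUniv

variable {μ ν : ℂ} {E F : (Eucl n → Fin n → Fin n → ℝ) → Eucl n → Eucl n → ℂ}

theorem congr (hE : IsUniv μ E) (h : ∀ G U, IsMetricOn U G → ∀ x ∈ U, ∀ ξ : Eucl n, ξ ≠ 0 →
    F G x ξ = E G x ξ) : IsUniv μ F := by
  obtain ⟨a, ha, hE⟩ := hE
  exact ⟨a, ha, fun G U hG x hx ξ hξ => by rw [h G U hG x hx ξ hξ, hE G U hG x hx ξ hξ]⟩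

theorem zero (μ : ℂ) : IsUniv (n := n) μ fun _ _ _ => 0 :=
  ⟨0, fun _ => IsUniversalSymbol.zero μ, fun G U _ x _ ξ _ => by simp [universalExpr]⟩

theorem add (hE : IsUniv μ E) (hF : IsUniv μ F) : IsUniv μ fun G x ξ => E G x ξ + F G x ξ := by
  classical
  obtain ⟨a, ha, hE⟩ := hE
  obtain ⟨b, hb, hF⟩ := hF
  refine ⟨a + b, fun β => (ha β).add (hb β), fun G U hG x hx ξ hξ => ?_⟩
  beta_reduce
  rw [hE G U hG x hx ξ hξ, hF G U hG x hx ξ hξ]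
  refine (Finsupp.sum_add_index' (fun β => ?_) fun β b₁ b₂ => ?_).symm
  · simp
  · simp [mul_add]

theorem sum {ι : Type*} (s : Finset ι) {E : ι → (Eucl n → Fin n → Fin n → ℝ) → Eucl n → Eucl n → ℂ}
    (h : ∀ i ∈ s, IsUniv μ (E i)) : IsUniv μ fun G x ξ => ∑ i ∈ s, E i G x ξ := by
  classical
  induction s using Finset.induction_on with
  | empty => exact (zero μ).congr fun G U _ x _ ξ _ => Finset.sum_empty
  | insert i s hi ih =>
    refine ((h i (Finset.mem_insert_self i s)).add
      (ih fun j hj => h j (Finset.mem_insert_of_mem hj))).congr fun G U _ x _ ξ _ => ?_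
    rw [Finset.sum_insert hi]

theorem monomial (β : JetExponent n) {b : (Fin n → Fin n → ℝ) → Eucl n → ℂ}
    (hb : IsUniversalSymbol n μ b) : IsUniv μ fun G x ξ => (jetMonomial G β x : ℂ) * b (G x) ξ := by
  classical
  refine ⟨Finsupp.single β b, fun γ => ?_, fun G U hG x hx ξ hξ => ?_⟩
  · rw [Finsupp.single_apply]
    split_ifs
    · exact hb
    · exact IsUniversalSymbol.zero μ
  · exact (Finsupp.sum_single_index
      (h := fun β (b : (Fin n → Fin n → ℝ) → Eucl n → ℂ) => (jetMonomial G β x : ℂ) * b (G x) ξ)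
      (mul_zero _)).symm

theorem of_symbol {b : (Fin n → Fin n → ℝ) → Eucl n → ℂ} (hb : IsUniversalSymbol n μ b) :
    IsUniv μ fun G x ξ => b (G x) ξ :=
  (monomial 0 hb).congr fun G U _ x _ ξ _ => by
    rw [jetMonomial_zero, Complex.ofReal_one, one_mul]

/-- Jet monomials multiply by adding exponents, and their coefficients multiply in degree `μ + ν`.
-/
theorem mul (hE : IsUniv μ E) (hF : IsUniv ν F) :
    IsUniv (μ + ν) fun G x ξ => E G x ξ * F G x ξ := by
  obtain ⟨a, ha, hE⟩ := hE
  obtain ⟨b, hb, hF⟩ := hF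
  refine (sum a.support fun β _ => sum b.support fun γ _ =>
    monomial (β + γ) ((ha β).mul (hb γ))).congr fun G U hG x hx ξ hξ => ?_
  rw [hE G U hG x hx ξ hξ, hF G U hG x hx ξ hξ, universalExpr, universalExpr, Finsupp.sum,
    Finsupp.sum, Finset.sum_mul_sum]
  refine Finset.sum_congr rfl fun β _ => Finset.sum_congr rfl fun γ _ => ?_
  rw [jetMonomial_add]
  push_cast
  ring

theorem const_mul (c : ℂ) (hE : IsUniv μ E) : IsUniv μ fun G x ξ => c * E G x ξ := by
  have h := (of_symbol (IsUniversalSymbol.one.const_mul c)).mul hE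
  rw [zero_add] at h
  simpa using h

/-- Closure properties may be checked on monomials. -/
theorem of_monomials {D : ((Eucl n → Fin n → Fin n → ℝ) → Eucl n → Eucl n → ℂ) →
      (Eucl n → Fin n → Fin n → ℝ) → Eucl n → Eucl n → ℂ} (hE : IsUniv μ E)
    (hcongr : ∀ E F G U, IsMetricOn U G → (∀ x ∈ U, ∀ ξ : Eucl n, ξ ≠ 0 → E G x ξ = F G x ξ) →
      ∀ x ∈ U, ∀ ξ : Eucl n, ξ ≠ 0 → D E G x ξ = D F G x ξ)
    (hsum : ∀ (s : Finset (JetExponent n))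
      (b : JetExponent n → (Fin n → Fin n → ℝ) → Eucl n → ℂ),
      (∀ β, IsUniversalSymbol n μ (b β)) → ∀ G U, IsMetricOn U G → ∀ x ∈ U, ∀ ξ : Eucl n, ξ ≠ 0 →
        D (fun G x ξ => ∑ β ∈ s, (jetMonomial G β x : ℂ) * b β (G x) ξ) G x ξ =
          ∑ β ∈ s, D (fun G x ξ => (jetMonomial G β x : ℂ) * b β (G x) ξ) G x ξ)
    (hD : ∀ β b, IsUniversalSymbol n μ b →
      IsUniv ν (D fun G x ξ => (jetMonomial G β x : ℂ) * b (G x) ξ)) : IsUniv ν (D E) := by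
  obtain ⟨a, ha, hE⟩ := hE
  refine (sum a.support fun β _ => hD β (a β) (ha β)).congr fun G U hG x hx ξ hξ => ?_
  rw [← hsum a.support a ha G U hG x hx ξ hξ]
  exact hcongr _ _ G U hG (fun x hx ξ hξ => hE G U hG x hx ξ hξ) x hx ξ hξ

/-- The jet monomials do not depend on `ξ`, so only the coefficients are differentiated. -/
theorem pd_snd (hE : IsUniv μ E) (l : List (Fin n)) :
    IsUniv (μ - l.length) fun G x ξ => pd l (E G x) ξ := by
  have ho : IsOpen ({0}ᶜ : Set (Eucl n)) := isOpen_compl_singleton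
  have hs : ∀ {b : (Fin n → Fin n → ℝ) → Eucl n → ℂ}, IsUniversalSymbol n μ b →
      ∀ {G U}, IsMetricOn U G → ∀ {x}, x ∈ U → ContDiffOn ℝ ∞ (b (G x)) {0}ᶜ :=
    fun hb _ _ hG x hx => contDiffOn_slice_snd (hG.contDiffOn_symbol hb) hx
  refine of_monomials (D := fun E G x ξ => pd l (E G x) ξ) hE ?_ ?_ ?_
  · intro E F G U _ h x hx ξ hξ
    exact pd_congr ho (fun ζ hζ => h x hx ζ hζ) l hξ
  · intro s b hb G U hG x hx ξ hξ
    exact pd_sum ho s (fun β _ => contDiffOn_const.mul (hs (hb β) hG hx)) l hξ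
  · intro β b hb
    refine (monomial β (hb.pd_snd l)).congr fun G U hG x hx ξ hξ => ?_
    exact pd_const_mul ho (hs hb hG hx) _ l hξ

theorem pd_singleton_mul {U : Set (Eucl n)} (hU : IsOpen U) {f g : Eucl n → ℂ}
    (hf : ContDiffOn ℝ ∞ f U) (hg : ContDiffOn ℝ ∞ g U) (i : Fin n) {x : Eucl n} (hx : x ∈ U) :
    pd [i] (fun y => f y * g y) x = pd [i] f x * g x + f x * pd [i] g x := by
  have h1 := (hf.contDiffAt (hU.mem_nhds hx)).differentiableAt (by simp)
  have h2 := (hg.contDiffAt (hU.mem_nhds hx)).differentiableAt (by simp)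
  simp only [pd]
  rw [fderiv_fun_mul h1 h2]
  simp only [_root_.add_apply, _root_.smul_apply, smul_eq_mul]
  ring

/-- Induction on the exponent: sums of exponents are handled by the Leibniz rule, a power of one jet
variable by the power rule. -/
theorem pd_jetMonomial (i : Fin n) (β : JetExponent n) {b : (Fin n → Fin n → ℝ) → Eucl n → ℂ}
    (hb : IsUniversalSymbol n μ b) :
    IsUniv μ fun G x ξ => pd [i] (fun y => (jetMonomial G β y : ℂ)) x * b (G x) ξ := by
  induction β using Finsupp.induction_linear with
  | zero =>
    refine (zero μ).congr fun G U _ x _ ξ _ => ?_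
    simp only [jetMonomial_zero]
    rw [pd_const_cons, zero_mul]
  | add β γ hβ hγ =>
    have h1 := (hβ.mul (monomial γ IsUniversalSymbol.one)).add
      (hγ.mul (monomial β IsUniversalSymbol.one))
    rw [add_zero] at h1
    refine h1.congr fun G U hG x hx ξ _ => ?_
    simp only [jetMonomial_add, Complex.ofReal_mul]
    rw [pd_singleton_mul hG.isOpen (hG.contDiffOn_ofReal_jetMonomial β)
      (hG.contDiffOn_ofReal_jetMonomial γ) i hx]
    ring
  | single v k =>
    -- One factor `∂^α g` is replaced by `∂_i ∂^α g`, the variable with index list `i :: v.1`.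
    -- Truncation of `k - 1` at `k = 0` is harmless because the coefficient is `k`.
    refine (monomial (Finsupp.single v (k - 1) + Finsupp.single (i :: v.1, v.2) 1)
      (hb.const_mul k)).congr fun G U hG x hx ξ _ => ?_
    simp only [jetMonomial_add, jetMonomial_single, pow_one]
    set f := pd v.1 fun y => G y v.2.1 v.2.2 with hf
    have hd : DifferentiableAt ℝ f x := ((contDiffOn_pd hG.isOpen (hG.entry _ _) _).contDiffAt
      (hG.isOpen.mem_nhds hx)).differentiableAt (by simp)
    have h1 : HasFDerivAt (fun y => ((f y ^ k : ℝ) : ℂ)) _ x :=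
      Complex.ofRealCLM.hasFDerivAt.comp x (hd.hasFDerivAt.pow k)
    have h2 : pd [i] (fun y => ((f y ^ k : ℝ) : ℂ)) x =
        ((k * f x ^ (k - 1) * fderiv ℝ f x (stdVec i) : ℝ) : ℂ) := by
      simp only [pd]
      rw [h1.fderiv]
      simp
    rw [h2, pd_cons]
    push_cast
    ring

theorem matrix_eq_sum (H : Fin n → Fin n → ℝ) :
    H = ∑ k, ∑ l, H k l • (Pi.single k (Pi.single l 1) : Fin n → Fin n → ℝ) := by
  ext i j
  simp [Finset.sum_apply, Pi.single_apply, Finset.sum_ite_eq, apply_ite, ite_apply]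

/-- Chain rule: the first derivatives of the metric entries appear as new monomials, and their
coefficients, the matrix derivatives of `b`, are again universal symbols. -/
theorem pd_symbol (i : Fin n) {b : (Fin n → Fin n → ℝ) → Eucl n → ℂ}
    (hb : IsUniversalSymbol n μ b) : IsUniv μ fun G x ξ => pd [i] (fun y => b (G y) ξ) x := by
  refine (sum Finset.univ fun k _ => sum Finset.univ fun l _ =>
    monomial (Finsupp.single ([i], k, l) 1)
      (hb.fderiv_matrix (Pi.single k (Pi.single l 1)))).congr fun G U hG x hx ξ hξ => ?_
  have hGx : DifferentiableAt ℝ G x := (hG.smooth.contDiffAt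
    (hG.isOpen.mem_nhds hx)).differentiableAt (by simp)
  have hbx : DifferentiableAt ℝ (fun B => b (symPart B) ξ) (G x) :=
    ((hb.contDiffOn_slice hξ).contDiffAt (isOpen_posDefSymPart.mem_nhds
      (posDefMatrices_subset (hG.posDef x hx)))).differentiableAt (by simp)
  have h1 : (fun y => b (G y) ξ) =ᶠ[𝓝 x] (fun B => b (symPart B) ξ) ∘ G := by
    filter_upwards [hG.isOpen.mem_nhds hx] with y hy
    simp only [Function.comp, symPart_of_posDef (hG.posDef y hy)]
  have h2 : ∀ k l, fderiv ℝ G x (stdVec i) k l = pd [i] (fun y => G y k l) x := fun k l => by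
    simp only [pd]
    have h3 : HasFDerivAt (fun y => G y k l) _ x :=
      (((ContinuousLinearMap.proj (R := ℝ) (φ := fun _ : Fin n => ℝ) l).comp
        (ContinuousLinearMap.proj (R := ℝ) (φ := fun _ : Fin n => Fin n → ℝ) k)).hasFDerivAt
          (x := G x)).comp x hGx.hasFDerivAt
    rw [h3.fderiv]
    rfl
  have h4 : pd [i] (fun y => b (G y) ξ) x =
      fderiv ℝ (fun B => b (symPart B) ξ) (G x) (fderiv ℝ G x (stdVec i)) := by
    simp only [pd]
    rw [h1.fderiv_eq, fderiv_comp x hbx hGx]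
    rfl
  rw [h4, matrix_eq_sum (fderiv ℝ G x (stdVec i))]
  simp only [map_sum, map_smul, h2, jetMonomial_single, pow_one, Complex.real_smul]

theorem pd_fst_singleton (hE : IsUniv μ E) (i : Fin n) :
    IsUniv μ fun G x ξ => pd [i] (fun y => E G y ξ) x := by
  refine of_monomials (D := fun E G x ξ => pd [i] (fun y => E G y ξ) x) hE ?_ ?_ ?_
  · intro E F G U hG h x hx ξ hξ
    exact pd_congr hG.isOpen (fun y hy => h y hy ξ hξ) [i] hx
  · intro s b hb G U hG x hx ξ hξ
    exact pd_sum hG.isOpen s (fun β _ => (hG.contDiffOn_ofReal_jetMonomial β).mul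
      (contDiffOn_slice_fst (hG.contDiffOn_symbol (hb β)) hξ)) [i] hx
  · intro β b hb
    have h1 := (monomial β IsUniversalSymbol.one).mul (pd_symbol i hb)
    rw [zero_add] at h1
    refine ((pd_jetMonomial i β hb).add h1).congr fun G U hG x hx ξ hξ => ?_
    rw [pd_singleton_mul hG.isOpen (hG.contDiffOn_ofReal_jetMonomial β)
      (contDiffOn_slice_fst (hG.contDiffOn_symbol hb) hξ) i hx, mul_one]

theorem pd_fst (hE : IsUniv μ E) (l : List (Fin n)) :
    IsUniv μ fun G x ξ => pd l (fun y => E G y ξ) x := by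
  induction l with
  | nil => exact hE
  | cons i l ih => exact ih.pd_fst_singleton i

/-- The formal product uses only sums, products, constants and derivatives, under all of which
universality is preserved; what remains is the count of degrees. -/
theorem symProd {σ τ : ℕ → (Eucl n → Fin n → Fin n → ℝ) → Eucl n → Eucl n → ℂ} {m m' : ℂ}
    (hσ : ∀ k : ℕ, IsUniv (m - k) (σ k)) (hτ : ∀ k : ℕ, IsUniv (m' - k) (τ k)) (j : ℕ) :
    IsUniv (m + m' - j) fun G => InvPsiDO.symProd (fun k => σ k G) (fun k => τ k G) j := by
  refine sum _ fun r hr => const_mul _ (sum _ fun J _ => sum _ fun k hk => ?_)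
  have h1 := ((hσ k).pd_snd (List.ofFn J)).mul
    (((hτ (j - r - k)).pd_fst (List.ofFn J)).const_mul ((-Complex.I) ^ r))
  have h2 : m - k - (List.ofFn J).length + (m' - (j - r - k : ℕ)) = m + m' - j := by
    have h3 : (j : ℂ) = ((r + k + (j - r - k) : ℕ) : ℂ) := by
      congr 1
      have := Finset.mem_range.1 hr
      have := Finset.mem_range.1 hk
      omega
    rw [h3, List.length_ofFn]
    push_cast
    have h4 : ((r + k + (j - r - k) - r - k : ℕ) : ℂ) = ((j - r - k : ℕ) : ℂ) := by
      congr 1; omega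
    ring_nf
  rw [h2] at h1
  exact h1

end IsUniv

end UniversalSymbols

/-! ### Formal inverses -/

section FormalInverses

variable {σ σ' τ τ' : ℕ → Eucl n → Eucl n → ℂ} {U : Set (Eucl n)}

/-- Derivatives are taken on open sets, so agreement on `U` and for `ξ ≠ 0` suffices; and component
`j` involves no `τ i` with `i > j`, which is what the recursion uses. -/
theorem symProd_congr (hU : IsOpen U) (hσ : ∀ j, ∀ x ∈ U, ∀ ξ, ξ ≠ 0 → σ j x ξ = σ' j x ξ)
    {j : ℕ} (hτ : ∀ i ≤ j, ∀ x ∈ U, ∀ ξ, ξ ≠ 0 → τ i x ξ = τ' i x ξ) {x : Eucl n} (hx : x ∈ U)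
    {ξ : Eucl n} (hξ : ξ ≠ 0) : symProd σ τ j x ξ = symProd σ' τ' j x ξ := by
  have ho : IsOpen ({0}ᶜ : Set (Eucl n)) := isOpen_compl_singleton
  simp only [symProd, prodTerm]
  refine Finset.sum_congr rfl fun r _ => ?_
  congr 1
  refine Finset.sum_congr rfl fun J _ => Finset.sum_congr rfl fun k _ => ?_
  rw [pd_congr ho (fun ζ hζ => hσ k x hx ζ hζ) _ hξ,
    pd_congr hU (fun y hy => hτ (j - r - k) (by omega) y hy ξ hξ) _ hx]

/-- A derivative, or a component of `σ` other than `σ 0`, uses up part of the total index `j`, so `τ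
j` meets only the undifferentiated `σ 0`. The rest is the product with `τ` truncated below `j`. -/
theorem symProd_eq_add (σ τ : ℕ → Eucl n → Eucl n → ℂ) (j : ℕ) (x ξ : Eucl n) :
    symProd σ τ j x ξ =
      σ 0 x ξ * τ j x ξ + symProd σ (fun i => if i < j then τ i else 0) j x ξ := by
  have h1 : ∀ r ∈ Finset.range j, prodTerm σ τ (r + 1) (j - (r + 1)) x ξ =
      prodTerm σ (fun i => if i < j then τ i else 0) (r + 1) (j - (r + 1)) x ξ := by
    intro r hr
    have := Finset.mem_range.1 hr
    simp only [prodTerm]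
    congr 1
    refine Finset.sum_congr rfl fun J _ => Finset.sum_congr rfl fun k _ => ?_
    rw [if_pos (by omega)]
  have h2 : ∀ τ : ℕ → Eucl n → Eucl n → ℂ, prodTerm σ τ 0 (j - 0) x ξ =
      ∑ k ∈ Finset.range j, σ (k + 1) x ξ * τ (j - (k + 1)) x ξ + σ 0 x ξ * τ j x ξ := by
    intro τ
    simp [prodTerm, pd, Finset.sum_range_succ']
  have h3 : ∀ k ∈ Finset.range j, σ (k + 1) x ξ * τ (j - (k + 1)) x ξ =
      σ (k + 1) x ξ * (if j - (k + 1) < j then τ (j - (k + 1)) else 0) x ξ := by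
    intro k hk
    have := Finset.mem_range.1 hk
    rw [if_pos (by omega)]
  rw [symProd, symProd, Finset.sum_range_succ', Finset.sum_range_succ', h2, h2,
    Finset.sum_congr rfl h1, Finset.sum_congr rfl h3, if_neg (lt_irrefl j)]
  simp only [Pi.zero_apply, mul_zero, add_zero]
  ring

/-- Uniqueness in the recursion: when all earlier components agree, the remaining identity is `σ 0 *
τ j = σ 0 * τ' j`, and `σ 0` can be cancelled. -/
theorem symProd_right_unique (hU : IsOpen U) (h0 : ∀ x ∈ U, ∀ ξ, ξ ≠ 0 → σ 0 x ξ ≠ 0)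
    (h : ∀ j, ∀ x ∈ U, ∀ ξ, ξ ≠ 0 → symProd σ τ j x ξ = symProd σ τ' j x ξ) (j : ℕ) :
    ∀ x ∈ U, ∀ ξ, ξ ≠ 0 → τ j x ξ = τ' j x ξ := by
  induction j using Nat.strong_induction_on with
  | _ j ih =>
    intro x hx ξ hξ
    have h1 := h j x hx ξ hξ
    rw [symProd_eq_add σ τ, symProd_eq_add σ τ', symProd_congr (σ' := σ)
      (τ' := fun i => if i < j then τ' i else 0) hU (fun _ _ _ _ _ => rfl) (fun i _ y hy ζ hζ => by
        split_ifs with hi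
        · exact ih i hi y hy ζ hζ
        · rfl) hx hξ] at h1
    exact mul_left_cancel₀ (h0 x hx ξ hξ) (add_right_cancel h1)

theorem symProd_const_mul_left {m : ℂ} (hσ : ∀ j : ℕ, IsHomogeneousSymbol U (m - j) (σ j))
    (c : ℂ) (j : ℕ) {x : Eucl n} (hx : x ∈ U) {ξ : Eucl n} (hξ : ξ ≠ 0) :
    symProd (fun k x ξ => c * σ k x ξ) τ j x ξ = c * symProd σ τ j x ξ := by
  have ho : IsOpen ({0}ᶜ : Set (Eucl n)) := isOpen_compl_singleton
  simp only [symProd, prodTerm, Finset.mul_sum]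
  refine Finset.sum_congr rfl fun r _ => Finset.sum_congr rfl fun J _ =>
    Finset.sum_congr rfl fun k _ => ?_
  rw [pd_const_mul ho (contDiffOn_slice_snd (hσ k).smooth hx) c _ hξ]
  ring

theorem symProd_const_mul_right (hU : IsOpen U) {m : ℂ}
    (hτ : ∀ j : ℕ, IsHomogeneousSymbol U (m - j) (τ j))
    (c : ℂ) (j : ℕ) {x : Eucl n} (hx : x ∈ U) {ξ : Eucl n} (hξ : ξ ≠ 0) :
    symProd σ (fun k x ξ => c * τ k x ξ) j x ξ = c * symProd σ τ j x ξ := by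
  simp only [symProd, prodTerm, Finset.mul_sum]
  refine Finset.sum_congr rfl fun r _ => Finset.sum_congr rfl fun J _ =>
    Finset.sum_congr rfl fun k _ => ?_
  rw [pd_const_mul hU (contDiffOn_slice_fst (hτ _).smooth hξ) c _ hx]
  ring

theorem isUniv_universalExpr {μ : ℂ} {a : JetExponent n →₀ ((Fin n → Fin n → ℝ) → Eucl n → ℂ)}
    (ha : ∀ β, IsUniversalSymbol n μ (a β)) : IsUniv μ (universalExpr a) :=
  ⟨a, ha, fun _ _ _ _ _ _ _ => rfl⟩

/-- The formal inverse of a universal symbol with admissible, nonvanishing principal part is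
universal. -/
theorem exists_universal_inverse {m : ℂ}
    {s : ℕ → (Eucl n → Fin n → Fin n → ℝ) → Eucl n → Eucl n → ℂ}
    (hs : ∀ k : ℕ, IsUniv (m - k) (s k)) {a : (Fin n → Fin n → ℝ) → Eucl n → ℂ}
    (ha : IsUniversalSymbol n m a)
    (ha0 : ∀ A ∈ posDefMatrices n, ∀ ξ : Eucl n, ξ ≠ 0 → a A ξ ≠ 0)
    (hs0 : ∀ G x ξ, s 0 G x ξ = a (G x) ξ) :
    ∃ b : ℕ → JetExponent n →₀ ((Fin n → Fin n → ℝ) → Eucl n → ℂ),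
      (∀ (j : ℕ) (β : JetExponent n), IsUniversalSymbol n (-m - j) (b j β)) ∧
      ∀ G U, IsMetricOn U G → ∀ τ : ℕ → Eucl n → Eucl n → ℂ,
        (∀ j, ∀ x ∈ U, ∀ ξ, ξ ≠ 0 →
          symProd (fun k => s k G) τ j x ξ = if j = 0 then 1 else 0) →
        ∀ j, ∀ x ∈ U, ∀ ξ, ξ ≠ 0 → τ j x ξ = universalExpr (b j) G x ξ := by
  have key : ∀ j : ℕ, ∃ b : JetExponent n →₀ ((Fin n → Fin n → ℝ) → Eucl n → ℂ),
      (∀ β : JetExponent n, IsUniversalSymbol n (-m - j) (b β)) ∧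
      ∀ G U, IsMetricOn U G → ∀ τ : ℕ → Eucl n → Eucl n → ℂ,
        (∀ j, ∀ x ∈ U, ∀ ξ, ξ ≠ 0 →
          symProd (fun k => s k G) τ j x ξ = if j = 0 then 1 else 0) →
        ∀ x ∈ U, ∀ ξ, ξ ≠ 0 → τ j x ξ = universalExpr b G x ξ := by
    intro j
    induction j using Nat.strong_induction_on with
    | _ j ih =>
      choose! b hb hbτ using ih
      -- The formulas already found below `j`, extended by zero, stand for the truncated inverse in
      -- the recursion.
      have ht : ∀ i : ℕ, IsUniv (-m - i) fun G => if i < j then universalExpr (b i) G else 0 := by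
        intro i
        split_ifs with hi
        · exact isUniv_universalExpr (hb i hi)
        · exact IsUniv.zero _
      have h1 := (IsUniv.symProd hs ht j).const_mul (-1)
      have h2 : IsUniv (n := n) (m + -m - j) fun _ _ _ => if j = 0 then 1 else 0 := by
        split_ifs with hj
        · have := IsUniv.of_symbol (IsUniversalSymbol.one (n := n))
          simpa [hj] using this
        · exact IsUniv.zero _
      -- The solution `σ₀⁻¹ (δ_{j0} - truncated product)`. Admissibility is decisive here: `σ₀⁻¹` is
      -- the universal symbol `a⁻¹`, without derivatives of the metric.
      have h3 := (IsUniv.of_symbol (ha.inv ha0)).mul (h2.add h1)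
      have h4 : -m + (m + -m - j) = -m - j := by ring
      rw [h4] at h3
      obtain ⟨c, hc, hcE⟩ := h3
      refine ⟨c, hc, fun G U hG τ hτ x hx ξ hξ => ?_⟩
      rw [← hcE G U hG x hx ξ hξ]
      have h5 := hτ j x hx ξ hξ
      rw [symProd_eq_add, symProd_congr (σ' := fun k => s k G)
        (τ' := fun i => if i < j then universalExpr (b i) G else 0) hG.isOpen
        (fun _ _ _ _ _ => rfl) (fun i _ y hy ζ hζ => by
          split_ifs with hi
          · exact hbτ i hi G U hG τ hτ y hy ζ hζ
          · rfl) hx hξ, hs0] at h5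
      have h6 := ha0 _ (hG.posDef x hx) ξ hξ
      rw [← h5]
      field_simp
      ring
  choose b hb hbτ using key
  exact ⟨b, hb, fun G U hG τ hτ j => hbτ j G U hG τ hτ⟩

end FormalInverses

/-! ### Metrics in local coordinates -/

section MetricCoordinates

variable {M : SmoothMfd.{u} n} {φ : OpenPartialHomeomorph M (Eucl n)}

theorem bilinear_sum_sum {E : Type*} [AddCommGroup E] [Module ℝ E] [TopologicalSpace E]
    (B : E →L[ℝ] E →L[ℝ] ℝ) (v : Fin n → ℝ) (e : Fin n → E) :
    B (∑ i, v i • e i) (∑ i, v i • e i) = ∑ i, ∑ j, v i * v j * B (e i) (e j) := by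
  simp only [map_sum, map_smul, _root_.sum_apply, _root_.smul_apply, smul_eq_mul, Finset.mul_sum]
  rw [Finset.sum_comm]
  exact Finset.sum_congr rfl fun i _ => Finset.sum_congr rfl fun j _ => by ring

/-- The tangent map of `φ.symm` is smooth and is composed with a constant section. -/
theorem IsLocalCoord.contMDiffOn_mfderiv_symm (hφ : IsLocalCoord M φ) (v : Eucl n) :
    ContMDiffOn (𝓡 n) (𝓡 n).tangent ∞
      (fun x => (TotalSpace.mk' (Eucl n) (φ.symm x) (mfderiv (𝓡 n) (𝓡 n) φ.symm x v) :
        TangentBundle (𝓡 n) M)) φ.target := by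
  have hU := φ.open_target
  have h1 := hφ.contMDiffOn_symm.contMDiffOn_tangentMapWithin (m := ∞) le_rfl hU.uniqueMDiffOn
  have h2 : ContMDiff (𝓡 n) (𝓡 n).tangent ∞
      (fun x : Eucl n => (⟨x, v⟩ : TangentBundle (𝓡 n) (Eucl n))) :=
    contMDiff_vectorSpace_iff_contDiff (V := fun _ : Eucl n => v) |>.2 contDiff_const
  refine (h1.comp h2.contMDiffOn fun x hx => hx).congr fun x hx => ?_
  simp only [Function.comp, tangentMapWithin, mfderivWithin_of_isOpen hU hx]

theorem IsLocalCoord.contDiffOn_metricCoord (hφ : IsLocalCoord M φ) (g : RiemMetric M)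
    (i j : Fin n) : ContDiffOn ℝ ∞ (fun x => metricCoord g φ x i j) φ.target := by
  rw [← contMDiffOn_iff_contDiffOn]
  have h1 := g.contMDiff.comp_contMDiffOn hφ.contMDiffOn_symm
  have h2 : ContMDiffOn (𝓡 n) ((𝓡 n).prod 𝓘(ℝ)) ∞
      (fun x => TotalSpace.mk' ℝ (E := Bundle.Trivial M ℝ) (φ.symm x)
        (g.inner (φ.symm x) (mfderiv (𝓡 n) (𝓡 n) φ.symm x (EuclideanSpace.single i 1))
        (mfderiv (𝓡 n) (𝓡 n) φ.symm x (EuclideanSpace.single j 1)))) φ.target := by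
    apply ContMDiffOn.clm_bundle_apply₂ (F₁ := Eucl n) (F₂ := Eucl n)
    · exact h1
    · exact hφ.contMDiffOn_mfderiv_symm _
    · exact hφ.contMDiffOn_mfderiv_symm _
  intro x hx
  have h3 := h2 x hx
  simp only [contMDiffWithinAt_totalSpace] at h3
  exact h3.2

/-- The quadratic form at `v` is the metric on `D V`, where `D` is the differential of `φ.symm`. By
the chain rule the differential of `φ` is a left inverse of `D`, so `D V ≠ 0` and positivity carries
over. -/
theorem IsLocalCoord.isMetricOn (hφ : IsLocalCoord M φ) (g : RiemMetric M) :
    IsMetricOn φ.target (metricCoord g φ) where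
  isOpen := φ.open_target
  smooth := contDiffOn_pi.2 fun i => contDiffOn_pi.2 fun j => hφ.contDiffOn_metricCoord g i j
  posDef x hx := by
    refine Matrix.PosDef.of_dotProduct_mulVec_pos ?_ fun v hv => ?_
    · ext i j
      exact g.symm _ _ _
    · set D := mfderiv (𝓡 n) (𝓡 n) φ.symm x with hD
      set V : Eucl n := WithLp.toLp 2 v with hV
      have hV0 : V ≠ 0 := fun h => hv (by simpa [hV] using congrArg WithLp.ofLp h)
      have hDV : D V = ∑ i, v i • D (EuclideanSpace.single i 1) := by
        conv_lhs => rw [← sum_coord_smul_stdVec V]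
        exact (map_sum D _ _).trans (Finset.sum_congr rfl fun i _ => map_smul D _ _)
      have h1 : star v ⬝ᵥ ((Matrix.of (metricCoord g φ x)).mulVec v) =
          g.inner (φ.symm x) (D V) (D V) := by
        rw [hDV, bilinear_sum_sum]
        simp only [dotProduct, Matrix.mulVec, Finset.mul_sum, star_trivial]
        exact Finset.sum_congr rfl fun i _ => Finset.sum_congr rfl fun j _ => by
          rw [mul_assoc, mul_comm (v j)]; rfl
      rw [h1]
      refine g.pos _ _ fun h => hV0 ?_
      have h2 : MDifferentiableAt (𝓡 n) (𝓡 n) φ.symm x :=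
        (hφ.contMDiffOn_symm.contMDiffAt (φ.open_target.mem_nhds hx)).mdifferentiableAt (by simp)
      have h3 : MDifferentiableAt (𝓡 n) (𝓡 n) φ (φ.symm x) :=
        (hφ.contMDiffOn.contMDiffAt (φ.open_source.mem_nhds (φ.map_target hx))).mdifferentiableAt
          (by simp)
      have h4 : mfderiv (𝓡 n) (𝓡 n) (φ ∘ φ.symm) x = ContinuousLinearMap.id ℝ (Eucl n) := by
        rw [Filter.EventuallyEq.mfderiv_eq (f₁ := φ ∘ φ.symm) (f := id), mfderiv_id]
        · rfl
        · filter_upwards [φ.open_target.mem_nhds hx] with y hy using φ.right_inv hy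
      have h5 := mfderiv_comp x h3 h2
      rw [h4] at h5
      have h6 : V = mfderiv (𝓡 n) (𝓡 n) φ (φ.symm x) (D V) := by
        conv_lhs => rw [← ContinuousLinearMap.id_apply (R₁ := ℝ) V, h5]
        rfl
      rw [h6, h]
      exact map_zero _

end MetricCoordinates

/-! ### Constant metrics on Euclidean space -/

section FlatMetrics

/-- `ℝⁿ` as a manifold, in an arbitrary universe. -/
def flatMfd (n : ℕ) : SmoothMfd.{u} n :=
  letI : ChartedSpace (Eucl n) (ULift.{u} (Eucl n)) :=
    (Homeomorph.ulift.toOpenPartialHomeomorph).singletonChartedSpace rfl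
  { carrier := ULift.{u} (Eucl n)
    isManifold := (Homeomorph.ulift.toOpenPartialHomeomorph).isManifold_singleton rfl }

/-- The global coordinates on `ℝⁿ`. -/
def flatCoord (n : ℕ) : OpenPartialHomeomorph (flatMfd.{u} n) (Eucl n) :=
  Homeomorph.ulift.toOpenPartialHomeomorph

theorem isLocalCoord_flatCoord : IsLocalCoord (flatMfd.{u} n) (flatCoord n) :=
  isLocalCoord_chartAt (M := flatMfd n) (ULift.up 0)

theorem mfderiv_flatCoord_symm (x v : Eucl n) :
    mfderiv (𝓡 n) (𝓡 n) (flatCoord.{u} n).symm x v = v := by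
  have h1 : MDifferentiableAt (𝓡 n) (𝓡 n) (flatCoord.{u} n).symm x :=
    ((isLocalCoord_flatCoord.contMDiffOn_symm).contMDiffAt (Filter.univ_mem)).mdifferentiableAt
      (by simp)
  rw [h1.mfderiv]
  have h2 : writtenInExtChartAt (𝓡 n) (𝓡 n) x (flatCoord.{u} n).symm = id := rfl
  rw [h2]
  have h3 : fderivWithin ℝ (id : Eucl n → Eucl n) (Set.range (𝓡 n)) (extChartAt (𝓡 n) x x) =
      ContinuousLinearMap.id ℝ (Eucl n) := by simp
  exact DFunLike.congr_fun h3 v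

/-- The bilinear form with matrix `A`. -/
def matrixForm (A : Fin n → Fin n → ℝ) : Eucl n →L[ℝ] Eucl n →L[ℝ] ℝ :=
  ∑ k, ∑ l, A k l • (EuclideanSpace.proj k : Eucl n →L[ℝ] ℝ).smulRight
    (EuclideanSpace.proj l : Eucl n →L[ℝ] ℝ)

theorem matrixForm_apply (A : Fin n → Fin n → ℝ) (v w : Eucl n) :
    matrixForm A v w = ∑ k, ∑ l, A k l * (v k * w l) := by
  simp [matrixForm, _root_.sum_apply]

theorem matrixForm_single (A : Fin n → Fin n → ℝ) (i j : Fin n) :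
    matrixForm A (EuclideanSpace.single i 1) (EuclideanSpace.single j 1) = A i j := by
  simp [matrixForm_apply]

/-- With a single chart, the coordinate change of the tangent bundle is that of the chart with
itself, the identity. -/
theorem symmL_flatMfd (x y : flatMfd.{u} n) (v : Eucl n) :
    (trivializationAt (Eucl n) (TangentSpace (𝓡 n)) x).symmL ℝ y v = v := by
  rw [TangentBundle.symmL_trivializationAt_eq_core (by trivial)]
  exact (tangentBundleCore (𝓡 n) (flatMfd n)).coordChange_self (achart (Eucl n) x) y trivial v

theorem matrixForm_symm {A : Fin n → Fin n → ℝ} (hA : A ∈ posDefMatrices n) (v w : Eucl n) :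
    matrixForm A v w = matrixForm A w v := by
  have h : (Matrix.of A).PosDef := hA
  have h1 : ∀ i j, A j i = A i j := fun i j => by simpa using h.1.apply i j
  rw [matrixForm_apply, matrixForm_apply, Finset.sum_comm]
  exact Finset.sum_congr rfl fun i _ => Finset.sum_congr rfl fun j _ => by rw [h1]; ring

theorem matrixForm_pos {A : Fin n → Fin n → ℝ} (hA : A ∈ posDefMatrices n) {v : Eucl n}
    (hv : v ≠ 0) : 0 < matrixForm A v v := by
  have h : (Matrix.of A).PosDef := hA
  have h1 := h.dotProduct_mulVec_pos (x := v.ofLp) (fun h0 => hv (by ext i; exact congrFun h0 i))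
  refine h1.trans_eq ?_
  rw [matrixForm_apply]
  simp only [dotProduct, Matrix.mulVec, Finset.mul_sum, star_trivial, Matrix.of_apply]
  exact Finset.sum_congr rfl fun i _ => Finset.sum_congr rfl fun j _ => by ring

/-- If `c > 0` is the minimum of the form on the unit sphere, its unit ball lies in the Euclidean
ball of radius `c ^ (-1/2)`. The sphere may be empty, namely for `n = 0`; that case is separate. -/
theorem isVonNBounded_matrixForm {A : Fin n → Fin n → ℝ} (hA : A ∈ posDefMatrices n) :
    Bornology.IsVonNBounded ℝ {v : Eucl n | matrixForm A v v < 1} := by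
  have hc : Continuous fun v : Eucl n => matrixForm A v v := by
    simp only [matrixForm_apply]
    fun_prop
  rcases (Metric.sphere (0 : Eucl n) 1).eq_empty_or_nonempty with h0 | h0
  · refine (NormedSpace.isVonNBounded_ball ℝ (Eucl n) 1).subset fun v _ => ?_
    rw [mem_ball_zero_iff]
    by_contra! h
    have hv : ‖v‖ ≠ 0 := by linarith
    have : ‖v‖⁻¹ • v ∈ Metric.sphere (0 : Eucl n) 1 := by
      rw [mem_sphere_zero_iff_norm, norm_smul, norm_inv, norm_norm, inv_mul_cancel₀ hv]
    rw [h0] at this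
    exact this
  · obtain ⟨w, hw, hmin⟩ := (isCompact_sphere (0 : Eucl n) 1).exists_isMinOn h0 hc.continuousOn
    set c := matrixForm A w w with hcdef
    have hcpos : 0 < c := matrixForm_pos hA (by rintro rfl; simp at hw)
    refine (NormedSpace.isVonNBounded_ball ℝ (Eucl n) (Real.sqrt c)⁻¹).subset fun v hv => ?_
    rw [mem_ball_zero_iff]
    rcases eq_or_ne v 0 with rfl | hv0
    · simpa using Real.sqrt_pos.2 hcpos
    have hn : ‖v‖ ≠ 0 := norm_ne_zero_iff.2 hv0
    have h1 : c ≤ matrixForm A (‖v‖⁻¹ • v) (‖v‖⁻¹ • v) := hmin (by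
      rw [mem_sphere_zero_iff_norm, norm_smul, norm_inv, norm_norm, inv_mul_cancel₀ hn])
    have h2 : matrixForm A (‖v‖⁻¹ • v) (‖v‖⁻¹ • v) = ‖v‖⁻¹ ^ 2 * matrixForm A v v := by
      simp only [map_smul, _root_.smul_apply, smul_eq_mul]
      ring
    have h3 : matrixForm A v v < 1 := hv
    have h4 : c < ‖v‖⁻¹ ^ 2 := by
      rw [h2] at h1
      have : 0 < ‖v‖⁻¹ ^ 2 := by positivity
      nlinarith
    rw [lt_inv_comm₀ (by positivity) (Real.sqrt_pos.2 hcpos)]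
    exact (Real.sqrt_lt' (by positivity)).2 h4

/-- The bilinear form with matrix `A` on the tangent spaces of `ℝⁿ`. -/
def flatInner (A : Fin n → Fin n → ℝ) (x : flatMfd.{u} n) :
    TangentSpace (𝓡 n) x →L[ℝ] TangentSpace (𝓡 n) x →L[ℝ] ℝ := matrixForm A

theorem continuousLinearMapAt_dual_flatMfd (x y : flatMfd.{u} n)
    (L : TangentSpace (𝓡 n) y →L[ℝ] ℝ) (w : Eucl n) :
    (trivializationAt (Eucl n →L[ℝ] ℝ)
      (fun y : flatMfd.{u} n => TangentSpace (𝓡 n) y →L[ℝ] ℝ) x).continuousLinearMapAt ℝ y L w =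
      L w := by
  have hb : y ∈ (trivializationAt (Eucl n →L[ℝ] ℝ)
      (fun y : flatMfd.{u} n => TangentSpace (𝓡 n) y →L[ℝ] ℝ) x).baseSet := by
    rw [hom_trivializationAt_baseSet]
    exact ⟨by trivial, by trivial⟩
  rw [Trivialization.continuousLinearMapAt_apply, Trivialization.coe_linearMapAt_of_mem _ hb]
  beta_reduce
  rw [hom_trivializationAt_apply]
  unfold ContinuousLinearMap.inCoordinates
  rw [ContinuousLinearMap.comp_apply, ContinuousLinearMap.comp_apply]
  refine Eq.trans ?_ (congrArg L (symmL_flatMfd x y w))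
  rw [Trivialization.continuousLinearMapAt_apply, Trivialization.coe_linearMapAt_of_mem _ (by trivial)]
  rfl

/-- In the trivialisation of the single chart the section is the constant `matrixForm A`. -/
theorem contMDiff_flatInner (A : Fin n → Fin n → ℝ) :
    ContMDiff (𝓡 n) ((𝓡 n).prod 𝓘(ℝ, Eucl n →L[ℝ] Eucl n →L[ℝ] ℝ)) ∞
      fun x : flatMfd.{u} n => TotalSpace.mk' (Eucl n →L[ℝ] Eucl n →L[ℝ] ℝ) x (flatInner A x) := by
  intro x
  rw [contMDiffAt_section]
  have h : (fun y : flatMfd.{u} n => (trivializationAt (Eucl n →L[ℝ] Eucl n →L[ℝ] ℝ)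
      (fun y : flatMfd.{u} n => TangentSpace (𝓡 n) y →L[ℝ] TangentSpace (𝓡 n) y →L[ℝ] ℝ) x
      ⟨y, flatInner A y⟩).2) = fun _ => matrixForm A := by
    ext y v w
    rw [hom_trivializationAt_apply]
    unfold ContinuousLinearMap.inCoordinates
    rw [ContinuousLinearMap.comp_apply, ContinuousLinearMap.comp_apply]
    refine (continuousLinearMapAt_dual_flatMfd x y _ w).trans ?_
    exact congrArg (fun u => matrixForm A u w) (symmL_flatMfd x y v)
  rw [h]
  exact contMDiffAt_const

/-- The constant metric with matrix `A`. -/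
def flatMetric (A : Fin n → Fin n → ℝ) (hA : A ∈ posDefMatrices n) : RiemMetric (flatMfd.{u} n) where
  inner := flatInner A
  symm _ v w := matrixForm_symm hA v w
  pos _ _ hv := matrixForm_pos hA hv
  isVonNBounded _ := isVonNBounded_matrixForm hA
  contMDiff := contMDiff_flatInner A

theorem metricCoord_flatMetric (A : Fin n → Fin n → ℝ) (hA : A ∈ posDefMatrices n) (x : Eucl n) :
    metricCoord (flatMetric.{u} A hA) (flatCoord n) x = A := by
  ext i j
  rw [metricCoord, mfderiv_flatCoord_symm, mfderiv_flatCoord_symm]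
  exact matrixForm_single A i j

end FlatMetrics

/-! ### Linearity of the full symbol; operators with vanishing symbol -/

section SymbolLinearity

open MeasureTheory Filter

variable {U : Set (Eucl n)} {m : ℂ} {p q : Eucl n → Eucl n → ℂ} {σ τ : ℕ → Eucl n → Eucl n → ℂ}

theorem HasSymbolExpansion.contDiffOn_remainder (hp : HasSymbolExpansion U m p σ) (N : ℕ) :
    ContDiffOn ℝ ∞ (Function.uncurry fun x ξ => p x ξ - ∑ j ∈ Finset.range N, σ j x ξ)
      (U ×ˢ {0}ᶜ) :=
  (hp.smooth.mono (Set.prod_mono subset_rfl (Set.subset_univ _))).sub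
    (ContDiffOn.sum fun j _ => (hp.homogeneous j).smooth)

theorem HasSymbolExpansion.add (hU : IsOpen U) (hp : HasSymbolExpansion U m p σ)
    (hq : HasSymbolExpansion U m q τ) :
    HasSymbolExpansion U m (fun x ξ => p x ξ + q x ξ) (fun j x ξ => σ j x ξ + τ j x ξ) where
  smooth := hp.smooth.add hq.smooth
  homogeneous j := ⟨(hp.homogeneous j).smooth.add (hq.homogeneous j).smooth, fun x hx ξ hξ t ht => by
    rw [(hp.homogeneous j).homogeneous x hx ξ hξ t ht,
      (hq.homogeneous j).homogeneous x hx ξ hξ t ht, mul_add]⟩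
  bound N K hK hKU α β := by
    have ho : IsOpen ({0}ᶜ : Set (Eucl n)) := isOpen_compl_singleton
    obtain ⟨C, hC⟩ := hp.bound N K hK hKU α β
    obtain ⟨D, hD⟩ := hq.bound N K hK hKU α β
    refine ⟨C + D, fun x hx ξ hξ => ?_⟩
    have h1 := hp.contDiffOn_remainder N
    have h2 := hq.contDiffOn_remainder N
    have h3 := contDiffOn_pd_snd (hU.prod ho) h1 β
    have h4 := contDiffOn_pd_snd (hU.prod ho) h2 β
    have hξ0 : ξ ∈ ({0}ᶜ : Set (Eucl n)) := far_subset hξ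
    have e : pd α (fun x' => pd β (fun ξ' => p x' ξ' + q x' ξ' -
        ∑ j ∈ Finset.range N, (σ j x' ξ' + τ j x' ξ')) ξ) x =
        pd α (fun x' => pd β (fun ξ' => p x' ξ' - ∑ j ∈ Finset.range N, σ j x' ξ') ξ) x +
        pd α (fun x' => pd β (fun ξ' => q x' ξ' - ∑ j ∈ Finset.range N, τ j x' ξ') ξ) x := by
      refine Eq.trans ?_
        (pd_add hU (contDiffOn_slice_fst h3 hξ0) (contDiffOn_slice_fst h4 hξ0) α (hKU hx))
      refine pd_congr hU (fun y hy => ?_) α (hKU hx)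
      refine Eq.trans ?_
        (pd_add ho (contDiffOn_slice_snd h1 hy) (contDiffOn_slice_snd h2 hy) β hξ0)
      congr 1
      ext ζ
      rw [Finset.sum_add_distrib]
      ring
    rw [e, add_mul]
    exact (norm_add_le _ _).trans (add_le_add (hC x hx ξ hξ) (hD x hx ξ hξ))

theorem HasSymbolExpansion.const_mul (hU : IsOpen U) (c : ℂ) (hp : HasSymbolExpansion U m p σ) :
    HasSymbolExpansion U m (fun x ξ => c * p x ξ) (fun j x ξ => c * σ j x ξ) where
  smooth := contDiffOn_const.mul hp.smooth
  homogeneous j := ⟨contDiffOn_const.mul (hp.homogeneous j).smooth, fun x hx ξ hξ t ht => by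
    rw [(hp.homogeneous j).homogeneous x hx ξ hξ t ht, mul_left_comm]⟩
  bound N K hK hKU α β := by
    have ho : IsOpen ({0}ᶜ : Set (Eucl n)) := isOpen_compl_singleton
    obtain ⟨C, hC⟩ := hp.bound N K hK hKU α β
    refine ⟨‖c‖ * C, fun x hx ξ hξ => ?_⟩
    have h1 := hp.contDiffOn_remainder N
    have h3 := contDiffOn_pd_snd (hU.prod ho) h1 β
    have hξ0 : ξ ∈ ({0}ᶜ : Set (Eucl n)) := far_subset hξ
    have e : pd α (fun x' => pd β (fun ξ' => c * p x' ξ' -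
        ∑ j ∈ Finset.range N, c * σ j x' ξ') ξ) x =
        c * pd α (fun x' => pd β (fun ξ' => p x' ξ' - ∑ j ∈ Finset.range N, σ j x' ξ') ξ) x := by
      refine Eq.trans ?_ (pd_const_mul hU (contDiffOn_slice_fst h3 hξ0) c α (hKU hx))
      refine pd_congr hU (fun y hy => ?_) α (hKU hx)
      refine Eq.trans ?_ (pd_const_mul ho (contDiffOn_slice_snd h1 hy) c β hξ0)
      congr 1
      ext ζ
      rw [← Finset.mul_sum]
      ring
    rw [e, norm_mul, mul_assoc]
    exact mul_le_mul_of_nonneg_left (hC x hx ξ hξ) (norm_nonneg _)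

/-- When all components vanish, every remainder is `p` itself, so `p` is of order `m - N'` for each
`N'`. -/
theorem HasSymbolExpansion.rapidDecay (hp : HasSymbolExpansion U m p fun _ _ _ => 0) (hU : IsOpen U) :
    RapidDecay U p where
  smooth := hp.smooth
  bound K hK hKU l N := by
    obtain ⟨N', hN'⟩ := exists_nat_ge (m.re + N)
    obtain ⟨C₁, hC₁⟩ := hp.bound N' K hK hKU l []
    obtain ⟨C₀, hC₀⟩ := bddOn_near hK hKU
      (contDiffOn_pd_fst (hU.prod isOpen_univ) hp.smooth l).continuousOn
    obtain ⟨C, hC, h⟩ := exists_growth_of_near_far (S := K)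
      (f := fun x ξ => pd l (fun x' => p x' ξ) x) (s := m.re - N') (C₁ := C₁) hC₀
      (fun x hx ξ hξ => by simpa [pd] using hC₁ x hx ξ hξ)
    refine ⟨C, fun x hx ξ => (h x hx ξ).trans ?_⟩
    exact mul_le_mul_of_nonneg_left (rpow_one_add_norm_mono ξ (by linarith)) hC

theorem quantize_const_mul (c : ℂ) (p : Eucl n → Eucl n → ℂ) (v : Eucl n → ℂ) (x : Eucl n) :
    quantize (fun x ξ => c * p x ξ) v x = c * quantize p v x := by
  rw [quantize_eq, quantize_eq]
  simp only [mul_assoc]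
  rw [oscInt_const_mul]
  ring

/-- Fubini, in the form `oscInt_oscInt_mul`: the kernel is the inverse Fourier transform of `p x` at
`x - y`. -/
theorem RapidDecay.quantize_eq_integral (hp : RapidDecay U p) {v : Eucl n → ℂ}
    (hv : Integrable v) {x : Eucl n} (hx : x ∈ U) :
    quantize p v x =
      ∫ y, ((2 * Real.pi : ℝ) : ℂ) ^ (-(n : ℤ)) * oscInt (p x) (x - y) * v y := by
  have h1 : ∀ ξ, oscInt v (-ξ) = oscInt (fun z => v (-z)) ξ := fun ξ => by
    rw [oscInt, oscInt, ← integral_neg_eq_self]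
    congr 1 with z
    rw [← osc_neg_comm, neg_neg]
  have h2 : (fun ξ => p x ξ * oscInt v (-ξ)) = fun ξ => oscInt (fun z => v (-z)) ξ * p x ξ := by
    ext ξ
    rw [h1, mul_comm]
  rw [quantize_eq, h2, oscInt_oscInt_mul hv.comp_neg (hp.integrable hx), ← integral_neg_eq_self,
    ← integral_const_mul]
  congr 1 with y
  rw [neg_neg, ← sub_eq_add_neg]
  ring

variable {M : SmoothMfd.{u} n} {φ : OpenPartialHomeomorph M (Eucl n)} {T S : Op M}

theorem HasSymbolInCoord.const_smul (c : ℂ) (hT : HasSymbolInCoord m T φ σ) :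
    HasSymbolInCoord m (c • T) φ (fun j x ξ => c * σ j x ξ) := by
  obtain ⟨p, k, hp, hk, hT⟩ := hT
  refine ⟨_, fun x y => c * k x y, hp.const_mul φ.open_target c, contDiffOn_const.mul hk,
    fun u hu x hx => ?_⟩
  have h1 : ((c • T) u : M → ℂ) (φ.symm x) = c * (T u : M → ℂ) (φ.symm x) := rfl
  rw [h1, hT u hu x hx, quantize_const_mul, mul_add, ← integral_const_mul]
  simp only [mul_assoc]

theorem HasSymbolInCoord.add (hφ : IsLocalCoord M φ) (hT : HasSymbolInCoord m T φ σ)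
    (hS : HasSymbolInCoord m S φ τ) :
    HasSymbolInCoord m (T + S) φ (fun j x ξ => σ j x ξ + τ j x ξ) := by
  obtain ⟨p, k, hp, hk, hT⟩ := hT
  obtain ⟨q, l, hq, hl, hS⟩ := hS
  refine ⟨_, fun x y => k x y + l x y, hp.add φ.open_target hq, hk.add hl,
    fun u hu x hx => ?_⟩
  have h1 : ((T + S) u : M → ℂ) (φ.symm x) = (T u : M → ℂ) (φ.symm x) + (S u : M → ℂ) (φ.symm x) :=
    rfl
  have hint : ∀ {p : Eucl n → Eucl n → ℂ} {σ : ℕ → Eucl n → Eucl n → ℂ},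
      HasSymbolExpansion φ.target m p σ →
        Integrable fun ξ => p x ξ * oscInt (φ.target.indicator ((u : M → ℂ) ∘ φ.symm)) (-ξ) := by
    intro p σ hp
    have hb := (hp.isLocalSymbol φ.open_target).bound_snd x hx
    obtain ⟨C, hC⟩ := hb.bound []
    exact integrable_symbol_mul hb.smooth.continuous hC (hφ.contDiff_coordRep u.2.1 u.2.2 hu)
      (hasCompactSupport_coordRep u.2.2 hu)
  have hT' := hT u hu x hx
  have hS' := hS u hu x hx
  rw [setIntegral_coordRep] at hT' hS' ⊢
  simp only [add_mul]
  rw [h1, hT', hS', integral_add (hφ.integrable_kernel hk u hu hx)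
    (hφ.integrable_kernel hl u hu hx), quantize_add (hint hp) (hint hq)]
  ring

theorem HasSymbolInCoord.sub (hφ : IsLocalCoord M φ) (hT : HasSymbolInCoord m T φ σ)
    (hS : HasSymbolInCoord m S φ τ) (c : ℂ) :
    HasSymbolInCoord m (T - c • S) φ (fun j x ξ => σ j x ξ - c * τ j x ξ) := by
  have h := hT.add hφ (hS.const_smul (-c))
  have e : T + (-c) • S = T - c • S := by
    refine LinearMap.ext fun u => Subtype.ext (funext fun z => ?_)
    change (T u : M → ℂ) z + -c * (S u : M → ℂ) z = (T u : M → ℂ) z - c * (S u : M → ℂ) z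
    ring
  rw [e] at h
  exact h.congr_symbol fun j x _ ξ _ => by ring

/-- The full symbol of a smoothing operator vanishes. -/
theorem HasSymbolInCoord.eq_zero (hφ : IsLocalCoord M φ) (hT : HasSymbolInCoord m T φ σ)
    (h : HasSmoothKernelOn T φ φ) (j : ℕ) {x₀ : Eucl n} (hx₀ : x₀ ∈ φ.target) {ξ₀ : Eucl n}
    (hξ₀ : ξ₀ ≠ 0) : σ j x₀ ξ₀ = 0 := by
  obtain ⟨p, k, hp, hk, hT⟩ := hT
  obtain ⟨l, hl, h⟩ := h.exists_kernel
  have hU := φ.open_target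
  have hls := hp.isLocalSymbol hU
  have hb := hls.bound_snd x₀ hx₀
  obtain ⟨C, hC⟩ := hb.bound []
  refine expansion_eq_zero (μ := m) (f := p x₀) (F := fun j => σ j x₀) (V := φ.target)
    (K := fun y => l x₀ y - k x₀ y) hU hx₀
    ((contDiffOn_slice_snd hl hx₀).sub (contDiffOn_slice_snd hk hx₀))
    hb.smooth.continuous.stronglyMeasurable (C := C) (M := m.re) (fun ξ => by simpa [pd] using hC ξ)
    (by simpa [pd] using hls.expansion_snd x₀ hx₀ [])
    (fun j => (hp.homogeneous j).homogeneous x₀ hx₀)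
    (fun j => (contDiffOn_slice_snd (hp.homogeneous j).smooth hx₀).continuousOn)
    (fun v hv hc hvφ => ?_) j ξ₀ hξ₀
  set u := hφ.liftTest hv hc hvφ with hudef
  have hu : tsupport (u : M → ℂ) ⊆ φ.source :=
    (hφ.tsupport_liftTest_subset hv hc hvφ hvφ).trans Set.inter_subset_left
  have h1 := hT u hu x₀ hx₀
  have h2 := h u hu x₀ hx₀
  have h3 : φ.target.indicator ((u : M → ℂ) ∘ φ.symm) = coordRep φ u := rfl
  have h4 : coordRep φ (u : M → ℂ) = v := coordRep_coordLift hvφ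
  have h5 := hφ.integrable_kernel hl u hu hx₀
  have h6 := hφ.integrable_kernel hk u hu hx₀
  rw [setIntegral_coordRep, h3, h4, h2, quantize_eq] at h1
  rw [h4] at h1 h5 h6
  simp only [sub_mul]
  rw [integral_sub h5 h6, h1, add_sub_cancel_right]

/-- A vanishing full symbol leaves a rapidly decreasing `p`, whose kernel is smooth across the
diagonal as well. -/
theorem HasSymbolInCoord.hasSmoothKernelOn (hφ : IsLocalCoord M φ)
    (hT : HasSymbolInCoord m T φ fun _ _ _ => 0) : HasSmoothKernelOn T φ φ := by
  obtain ⟨p, k, hp, hk, hT⟩ := hT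
  have hU := φ.open_target
  have hr := hp.rapidDecay hU
  have hl : ContDiffOn ℝ ∞ (Function.uncurry fun x y =>
      ((2 * Real.pi : ℝ) : ℂ) ^ (-(n : ℤ)) * oscInt (p x) (x - y)) (φ.target ×ˢ φ.target) := by
    have h1 : ContDiff ℝ ∞ fun q : Eucl n × Eucl n => (q.1, q.1 - q.2) := by fun_prop
    have h2 := (hr.contDiffOn_oscInt hU).comp h1.contDiffOn
      (s := φ.target ×ˢ φ.target) fun q hq => ⟨hq.1, trivial⟩
    exact contDiffOn_const.mul h2
  refine hasSmoothKernelOn_of_kernel (k := fun x y =>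
      ((2 * Real.pi : ℝ) : ℂ) ^ (-(n : ℤ)) * oscInt (p x) (x - y) + k x y) (hl.add hk)
    fun u hu x hx => ?_
  have h1 := hT u hu x hx
  rw [setIntegral_coordRep] at h1
  have h2 : φ.target.indicator ((u : M → ℂ) ∘ φ.symm) = coordRep φ u := rfl
  rw [h1, h2, hr.quantize_eq_integral (contDiff_integrable (hφ.contDiff_coordRep u.2.1 u.2.2 hu)
    (hasCompactSupport_coordRep u.2.2 hu)) hx,
    ← integral_add (hφ.integrable_kernel hl u hu hx) (hφ.integrable_kernel hk u hu hx)]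
  simp only [add_mul]

end SymbolLinearity

/-! ### Gluing smooth kernels -/

section Gluing

open MeasureTheory Filter

variable {M : SmoothMfd.{u} n} {φ ψ : OpenPartialHomeomorph M (Eucl n)} {T : Op M}

/-- Continuous kernels are determined by their action on test functions. -/
theorem IsLocalCoord.eqOn_of_integral_eq (hψ : IsLocalCoord M ψ) {W : Set (Eucl n)}
    (hW : IsOpen W) (hWψ : W ⊆ ψ.target) {k l : Eucl n → ℂ} (hk : ContinuousOn k W)
    (hl : ContinuousOn l W) (h : ∀ u : TestFn M, tsupport (u : M → ℂ) ⊆ ψ.source ∩ ψ ⁻¹' W →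
      ∫ y, k y * coordRep ψ u y = ∫ y, l y * coordRep ψ u y) : Set.EqOn k l W := by
  have hkl := hk.sub hl
  have h0 : ∀ᵐ y, y ∈ W → k y - l y = 0 := by
    -- Integrals against real test functions determine `k - l` almost everywhere on `W`; continuity
    -- then gives equality everywhere there.
    refine hW.ae_eq_zero_of_integral_contDiff_smul_eq_zero
      (hkl.locallyIntegrableOn hW.measurableSet) fun g hg hgc hgW => ?_
    set v : Eucl n → ℂ := fun y => (g y : ℂ) with hvdef
    have hv : ContDiff ℝ ∞ v := Complex.ofRealCLM.contDiff.comp hg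
    have hvs : tsupport v ⊆ tsupport g := closure_mono fun y hy hy' => hy (by simp [hvdef, hy'])
    have hvc : HasCompactSupport v := hgc.of_isClosed_subset (isClosed_tsupport _) hvs
    have hvW := hvs.trans hgW
    have h1 := h (hψ.liftTest hv hvc (hvW.trans hWψ))
      (hψ.tsupport_liftTest_subset hv hvc (hvW.trans hWψ) hvW)
    have h2 : coordRep ψ (hψ.liftTest hv hvc (hvW.trans hWψ) : M → ℂ) = v :=
      coordRep_coordLift (hvW.trans hWψ)
    rw [h2] at h1
    have hi : ∀ {f : Eucl n → ℂ}, ContinuousOn f W → Integrable fun y => f y * v y := by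
      intro f hf
      have hc : Continuous fun y => f y * v y := by
        refine continuous_iff_continuousAt.2 fun y => ?_
        by_cases hy : y ∈ W
        · exact (hf.continuousAt (hW.mem_nhds hy)).mul hv.continuous.continuousAt
        · have : (fun y => f y * v y) =ᶠ[𝓝 y] fun _ => 0 := by
            filter_upwards [(isClosed_tsupport v).isOpen_compl.mem_nhds fun h => hy (hvW h)]
              with z hz
            rw [image_eq_zero_of_notMem_tsupport hz, mul_zero]
          exact continuousAt_const.congr_of_eventuallyEq this
      exact hc.integrable_of_hasCompactSupport hvc.mul_left
    have h3 : (fun y => g y • (k y - l y)) = fun y => k y * v y - l y * v y := by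
      ext y
      rw [Complex.real_smul, hvdef]
      ring
    rw [h3, integral_sub (hi hk) (hi hl), h1, sub_self]
  have h1 : (fun y => k y - l y) =ᵐ[volume.restrict W] fun _ => 0 :=
    (ae_restrict_iff' hW.measurableSet).2 h0
  exact fun y hy => sub_eq_zero.1 (Measure.eqOn_open_of_ae_eq h1 hW hkl continuousOn_const hy)

/-- A kernel for `T` on the open subset `V × W` of `φ.target × ψ.target`. -/
def IsKernelOn (T : Op M) (φ ψ : OpenPartialHomeomorph M (Eucl n)) (V W : Set (Eucl n))
    (k : Eucl n → Eucl n → ℂ) : Prop :=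
  ∀ u : TestFn M, tsupport (u : M → ℂ) ⊆ ψ.source ∩ ψ ⁻¹' W → ∀ x ∈ V,
    (T u : M → ℂ) (φ.symm x) = ∫ y, k x y * coordRep ψ u y

/-- An operator that has a smooth kernel locally on `φ.target × ψ.target` has a smooth kernel
there. -/
theorem HasSmoothKernelOn.of_local (hψ : IsLocalCoord M ψ)
    (h : ∀ x ∈ φ.target, ∀ y ∈ ψ.target, ∃ V W k, IsOpen V ∧ x ∈ V ∧ IsOpen W ∧ y ∈ W ∧
      W ⊆ ψ.target ∧ ContDiffOn ℝ ∞ (Function.uncurry k) (V ×ˢ W) ∧ IsKernelOn T φ ψ V W k) :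
    HasSmoothKernelOn T φ ψ := by
  choose! V W k hV hxV hW hyW hWψ hk hT using h
  -- Kernels are unique, so the chosen local kernels agree on overlaps. The function `k x y x y` is
  -- therefore near each point one of the local kernels, hence smooth.
  have hloc : ∀ x₀ ∈ φ.target, ∀ y₀ ∈ ψ.target, ∀ x ∈ φ.target, x ∈ V x₀ y₀ → ∀ y ∈ W x₀ y₀,
      k x y x y = k x₀ y₀ x y := by
    intro x₀ hx₀ y₀ hy₀ x hx hxV₀ y hyW₀
    have hy := hWψ x₀ hx₀ y₀ hy₀ hyW₀
    have h1 := hψ.eqOn_of_integral_eq ((hW x hx y hy).inter (hW x₀ hx₀ y₀ hy₀))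
      (Set.inter_subset_left.trans (hWψ x hx y hy)) (k := k x y x) (l := k x₀ y₀ x)
      ((contDiffOn_slice_snd (hk x hx y hy) (hxV x hx y hy)).continuousOn.mono
        Set.inter_subset_left)
      ((contDiffOn_slice_snd (hk x₀ hx₀ y₀ hy₀) hxV₀).continuousOn.mono Set.inter_subset_right)
      fun u hu => by
        rw [← hT x hx y hy u (fun z hz => ⟨(hu hz).1, (hu hz).2.1⟩) x (hxV x hx y hy),
          ← hT x₀ hx₀ y₀ hy₀ u (fun z hz => ⟨(hu hz).1, (hu hz).2.2⟩) x hxV₀]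
    exact h1 ⟨hyW x hx y hy, hyW₀⟩
  have hsm : ContDiffOn ℝ ∞ (Function.uncurry fun x y => k x y x y) (φ.target ×ˢ ψ.target) := by
    rintro ⟨x₀, y₀⟩ ⟨hx₀, hy₀⟩
    have hn : (φ.target ∩ V x₀ y₀) ×ˢ W x₀ y₀ ∈ 𝓝 (x₀, y₀) :=
      prod_mem_nhds (inter_mem (φ.open_target.mem_nhds hx₀)
        ((hV x₀ hx₀ y₀ hy₀).mem_nhds (hxV x₀ hx₀ y₀ hy₀)))
        ((hW x₀ hx₀ y₀ hy₀).mem_nhds (hyW x₀ hx₀ y₀ hy₀))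
    have h1 : ContDiffAt ℝ ∞ (Function.uncurry (k x₀ y₀)) (x₀, y₀) :=
      (hk x₀ hx₀ y₀ hy₀).contDiffAt (mem_of_superset hn
        (Set.prod_mono Set.inter_subset_right subset_rfl))
    refine (h1.congr_of_eventuallyEq ?_).contDiffWithinAt
    filter_upwards [hn] with q hq
    exact hloc x₀ hx₀ y₀ hy₀ q.1 hq.1.1 hq.1.2 q.2 hq.2
  refine hasSmoothKernelOn_of_kernel hsm fun u hu x hx => ?_
  -- With `x` fixed, `u` is cut into pieces each supported where a single local kernel represents
  -- `T` at `x`.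
  obtain ⟨t, ρ, hρ, hρ1⟩ := exists_finite_partition u.2.2.isCompact
    (U := fun z => ψ.source ∩ ψ ⁻¹' W x (ψ z)) fun z hz =>
    ⟨isOpen_coord_preimage (hW x hx _ (ψ.map_source (hu hz))),
      hu hz, hyW x hx _ (ψ.map_source (hu hz))⟩
  set w : M → TestFn M := fun i => mulTest (ρ i).2.1 u with hw
  have hws : ∀ i, tsupport (w i : M → ℂ) ⊆ tsupport (ρ i : M → ℂ) := fun i =>
    tsupport_mul_subset_left
  have hwu : ∀ i, tsupport (w i : M → ℂ) ⊆ ψ.source := fun i =>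
    (tsupport_mul_subset_right).trans hu
  have hsum : u = ∑ i ∈ t, w i := by
    refine Subtype.ext (funext fun z => ?_)
    have h1 : ((∑ i ∈ t, w i : TestFn M) : M → ℂ) z = (∑ i ∈ t, (ρ i : M → ℂ) z) * (u : M → ℂ) z := by
      rw [Submodule.coe_sum, Finset.sum_apply, Finset.sum_mul]
      rfl
    rw [h1]
    by_cases hz : z ∈ tsupport (u : M → ℂ)
    · rw [hρ1 z hz, one_mul]
    · rw [image_eq_zero_of_notMem_tsupport hz, mul_zero]
  have hrep : ∀ y, coordRep ψ (u : M → ℂ) y = ∑ i ∈ t, coordRep ψ (w i : M → ℂ) y := by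
    intro y
    by_cases hy : y ∈ ψ.target
    · simp only [coordRep_apply hy]
      conv_lhs => rw [hsum]
      rw [Submodule.coe_sum, Finset.sum_apply]
    · simp only [coordRep, Set.indicator_of_notMem hy, Finset.sum_const_zero]
  have hTu : (T u : M → ℂ) (φ.symm x) = ∑ i ∈ t, (T (w i) : M → ℂ) (φ.symm x) := by
    conv_lhs => rw [hsum, map_sum, Submodule.coe_sum, Finset.sum_apply]
  rw [hTu]
  simp only [hrep, Finset.mul_sum]
  rw [integral_finsetSum _ fun i _ => hψ.integrable_kernel hsm (w i) (hwu i) hx]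
  refine Finset.sum_congr rfl fun i hi => ?_
  have hi' := ψ.map_source (hu (hρ i hi).1)
  rw [hT x hx _ hi' (w i) ((hws i).trans (hρ i hi).2) x (hxV x hx _ hi')]
  congr 1 with y
  by_cases hy : y ∈ W x (ψ i)
  · rw [hloc x hx _ hi' x hx (hxV x hx _ hi') y hy]
  · rw [coordRep_eq_zero, mul_zero, mul_zero]
    rintro ⟨z, hz, rfl⟩
    exact hy ((hρ i hi).2 (hws i hz)).2

/-- An operator whose kernel is smooth off the diagonal and on the squares of coordinate domains
is smoothing. -/
theorem HasKernelSmoothOffDiagonal.isSmoothing (hT : HasKernelSmoothOffDiagonal T)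
    (h : ∀ ψ, IsLocalCoord M ψ → HasSmoothKernelOn T ψ ψ) : IsSmoothing T := by
  intro φ ψ hφ hψ
  refine HasSmoothKernelOn.of_local hψ fun x₀ hx₀ y₀ hy₀ => ?_
  -- Near a diagonal point the first variable is moved to the chart `ψ`, whose square is covered by
  -- `h`. Distinct points have disjoint neighbourhoods, where the off-diagonal hypothesis applies.
  by_cases hxy : φ.symm x₀ = ψ.symm y₀
  · obtain ⟨k, hk, hkT⟩ := (h ψ hψ).exists_kernel
    have hO : IsOpen (φ.target ∩ φ.symm ⁻¹' ψ.source) :=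
      φ.isOpen_inter_preimage_symm ψ.open_source
    refine ⟨φ.target ∩ φ.symm ⁻¹' ψ.source, ψ.target, fun x y => k (ψ (φ.symm x)) y, hO,
      ⟨hx₀, ?_⟩, ψ.open_target, hy₀, subset_rfl, ?_, fun u hu x hx => ?_⟩
    · change φ.symm x₀ ∈ ψ.source
      rw [hxy]
      exact ψ.map_target hy₀
    · have h1 := hφ.contDiffOn_transition hψ
      exact hk.comp ((h1.comp contDiff_fst.contDiffOn fun q hq => hq.1).prodMk
        contDiff_snd.contDiffOn) fun q hq => ⟨ψ.map_source hq.1.2, hq.2⟩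
    · rw [← hkT u (hu.trans Set.inter_subset_left) _ (ψ.map_source hx.2), ψ.left_inv hx.2]
  · obtain ⟨O₁, O₂, hO₁, hO₂, hx₁, hy₂, hd⟩ := t2_separation hxy
    have hV : IsOpen (φ.target ∩ φ.symm ⁻¹' O₁) := φ.isOpen_inter_preimage_symm hO₁
    have hW : IsOpen (ψ.target ∩ ψ.symm ⁻¹' O₂) := ψ.isOpen_inter_preimage_symm hO₂
    have hdisj : Disjoint (coordRestr φ (φ.target ∩ φ.symm ⁻¹' O₁)).source
        (coordRestr ψ (ψ.target ∩ ψ.symm ⁻¹' O₂)).source := by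
      rw [coordRestr_source hV, coordRestr_source hW]
      refine Set.disjoint_left.2 fun z hz hz' => ?_
      have h1 := hz.2.2
      have h2 := hz'.2.2
      rw [Set.mem_preimage, φ.left_inv hz.1] at h1
      rw [Set.mem_preimage, ψ.left_inv hz'.1] at h2
      exact Set.disjoint_left.1 hd h1 h2
    obtain ⟨k, hk, hkT⟩ := (hT _ _ (hφ.coordRestr hV) (hψ.coordRestr hW) hdisj).exists_kernel
    rw [coordRestr_target hV Set.inter_subset_left, coordRestr_target hW Set.inter_subset_left]
      at hk
    refine ⟨_, _, k, hV, ⟨hx₀, hx₁⟩, hW, ⟨hy₀, hy₂⟩, Set.inter_subset_left, hk, fun u hu x hx => ?_⟩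
    have h1 := hkT u (by rwa [coordRestr_source hW]) x
      (by rwa [coordRestr_target hV Set.inter_subset_left])
    rwa [coordRestr_symm_apply, coordRep_coordRestr hW Set.inter_subset_left hu] at h1

end Gluing

/-! ### Parametrices of invariant operators -/

section Parametrices

variable {M : SmoothMfd.{u} n} {φ : OpenPartialHomeomorph M (Eucl n)} {m : ℂ}
  {σ σ' τ τ' : ℕ → Eucl n → Eucl n → ℂ}

/-- Passing to properly supported representatives changes neither full symbols nor smoothness off
the diagonal. -/
theorem IsParametrix.symProd_eq_one {P Q : Op M} (h : IsParametrix m P Q) (hP : IsPsiDO m P)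
    (hφ : IsLocalCoord M φ) (hσ : HasSymbolInCoord m P φ σ) (hτ : HasSymbolInCoord (-m) Q φ τ)
    (j : ℕ) : ∀ x ∈ φ.target, ∀ ξ, ξ ≠ 0 → symProd σ τ j x ξ = if j = 0 then 1 else 0 := by
  obtain ⟨hQ, P', Q', hP', hQ', hPP', hQQ', hPQ, -⟩ := h
  exact fun x hx ξ hξ => InvPsiDO.symProd_eq_one hQ' (hP.offDiagonal.congr_smoothing hPP')
    (hQ.offDiagonal.congr_smoothing hQQ') hφ (add_neg_cancel m) (hσ.congr_smoothing hφ hPP')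
    (hτ.congr_smoothing hφ hQQ') hPQ j hx hξ

/-- If `P₁ = c P₀` modulo smoothing operators, then the same holds for the parametrices, with
the inverse constant. -/
theorem isSmoothing_sub_of_isParametrix {P₀ P₁ Q₀ Q₁ : Op M} (h₀ : IsParametrix m P₀ Q₀)
    (h₁ : IsParametrix m P₁ Q₁) (hP₀ : IsElliptic m P₀) (hP₁ : IsPsiDO m P₁) {c : ℂ} (hc : c ≠ 0)
    (h : IsSmoothing (P₁ - c • P₀)) : IsSmoothing (Q₁ - c⁻¹ • Q₀) := by
  -- Off the diagonal the kernel is smooth, so it remains to see that the full symbol vanishes in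
  -- each chart.
  refine (h₁.1.offDiagonal.sub (h₀.1.offDiagonal.smul c⁻¹)).isSmoothing fun ψ hψ => ?_
  have hU := ψ.open_target
  obtain ⟨σ₀, hσ₀⟩ := hP₀.1.local_form ψ hψ
  obtain ⟨σ₁, hσ₁⟩ := hP₁.local_form ψ hψ
  obtain ⟨τ₀, hτ₀⟩ := h₀.1.local_form ψ hψ
  obtain ⟨τ₁, hτ₁⟩ := h₁.1.local_form ψ hψ
  have e₀ := h₀.symProd_eq_one hP₀.1 hψ hσ₀ hτ₀
  have e₁ := h₁.symProd_eq_one hP₁ hψ hσ₁ hτ₁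
  have hhom : ∀ {μ : ℂ} {T : Op M} {σ : ℕ → Eucl n → Eucl n → ℂ}, HasSymbolInCoord μ T ψ σ →
      ∀ j : ℕ, IsHomogeneousSymbol ψ.target (μ - j) (σ j) := by
    rintro μ T σ ⟨p, k, hp, -⟩
    exact hp.homogeneous
  have hσ : ∀ j, ∀ x ∈ ψ.target, ∀ ξ, ξ ≠ 0 → σ₁ j x ξ = c * σ₀ j x ξ := fun j x hx ξ hξ =>
    sub_eq_zero.1 ((hσ₁.sub hψ hσ₀ c).eq_zero hψ (h ψ ψ hψ hψ) j hx hξ)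
  have hτ : ∀ j, ∀ x ∈ ψ.target, ∀ ξ, ξ ≠ 0 → c * τ₁ j x ξ = τ₀ j x ξ := by
    intro j
    -- Both `c τ₁` and `τ₀` are formal right inverses of `σ₀`: the constant moves from the right
    -- factor to the left one, where `c σ₀ = σ₁`.
    refine symProd_right_unique (σ := σ₀) (τ := fun j x ξ => c * τ₁ j x ξ) hU
      (hP₀.2 ψ hψ σ₀ hσ₀) (fun j x hx ξ hξ => ?_) j
    rw [symProd_const_mul_right hU (hhom hτ₁) c j hx hξ, e₀ j x hx ξ hξ, ← e₁ j x hx ξ hξ,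
      ← symProd_const_mul_left (hhom hσ₀) c j hx hξ]
    exact symProd_congr hU (fun j x hx ξ hξ => (hσ j x hx ξ hξ).symm) (fun _ _ _ _ _ _ => rfl) hx hξ
  refine ((hτ₁.sub hψ hτ₀ c⁻¹).congr_symbol fun j x hx ξ hξ => ?_).hasSmoothKernelOn hψ
  rw [← hτ j x hx ξ hξ, inv_mul_cancel_left₀ hc, sub_self]

theorem universalExpr_of_eq_zero {a : JetExponent n →₀ ((Fin n → Fin n → ℝ) → Eucl n → ℂ)}
    (ha : ∀ β, β ≠ 0 → a β = 0) (G : Eucl n → Fin n → Fin n → ℝ) (x ξ : Eucl n) :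
    universalExpr a G x ξ = a 0 (G x) ξ := by
  have h : a = Finsupp.single 0 (a 0) := by
    ext1 β
    rw [Finsupp.single_apply]
    split_ifs with hβ
    · rw [hβ]
    · exact ha β (Ne.symm hβ)
  have h0 : (Finsupp.single (0 : JetExponent n) (a 0)).sum
      (fun β b => (jetMonomial G β x : ℂ) * b (G x) ξ) =
      (jetMonomial G 0 x : ℂ) * a 0 (G x) ξ := Finsupp.sum_single_index (by simp)
  rw [universalExpr, h, h0, jetMonomial_zero, Complex.ofReal_one, one_mul, Finsupp.single_eq_same]

/-- The principal symbol of an admissible elliptic operator does not vanish. -/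
theorem HasUniversalSymbol.principal_ne_zero {P : OpFamily.{u} n}
    {a : ℕ → JetExponent n →₀ ((Fin n → Fin n → ℝ) → Eucl n → ℂ)} (ha : HasUniversalSymbol m P a)
    (ha0 : ∀ β, β ≠ 0 → a 0 β = 0)
    (hell : ∀ (M : SmoothMfd.{u} n) (g : RiemMetric M), IsElliptic m (P M g)) :
    ∀ A ∈ posDefMatrices n, ∀ ξ : Eucl n, ξ ≠ 0 → a 0 0 A ξ ≠ 0 := by
  intro A hA ξ hξ
  -- Every positive definite `A` is the coordinate matrix of a constant metric on `ℝⁿ`; ellipticity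
  -- there, read at the origin, is the claim for `A`.
  have h := (hell (flatMfd n) (flatMetric A hA)).2 (flatCoord n) isLocalCoord_flatCoord _
    (ha.2 _ (flatMetric A hA) _ isLocalCoord_flatCoord) 0 trivial ξ hξ
  rwa [universalExpr_of_eq_zero ha0, metricCoord_flatMetric] at h

end Parametrices

end InvPsiDO

end

/-! ### The proposition -/

theorem mainTheorem12 (n : ℕ) (m : ℂ) (w : ℝ) (P Q : OpFamily.{u} n)
    (hP : IsRiemannianInvariantPsiDO m w P)
    (hadm : IsAdmissible m P)
    (hell : ∀ (M : SmoothMfd.{u} n) (g : RiemMetric M), IsElliptic m (P M g))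
    (hQ : ∀ (M : SmoothMfd.{u} n) (g : RiemMetric M), IsParametrix m (P M g) (Q M g)) :
    IsRiemannianInvariantPsiDO (-m) (-w) Q := by
  refine ⟨fun M g => (hQ M g).1, ?_, fun M g t ht => ?_⟩
  · obtain ⟨a, ha, ha0⟩ := hadm
    have h00 : IsUniversalSymbol n m (a 0 0) := by simpa using ha.1 0 0
    obtain ⟨b, hb, hbτ⟩ := exists_universal_inverse
      (s := fun k => universalExpr (a k)) (fun k => isUniv_universalExpr (ha.1 k)) h00
      (ha.principal_ne_zero ha0 hell) fun G x ξ => universalExpr_of_eq_zero ha0 G x ξ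
    refine ⟨b, hb, fun M g φ hφ => ?_⟩
    obtain ⟨τ, hτ⟩ := (hQ M g).1.local_form φ hφ
    -- The symbol `τ` that `Q` has in this chart is a formal right inverse of that of `P`, hence
    -- equals the universal expression wherever `ξ ≠ 0`.
    exact hτ.congr_symbol (hbτ _ _ (hφ.isMetricOn g) τ
      ((hQ M g).symProd_eq_one (hP.isPsiDO M g) hφ (ha.2 M g φ hφ) hτ))
  · have hc : ((t ^ (-w) : ℝ) : ℂ) ≠ 0 := by exact_mod_cast (Real.rpow_pos_of_pos ht _).ne'
    -- The constant is `c = t ^ (-w)`; its inverse is `t ^ (-(-w))`, the factor for weight `-w`.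
    have h := isSmoothing_sub_of_isParametrix (hQ M g) (hQ M (scaleMetric t ht g)) (hell M g)
      (hP.isPsiDO M _) hc (hP.weight M g t ht)
    rwa [← Complex.ofReal_inv, ← Real.rpow_neg ht.le] at h
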